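/- Let $\kappa\in\mathbb{R}$ and $R>0$ with $R^2|\kappa|<1$. Let $M=\mathbb{D}_R=\{z\in\mathbb{C}: |z|\le R\}$ carry the metric $g_\kappa=(1+\kappa|z|^2)^{-2}|dz|^2$ of constant curvature $4\kappa$, with area form $dVol=(1+\kappa|z|^2)^{-2}\,dx\,dy$, and put $w(z)=\frac{1+\kappa|z|^2}{1-\kappa|z|^2}$. Let $\Phi(z)=\frac{1-\kappa R^2}{1-\kappa|z|^2}\frac{z}{R}$, a diffeomorphism of $\mathbb{D}_R$ onto the closed unit disk $\mathbb{D}_1$, and let $$\mathcal{L}=w\,\Phi^*\mathcal{L}_e(\Phi^{-1})^*\tfrac1w,\qquad \mathcal{L}_e=-\Big((1-\rho^2)\partial_\rho^2+\big(\tfrac1\rho-3\rho\big)\partial_\rho+\tfrac1{\rho^2}\partial_\omega^2\Big)+1$$ ($\mathcal{L}_e$ in polar coordinates $\rho e^{i\omega}$ on $\mathbb{D}_1$; for $\kappa=0$, $R=1$ one has $w=1$, $\Phi=\mathrm{id}$, $\mathcal{L}=\mathcal{L}_e$). Regard $\mathcal{L}$ as a self-adjoint operator on the space $L^2(M,w\,dVol)$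 of complex-valued functions: $\mathcal{L}f=g$ means $(f,\mathcal{L}\varphi)=(g,\varphi)$ for all $\varphi\in C^\infty(M)$, where $C^\infty(M)$ is the space of functions smooth on the closed disk up to the boundary. Its real powers are taken in an orthonormal basis of eigenfunctions. For $s\ge 0$ let $$\widetilde H^s(M)=\{f\in L^2(M,w\,dVol):\ \mathcal{L}^{s/2}f\in L^2(M,w\,dVol)\}.$$ Let $Z^e_{n,k}(z)=\frac1{k!}\partial_z^k\big[z^n(\tfrac1z-\bar z)^k\big]$ for $0\le k\le n$ be the Zernike polynomials on $\mathbb{D}_1$, let $Z_{n,k}=w\,\Phi^*Z^e_{n,k}$, and let $\widehat{Z_{n,k}}$ be $Z_{n,k}$ normalized in $L^2(M,w\,dVol)$. Then, for every $s\ge0$, $$\widetilde H^s(M)=\Big\{f=\sum_{n\ge0}\sum_{k=0}^n f_{n,k}\widehat{Z_{n,k}}:\ \sum_{n\ge0}(n+1)^{2s}\sum_{k=0}^n|f_{n,k}|^2<\infty\Big\},$$ and $$\bigcap_{s\ge0}\widetilde H^s(M)=C^\infty(M).$$ -/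

import Mathlib

open Set Filter Topology MeasureTheory
open scoped ContDiff

noncomputable section

namespace GeodesicDisk

/-! ### The disk model

The closed disk of radius `R` about `0` in `ℂ`, with the metric `(1 + κ|z|²)⁻² |dz|²` of constant
curvature `4κ`; its area form is `(1 + κ|z|²)⁻² dx dy`. -/

/-- The weight `w(z) = (1 + κ|z|²) / (1 - κ|z|²)`. -/
def weight (κ : ℝ) (z : ℂ) : ℝ := (1 + κ * ‖z‖ ^ 2) / (1 - κ * ‖z‖ ^ 2)

/-- The measure `w dVol` on the closed disk of radius `R`. -/
def weightedVolume (κ R : ℝ) : Measure ℂ :=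
  (volume.restrict (Metric.closedBall (0 : ℂ) R)).withDensity
    fun z => ENNReal.ofReal (weight κ z * (1 / (1 + κ * ‖z‖ ^ 2) ^ 2))

/-- The Hilbert space `L²(M, w dVol)` of complex-valued functions. -/
abbrev L2 (κ R : ℝ) : Type := Lp ℂ 2 (weightedVolume κ R)

/-- The function `u` is smooth on the closed disk of radius `R`, up to and including the boundary:
its values off the disk play no role. -/
def IsSmooth (R : ℝ) (u : ℂ → ℂ) : Prop :=
  ContDiffOn ℝ ∞ u (Metric.closedBall (0 : ℂ) R)

/-- `C^∞(M)` as a subset of `L²(M, w dVol)`. -/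
def smoothFunctions (κ R : ℝ) : Set (L2 κ R) :=
  {f | ∃ u : ℂ → ℂ, IsSmooth R u ∧ f =ᵐ[weightedVolume κ R] u}

/-! ### The intertwining diffeomorphism onto the unit disk -/

/-- `Φ(z) = (1 - κR²) / (1 - κ|z|²) · z / R`, from the disk of radius `R` to the unit disk. -/
def diskMap (κ R : ℝ) (z : ℂ) : ℂ :=
  (((1 - κ * R ^ 2) / (1 - κ * ‖z‖ ^ 2) / R : ℝ) : ℂ) * z

/-- The inverse `Φ⁻¹` from the unit disk to the disk of radius `R`, in closed form. -/
def diskMapInv (κ R : ℝ) (ζ : ℂ) : ℂ :=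
  ((2 * R / (1 - κ * R ^ 2 + √((1 - κ * R ^ 2) ^ 2 + 4 * κ * R ^ 2 * ‖ζ‖ ^ 2)) : ℝ) : ℂ) * ζ

lemma mul_sq_abs_lt_one {κ R : ℝ} (hκ : R ^ 2 * |κ| < 1) {r : ℝ} (h0 : 0 ≤ r) (hr : r ≤ R) :
    |κ * r ^ 2| < 1 := by
  rw [abs_mul, abs_of_nonneg (sq_nonneg r)]
  have : r ^ 2 ≤ R ^ 2 := by gcongr
  nlinarith [abs_nonneg κ]

lemma diskMapInv_diskMap {κ R : ℝ} (hR : 0 < R) (hκ : R ^ 2 * |κ| < 1) {z : ℂ}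
    (hz : z ∈ Metric.closedBall (0 : ℂ) R) : diskMapInv κ R (diskMap κ R z) = z := by
  have hz' : ‖z‖ ≤ R := by simpa using hz
  have h1 := abs_lt.mp (mul_sq_abs_lt_one hκ (norm_nonneg z) hz')
  have h2 := abs_lt.mp (mul_sq_abs_lt_one hκ hR.le le_rfl)
  have hd : 0 < 1 - κ * ‖z‖ ^ 2 := by linarith
  have hc : 0 < 1 - κ * R ^ 2 := by linarith
  have hn : ‖diskMap κ R z‖ = (1 - κ * R ^ 2) / (1 - κ * ‖z‖ ^ 2) / R * ‖z‖ := by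
    rw [diskMap, norm_mul, Complex.norm_real, Real.norm_of_nonneg (by positivity)]
  have hs : √((1 - κ * R ^ 2) ^ 2 + 4 * κ * R ^ 2 * ‖diskMap κ R z‖ ^ 2)
      = (1 - κ * R ^ 2) * (1 + κ * ‖z‖ ^ 2) / (1 - κ * ‖z‖ ^ 2) := by
    rw [Real.sqrt_eq_iff_mul_self_eq_of_pos, hn]
    · field_simp
      ring
    · have : 0 < 1 + κ * ‖z‖ ^ 2 := by linarith
      positivity
  rw [diskMapInv, hs, diskMap, ← mul_assoc, ← Complex.ofReal_mul]
  have : 2 * R / (1 - κ * R ^ 2 + (1 - κ * R ^ 2) * (1 + κ * ‖z‖ ^ 2) / (1 - κ * ‖z‖ ^ 2)) *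
      ((1 - κ * R ^ 2) / (1 - κ * ‖z‖ ^ 2) / R) = 1 := by
    have e : 1 - κ * R ^ 2 + (1 - κ * R ^ 2) * (1 + κ * ‖z‖ ^ 2) / (1 - κ * ‖z‖ ^ 2)
        = 2 * (1 - κ * R ^ 2) / (1 - κ * ‖z‖ ^ 2) := by
      field_simp
      ring
    rw [e]
    field_simp
    exact div_self (by nlinarith)
  rw [this]
  simp

lemma diskMap_diskMapInv {κ R : ℝ} (hR : 0 < R) (hκ : R ^ 2 * |κ| < 1) {ζ : ℂ}
    (hζ : ζ ∈ Metric.closedBall (0 : ℂ) 1) : diskMap κ R (diskMapInv κ R ζ) = ζ := by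
  have hζ' : ‖ζ‖ ≤ 1 := by simpa using hζ
  have h2 := abs_lt.mp (mul_sq_abs_lt_one hκ hR.le le_rfl)
  have hc : 0 < 1 - κ * R ^ 2 := by linarith
  have hq : ‖ζ‖ ^ 2 ≤ 1 := by nlinarith [norm_nonneg ζ]
  have hD : 0 < (1 - κ * R ^ 2) ^ 2 + 4 * κ * R ^ 2 * ‖ζ‖ ^ 2 := by
    have h3 : 0 < (1 + κ * R ^ 2) ^ 2 := pow_pos (by linarith) 2
    have h4 : 0 < (1 - κ * R ^ 2) ^ 2 := pow_pos hc 2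
    rcases le_or_gt 0 κ with hk | hk
    · have : 0 ≤ 4 * κ * R ^ 2 * ‖ζ‖ ^ 2 := by positivity
      linarith
    · have : 0 ≤ (-κ) * R ^ 2 * (1 - ‖ζ‖ ^ 2) :=
        mul_nonneg (mul_nonneg (by linarith) (sq_nonneg R)) (by linarith)
      nlinarith
  set S := √((1 - κ * R ^ 2) ^ 2 + 4 * κ * R ^ 2 * ‖ζ‖ ^ 2) with hS
  have hS0 : 0 < S := Real.sqrt_pos.mpr hD
  have hSS : S ^ 2 = (1 - κ * R ^ 2) ^ 2 + 4 * κ * R ^ 2 * ‖ζ‖ ^ 2 := Real.sq_sqrt hD.le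
  have hn : ‖diskMapInv κ R ζ‖ = 2 * R / (1 - κ * R ^ 2 + S) * ‖ζ‖ := by
    rw [diskMapInv, norm_mul, Complex.norm_real, Real.norm_of_nonneg (by positivity)]
  have e : 1 - κ * ‖diskMapInv κ R ζ‖ ^ 2 = 2 * (1 - κ * R ^ 2) / (1 - κ * R ^ 2 + S) := by
    rw [hn]
    have : 0 < 1 - κ * R ^ 2 + S := by linarith
    field_simp
    nlinarith
  rw [diskMap, e, diskMapInv, ← hS, ← mul_assoc, ← Complex.ofReal_mul]
  have : (1 - κ * R ^ 2) / (2 * (1 - κ * R ^ 2) / (1 - κ * R ^ 2 + S)) / R *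
      (2 * R / (1 - κ * R ^ 2 + S)) = 1 := by
    have : 0 < 1 - κ * R ^ 2 + S := by linarith
    field_simp
  rw [this]
  simp

/-! ### The operator `𝓛` -/

/-- The operator of the Euclidean unit disk in polar coordinates `z = ρ e^{iθ}`,
`-((1 - ρ²) ∂_ρ² + (1/ρ - 3ρ) ∂_ρ + ρ⁻² ∂_θ²) + 1`. The value at the single point `0`, where polar
coordinates degenerate, is irrelevant: the operator is only ever used under an integral. -/
def euclideanOp (u : ℂ → ℂ) (z : ℂ) : ℂ :=
  let ρ : ℝ := ‖z‖
  let θ : ℝ := Complex.arg z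
  let radial : ℝ → ℂ := fun r => u (r * Complex.exp (θ * Complex.I))
  let angular : ℝ → ℂ := fun t => u (ρ * Complex.exp (t * Complex.I))
  u z - (((1 - ρ ^ 2 : ℝ) : ℂ) * iteratedDeriv 2 radial ρ
      + ((1 / ρ - 3 * ρ : ℝ) : ℂ) * deriv radial ρ
      + ((1 / ρ ^ 2 : ℝ) : ℂ) * iteratedDeriv 2 angular θ)

/-- The differential operator `𝓛 = w Φ^* 𝓛_e (Φ⁻¹)^* (1/w)` on the disk of radius `R`, where `𝓛_e`
is the operator of the Euclidean unit disk. -/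
def diskOp (κ R : ℝ) (u : ℂ → ℂ) (z : ℂ) : ℂ :=
  weight κ z * euclideanOp (fun ζ => u (diskMapInv κ R ζ) / weight κ (diskMapInv κ R ζ))
    (diskMap κ R z)

/-- The self-adjoint realization of `𝓛` on `L²(M, w dVol)`, as a relation: `𝓛 f = g` in the sense
that `(f, 𝓛 φ) = (g, φ)` for all `φ ∈ C^∞(M)`. It is the adjoint of `𝓛` with domain `C^∞(M)`; the
test functions need not vanish near the boundary. -/
def IsImage (κ R : ℝ) (f g : L2 κ R) : Prop :=
  ∀ φ : ℂ → ℂ, IsSmooth R φ →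
    ∫ z, f z * starRingEnd ℂ (diskOp κ R φ z) ∂(weightedVolume κ R)
      = ∫ z, g z * starRingEnd ℂ (φ z) ∂(weightedVolume κ R)

/-! ### Real powers and the Hilbert scale -/

/-- `A^t f = g`, for the real power `A^t` of a positive self-adjoint operator `A` (given by its
graph) with purely discrete spectrum: there is an orthonormal basis `(b_i)` of eigenvectors,
`A b_i = λ_i b_i` with `λ_i > 0`, and `(b_i, g) = λ_i^t (b_i, f)` for all `i`. -/
def IsPowerImage {H : Type} [NormedAddCommGroup H] [InnerProductSpace ℂ H]
    (A : H → H → Prop) (t : ℝ) (f g : H) : Prop :=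
  ∃ (ι : Type) (b : HilbertBasis ι ℂ H) (lam : ι → ℝ),
    (∀ i, 0 < lam i ∧ A (b i) ((lam i : ℂ) • b i)) ∧
    ∀ i, inner ℂ (b i) g = ((lam i ^ t : ℝ) : ℂ) * inner ℂ (b i) f

/-- The space of all `f ∈ L²(M, w dVol)` with `𝓛^{s/2} f ∈ L²(M, w dVol)`. -/
def hilbertScale (κ R s : ℝ) : Set (L2 κ R) :=
  {f | ∃ g : L2 κ R, IsPowerImage (IsImage κ R) (s / 2) f g}

/-! ### The Zernike scale -/

/-- The Zernike polynomial `Z_{n,k} = (1/k!) ∂_z^k [z^n (1/z - z̄)^k]`, `0 ≤ k ≤ n`, on the unit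
disk. Note `z^n (1/z - z̄)^k = z^{n-k} (1 - z z̄)^k`; the operator `∂_z` treats `z̄` as a
constant. -/
def zernikePoly (n k : ℕ) (z : ℂ) : ℂ :=
  (1 / (k.factorial : ℂ)) *
    iteratedDeriv k (fun ζ : ℂ => ζ ^ (n - k) * (1 - ζ * starRingEnd ℂ z) ^ k) z

/-- `Z_{n,k} = w Φ^* Z_{n,k}^e` on the disk of radius `R`. -/
def zernike (κ R : ℝ) (n k : ℕ) (z : ℂ) : ℂ :=
  weight κ z * zernikePoly n k (diskMap κ R z)

/-- `Z_{n,k}` normalized in `L²(M, w dVol)`. -/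
def zernikeHat (κ R : ℝ) (n k : ℕ) (z : ℂ) : ℂ :=
  zernike κ R n k z / ((eLpNorm (zernike κ R n k) 2 (weightedVolume κ R)).toReal : ℂ)

/-- The space of all sums `f = ∑_{n ≥ 0} ∑_{k ≤ n} f_{n,k} Ẑ_{n,k}`, convergent in
`L²(M, w dVol)`, with `∑_n (n+1)^{2s} ∑_{k ≤ n} |f_{n,k}|² < ∞`. -/
def zernikeScale (κ R s : ℝ) : Set (L2 κ R) :=
  {f | ∃ c : ℕ → ℕ → ℂ,
    Tendsto (fun N : ℕ => eLpNorm (fun z => f z - ∑ n ∈ Finset.range N,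
      ∑ k ∈ Finset.range (n + 1), c n k * zernikeHat κ R n k z) 2 (weightedVolume κ R))
      atTop (𝓝 0) ∧
    Summable fun n : ℕ =>
      ((n : ℝ) + 1) ^ (2 * s) * ∑ k ∈ Finset.range (n + 1), ‖c n k‖ ^ 2}

end GeodesicDisk

end

/-! Conjugation by `Φ` and `w` moves everything to the flat unit disk. The Jacobian of `Φ` is such
that `u ↦ w · (u ∘ Φ)` (`pull`) preserves integrals of products against `w dVol`, up to the constant
`scaleSq`; it respects smoothness up to the boundary and turns the Euclidean operator into `𝓛`. Away
from the origin the Euclidean operator is the divergence-form operator `divOp`. Its weight `1 - ρ²`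
vanishes on the circle and `∂_θ` is tangent to it, so `divOp` is symmetric on all functions smooth
up to the boundary, with no boundary condition (`integral_mul_divOp`).

The Zernike polynomials are, up to sign, the coefficients of `G = 1 / (1 - z a - z̄ b + a b)`
(`zernikePoly_eq`). Identities between `G`, `G²` and `2 G³` give their derivatives and show that
they are eigenfunctions with eigenvalue `(n + 1)²` (`divOp_genPoly`). Symmetry of `divOp` together
with rotation invariance gives orthogonality, the divergence theorem gives the norms, and
Stone–Weierstrass gives completeness (`dense_genSpan`, `eq_zero_of_inner_zernikeVec`). This produces
the Hilbert basis `zernikeBasis`. Zernike functions are themselves admissible test functions, so `𝓛`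
is diagonal in that basis, and its powers are too, whichever eigenbasis defines them
(`IsPowerImage.inner_eq`). Thus `𝓛^{s/2}` multiplies coefficients by `(n + 1)^s`, and the first
claim is Riesz–Fischer.

For the intersection, `𝓛` preserves smooth functions, and iterating it forces their coefficients to
decay faster than any power. Conversely, each derivative of a Zernike polynomial is bounded on the
closed disk by a power of `n` (`norm_iteratedFDeriv_genPoly_le`). Rapidly decaying coefficients
therefore give a series converging with all derivatives up to the boundary, and by completeness its
sum is `f` (`mem_smoothFunctions`). -/

namespace GeodesicDisk

/-! ### Zernike polynomials through their generating function

With `G = 1 / (1 - z a - z̄ b + a b)`, the coefficients of `aⁱ bʲ` in `G`, `G²` and `2 G³` are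
`genPoly (i+1) (j+1)`, `genPolySq (i+1) (j+1)` and `genPolyCube (i+1) (j+1)`; entries with a zero
index vanish. -/

/-- The array of coefficients of `S / (1 - z a - z̄ b + a b)`, where `S` has the coefficients
`s i j`, with both indices shifted by one. -/
noncomputable def genSolve (s : ℕ → ℕ → ℂ → ℂ) : ℕ → ℕ → ℂ → ℂ
  | 0, _, _ => 0
  | _ + 1, 0, _ => 0
  | i + 1, j + 1, z => z * genSolve s i (j + 1) z + starRingEnd ℂ z * genSolve s (i + 1) j z
      - genSolve s i j z + s i j z
  termination_by i j => (i, j)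

@[simp] lemma genSolve_zero_left (s : ℕ → ℕ → ℂ → ℂ) (j : ℕ) (z : ℂ) : genSolve s 0 j z = 0 := by
  rw [genSolve]

@[simp] lemma genSolve_zero_right (s : ℕ → ℕ → ℂ → ℂ) (i : ℕ) (z : ℂ) : genSolve s i 0 z = 0 := by
  cases i <;> rw [genSolve]

lemma genSolve_succ (s : ℕ → ℕ → ℂ → ℂ) (i j : ℕ) (z : ℂ) :
    genSolve s (i + 1) (j + 1) z = z * genSolve s i (j + 1) z
      + starRingEnd ℂ z * genSolve s (i + 1) j z - genSolve s i j z + s i j z := by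
  rw [genSolve]

/-- A double induction adapted to the recursion of `genSolve`. -/
lemma genSolve_induction {p : ℕ → ℕ → Prop} (hl : ∀ j, p 0 j) (hr : ∀ i, p i 0)
    (h : ∀ i j, p i (j + 1) → p (i + 1) j → p i j → p (i + 1) (j + 1)) (i j : ℕ) : p i j := by
  induction i generalizing j with
  | zero => exact hl j
  | succ i ih =>
    induction j with
    | zero => exact hr _
    | succ j ihj => exact h i j (ih _) ihj (ih _)

lemma conj_genSolve {s : ℕ → ℕ → ℂ → ℂ}
    (hs : ∀ i j z, starRingEnd ℂ (s i j z) = s j i z) (i j : ℕ) (z : ℂ) :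
    starRingEnd ℂ (genSolve s i j z) = genSolve s j i z := by
  induction i, j using genSolve_induction with
  | hl j => simp
  | hr i => simp
  | h i j h1 h2 h3 =>
    rw [genSolve_succ, genSolve_succ]
    simp only [map_add, map_sub, map_mul, h1, h2, h3, hs, Complex.conj_conj]
    ring

/-- The Zernike polynomial with leading term a multiple of `z^(i-1) z̄^(j-1)`. -/
noncomputable def genPoly : ℕ → ℕ → ℂ → ℂ :=
  genSolve fun i j _ => if i = 0 ∧ j = 0 then 1 else 0

/-- The coefficients of `G²`. -/
noncomputable def genPolySq : ℕ → ℕ → ℂ → ℂ := genSolve fun i j => genPoly (i + 1) (j + 1)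

/-- The coefficients of `2 G³`. -/
noncomputable def genPolyCube : ℕ → ℕ → ℂ → ℂ :=
  genSolve fun i j z => 2 * genPolySq (i + 1) (j + 1) z

@[simp] lemma genPoly_zero_left (j : ℕ) (z : ℂ) : genPoly 0 j z = 0 := genSolve_zero_left ..
@[simp] lemma genPoly_zero_right (i : ℕ) (z : ℂ) : genPoly i 0 z = 0 := genSolve_zero_right ..
@[simp] lemma genPolySq_zero_left (j : ℕ) (z : ℂ) : genPolySq 0 j z = 0 := genSolve_zero_left ..
@[simp] lemma genPolySq_zero_right (i : ℕ) (z : ℂ) : genPolySq i 0 z = 0 := genSolve_zero_right ..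
@[simp] lemma genPolyCube_zero_left (j : ℕ) (z : ℂ) : genPolyCube 0 j z = 0 :=
  genSolve_zero_left ..
@[simp] lemma genPolyCube_zero_right (i : ℕ) (z : ℂ) : genPolyCube i 0 z = 0 :=
  genSolve_zero_right ..

lemma genPoly_succ (i j : ℕ) (z : ℂ) :
    genPoly (i + 1) (j + 1) z = z * genPoly i (j + 1) z + starRingEnd ℂ z * genPoly (i + 1) j z
      - genPoly i j z + if i = 0 ∧ j = 0 then 1 else 0 := genSolve_succ ..

lemma genPolySq_succ (i j : ℕ) (z : ℂ) :
    genPolySq (i + 1) (j + 1) z = z * genPolySq i (j + 1) z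
      + starRingEnd ℂ z * genPolySq (i + 1) j z - genPolySq i j z + genPoly (i + 1) (j + 1) z :=
  genSolve_succ ..

lemma genPolyCube_succ (i j : ℕ) (z : ℂ) :
    genPolyCube (i + 1) (j + 1) z = z * genPolyCube i (j + 1) z
      + starRingEnd ℂ z * genPolyCube (i + 1) j z - genPolyCube i j z
      + 2 * genPolySq (i + 1) (j + 1) z :=
  genSolve_succ ..

lemma conj_genPoly (i j : ℕ) (z : ℂ) : starRingEnd ℂ (genPoly i j z) = genPoly j i z :=
  conj_genSolve (fun i j z => by simp [and_comm, apply_ite (starRingEnd ℂ)]) i j z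

lemma conj_genPolySq (i j : ℕ) (z : ℂ) : starRingEnd ℂ (genPolySq i j z) = genPolySq j i z :=
  conj_genSolve (fun _ _ z => conj_genPoly _ _ z) i j z

lemma conj_genPolyCube (i j : ℕ) (z : ℂ) :
    starRingEnd ℂ (genPolyCube i j z) = genPolyCube j i z :=
  conj_genSolve (fun i j z => by rw [map_mul, conj_genPolySq, map_ofNat]) i j z

@[simp] lemma genPoly_one_one (z : ℂ) : genPoly 1 1 z = 1 := by
  simpa using genPoly_succ 0 0 z

/-- Coefficient form of `a ∂_a G = a (z - b) G²`; the analogue one level up is `a ∂_a G² = a (z - b)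
· 2 G³`. -/
lemma mul_genPoly_left (i j : ℕ) (z : ℂ) :
    (i : ℂ) * genPoly (i + 1) (j + 1) z = z * genPolySq i (j + 1) z - genPolySq i j z := by
  induction i generalizing j with
  | zero => simp
  | succ i ih =>
    induction j with
    | zero =>
      have h := ih 0
      have h1 := genPolySq_succ i 0 z
      have h2 := genPoly_succ (i + 1) 0 z
      simp at h h1 h2 ⊢
      rw [h1, h2]
      linear_combination z * h
    | succ j ihj =>
      have h1 := ih (j + 1)
      have h2 := ih j
      have h3 := genPolySq_succ i (j + 1) z
      have h4 := genPoly_succ (i + 1) (j + 1) z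
      have h5 := genPolySq_succ i j z
      simp at h1 h2 h3 h4 h5 ihj ⊢
      linear_combination z * h1 + starRingEnd ℂ z * ihj - h2 + (i + 1) * h4 - z * h3 + h5

lemma mul_genPoly_right (i j : ℕ) (z : ℂ) :
    (j : ℂ) * genPoly (i + 1) (j + 1) z
      = starRingEnd ℂ z * genPolySq (i + 1) j z - genPolySq i j z := by
  have := congrArg (starRingEnd ℂ) (mul_genPoly_left j i z)
  simpa [conj_genPoly, conj_genPolySq] using this

lemma mul_genPolySq_left (i j : ℕ) (z : ℂ) :
    (i : ℂ) * genPolySq (i + 1) (j + 1) z = z * genPolyCube i (j + 1) z - genPolyCube i j z := by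
  induction i generalizing j with
  | zero => simp
  | succ i ih =>
    induction j with
    | zero =>
      have h := ih 0
      have h1 := genPolyCube_succ i 0 z
      have h2 := genPolySq_succ (i + 1) 0 z
      have h3 := mul_genPoly_left (i + 1) 0 z
      simp at h h1 h2 h3 ⊢
      linear_combination z * h - z * h1 + (i + 1) * h2 + h3
    | succ j ihj =>
      have h1 := ih (j + 1)
      have h2 := ih j
      have h3 := genPolyCube_succ i (j + 1) z
      have h4 := genPolySq_succ (i + 1) (j + 1) z
      have h5 := genPolyCube_succ i j z
      have h6 := mul_genPoly_left (i + 1) (j + 1) z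
      simp at h1 h2 h3 h4 h5 h6 ihj ⊢
      linear_combination z * h1 + starRingEnd ℂ z * ihj - h2 + (i + 1) * h4 - z * h3 + h5 + h6

lemma mul_genPolySq_right (i j : ℕ) (z : ℂ) :
    (j : ℂ) * genPolySq (i + 1) (j + 1) z
      = starRingEnd ℂ z * genPolyCube (i + 1) j z - genPolyCube i j z := by
  have := congrArg (starRingEnd ℂ) (mul_genPolySq_left j i z)
  simpa [conj_genPolySq, conj_genPolyCube] using this

/-- Coefficient form of `(1 - a b) G² = (1 + a ∂_a + b ∂_b) G`. It expresses the coefficients of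
`G²` as sums of Zernike polynomials along a diagonal, which drives both the derivative bounds and
the norm computation. -/
lemma genPolySq_eq_add (i j : ℕ) (z : ℂ) :
    genPolySq (i + 1) (j + 1) z = genPolySq i j z + ((i : ℂ) + j + 1) * genPoly (i + 1) (j + 1) z := by
  linear_combination genPolySq_succ i j z - mul_genPoly_left i j z - mul_genPoly_right i j z

lemma genPolyCube_eq_add (i j : ℕ) (z : ℂ) :
    genPolyCube (i + 1) (j + 1) z
      = genPolyCube i j z + ((i : ℂ) + j + 2) * genPolySq (i + 1) (j + 1) z := by
  linear_combination genPolyCube_succ i j z - mul_genPolySq_left i j z - mul_genPolySq_right i j z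

/-- The three-term relation for multiplication by `z`. -/
lemma mul_self_genPoly (i j : ℕ) (z : ℂ) :
    ((i : ℂ) + j + 1) * (z * genPoly (i + 1) (j + 1) z)
      = (i + 1) * genPoly (i + 2) (j + 1) z + j * genPoly (i + 1) j z := by
  have h1 := mul_genPoly_left (i + 1) j z
  have h2 := genPolySq_eq_add i j z
  push_cast at h1
  rcases j with _ | j
  · simp only [genPolySq_zero_right, genPoly_zero_right, Nat.cast_zero] at h1 h2 ⊢
    linear_combination -h1 - z * h2
  have h3 := mul_genPoly_left i j z
  have h4 := genPolySq_eq_add i j z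
  push_cast at h2 ⊢
  linear_combination -h1 - z * h2 + h3 + h4

/-! ### Derivatives -/

/-- Since `∂_z G = a G²`, one has `∂_z (S G) = a T G` with `T = S G + a⁻¹ ∂_z S`, and likewise `∂_z̄
(S G) = b T G`. Multiplication by the formal variable `a` or `b` is the index shift; the truncated
subtraction is harmless because row and column zero vanish. -/
lemma hasFDerivAt_genSolve {s t a b : ℕ → ℕ → ℂ → ℂ}
    (ha : ∀ j z, a 0 j z = 0) (hb : ∀ i z, b i 0 z = 0)
    (hs : ∀ i j z, HasFDerivAt (𝕜 := ℝ) (s i j) (a i j z • ContinuousLinearMap.id ℝ ℂ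
      + b i j z • (Complex.conjCLE : ℂ →L[ℝ] ℂ)) z)
    (hta : ∀ i j z, t i j z = genSolve s (i + 1) (j + 1) z + a (i + 1) j z)
    (htb : ∀ i j z, t i j z = genSolve s (i + 1) (j + 1) z + b i (j + 1) z) (i j : ℕ) (z : ℂ) :
    HasFDerivAt (genSolve s i j) (genSolve t (i - 1) j z • ContinuousLinearMap.id ℝ ℂ
      + genSolve t i (j - 1) z • (Complex.conjCLE : ℂ →L[ℝ] ℂ)) z := by
  induction i, j using genSolve_induction with
  | hl j =>
    have : genSolve s 0 j = fun _ => 0 := by ext; simp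
    rw [this]
    exact (hasFDerivAt_const (0 : ℂ) z).congr_fderiv (by ext; simp)
  | hr i =>
    have : genSolve s i 0 = fun _ => 0 := by ext; simp
    rw [this]
    exact (hasFDerivAt_const (0 : ℂ) z).congr_fderiv (by ext; simp)
  | h i j h1 h2 h3 =>
    have hz : HasFDerivAt (fun z : ℂ => z) (ContinuousLinearMap.id ℝ ℂ) z := hasFDerivAt_id z
    have hc : HasFDerivAt (𝕜 := ℝ) (fun z : ℂ => starRingEnd ℂ z) (Complex.conjCLE : ℂ →L[ℝ] ℂ) z :=
      Complex.conjCLE.hasFDerivAt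
    have key := (((hz.mul h1).add (hc.mul h2)).sub h3).add (hs i j z)
    have e : genSolve s (i + 1) (j + 1) = fun z => z * genSolve s i (j + 1) z
        + starRingEnd ℂ z * genSolve s (i + 1) j z - genSolve s i j z + s i j z := by
      ext; rw [genSolve_succ]
    rw [e]
    refine key.congr_fderiv ?_
    have e1 : genSolve t i (j + 1) z = genSolve s i (j + 1) z + z * genSolve t (i - 1) (j + 1) z
        + starRingEnd ℂ z * genSolve t i j z - genSolve t (i - 1) j z + a i j z := by
      rcases i with _ | i
      · simp [ha]
      · rw [genSolve_succ, hta]; simp; ring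
    have e2 : genSolve t (i + 1) j z = genSolve s (i + 1) j z + z * genSolve t i j z
        + starRingEnd ℂ z * genSolve t (i + 1) (j - 1) z - genSolve t i (j - 1) z + b i j z := by
      rcases j with _ | j
      · simp [hb]
      · rw [genSolve_succ, htb]; simp; ring
    ext v
    simp [e1, e2]
    ring

lemma hasFDerivAt_genPoly (i j : ℕ) (z : ℂ) :
    HasFDerivAt (genPoly i j) (genPolySq (i - 1) j z • ContinuousLinearMap.id ℝ ℂ
      + genPolySq i (j - 1) z • (Complex.conjCLE : ℂ →L[ℝ] ℂ)) z := by
  refine hasFDerivAt_genSolve (a := fun _ _ _ => 0) (b := fun _ _ _ => 0) (by simp) (by simp)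
    (fun i j z => ?_) (fun i j z => by simp [genPoly]) (fun i j z => by simp [genPoly]) i j z
  exact (hasFDerivAt_const _ z).congr_fderiv (by ext; simp)

lemma hasFDerivAt_genPolySq (i j : ℕ) (z : ℂ) :
    HasFDerivAt (genPolySq i j) (genPolyCube (i - 1) j z • ContinuousLinearMap.id ℝ ℂ
      + genPolyCube i (j - 1) z • (Complex.conjCLE : ℂ →L[ℝ] ℂ)) z := by
  refine hasFDerivAt_genSolve (a := fun i j => genPolySq i (j + 1))
    (b := fun i j => genPolySq (i + 1) j) (by simp) (by simp)
    (fun i j z => ?_) (fun i j z => ?_) (fun i j z => ?_) i j z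
  · simpa using hasFDerivAt_genPoly (i + 1) (j + 1) z
  · simp [genPolySq]; ring
  · simp [genPolySq]; ring

lemma contDiff_genSolve {s : ℕ → ℕ → ℂ → ℂ} (hs : ∀ i j, ContDiff ℝ ∞ (s i j)) (i j : ℕ) :
    ContDiff ℝ ∞ (genSolve s i j) := by
  induction i, j using genSolve_induction with
  | hl j => 
    have : genSolve s 0 j = fun _ => 0 := by ext; simp
    rw [this]; exact contDiff_const
  | hr i =>
    have : genSolve s i 0 = fun _ => 0 := by ext; simp
    rw [this]; exact contDiff_const
  | h i j h1 h2 h3 =>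
    have e : genSolve s (i + 1) (j + 1) = fun z => z * genSolve s i (j + 1) z
        + starRingEnd ℂ z * genSolve s (i + 1) j z - genSolve s i j z + s i j z := by
      ext; rw [genSolve_succ]
    have hc : ContDiff ℝ ∞ (fun z : ℂ => starRingEnd ℂ z) := Complex.conjCLE.contDiff
    rw [e]
    exact (((contDiff_id.mul h1).add (hc.mul h2)).sub h3).add (hs i j)

lemma contDiff_genPoly (i j : ℕ) : ContDiff ℝ ∞ (genPoly i j) :=
  contDiff_genSolve (fun _ _ => contDiff_const) i j

lemma contDiff_genPolySq (i j : ℕ) : ContDiff ℝ ∞ (genPolySq i j) :=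
  contDiff_genSolve (fun _ _ => contDiff_genPoly _ _) i j

/-! ### Values on the circle and the bound on the disk -/

/-- When `z z̄ = 1` the denominator of `G` factors as `(1 - z a)(1 - z̄ b)`, so `G` is a product of
two geometric series. -/
lemma genPoly_of_norm_eq_one {z : ℂ} (hz : ‖z‖ = 1) (i j : ℕ) :
    genPoly (i + 1) (j + 1) z = z ^ i * starRingEnd ℂ z ^ j := by
  have hzz : z * starRingEnd ℂ z = 1 := by
    rw [Complex.mul_conj, Complex.normSq_eq_norm_sq, hz]; simp
  induction i generalizing j with
  | zero =>
    induction j with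
    | zero => simp
    | succ j ih => 
      rw [genPoly_succ, ih]; simp; ring
  | succ i ihi =>
    induction j with
    | zero => rw [genPoly_succ, ihi]; simp; ring
    | succ j ih =>
      rw [genPoly_succ, ih, ihi, ihi]
      simp only [Nat.add_eq_zero_iff, one_ne_zero, and_false, and_self, if_false]
      linear_combination (z ^ i * starRingEnd ℂ z ^ j) * hzz

open Polynomial in
/-- The polynomials `∑ genPoly (n + 1 - q) (q + 1) z * X ^ q` in `X`. -/
noncomputable def rowPoly (z : ℂ) : ℕ → ℂ[X]
  | 0 => 1
  | 1 => C z + C (starRingEnd ℂ z) * X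
  | n + 2 => (C z + C (starRingEnd ℂ z) * X) * rowPoly z (n + 1) - X * rowPoly z n

/-- Putting `a = t`, `b = t X` in `G` gives `1 / (1 - (z + z̄ X) t + X t²)`, whose coefficients in
`t` obey the recursion of `rowPoly`. -/
lemma coeff_rowPoly (z : ℂ) (n q : ℕ) :
    (rowPoly z n).coeff q = genPoly (n + 1 - q) (q + 1) z := by
  induction n using Nat.strong_induction_on generalizing q with
  | h n ih =>
    match n with
    | 0 =>
      rcases q with _ | q
      · simp [rowPoly]
      · simp [rowPoly, Polynomial.coeff_one]
    | 1 =>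
      rcases q with _ | _ | q
      · simp [rowPoly, genPoly_succ]
      · simp [rowPoly, Polynomial.coeff_C, genPoly_succ]
      · simp [rowPoly]
    | n + 2 =>
      rw [rowPoly, add_mul, mul_assoc, Polynomial.coeff_sub, Polynomial.coeff_add,
        Polynomial.coeff_C_mul, Polynomial.coeff_C_mul]
      rcases q with _ | q
      · rw [ih (n + 1) (by omega)]
        have := genPoly_succ (n + 2) 0 z
        simp at this ⊢
        rw [this]
      · rw [Polynomial.coeff_X_mul, Polynomial.coeff_X_mul, ih (n + 1) (by omega),
          ih (n + 1) (by omega), ih n (by omega)]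
        rcases le_or_gt q (n + 1) with h | h
        · have e1 : n + 2 + 1 - (q + 1) = (n + 1 - q) + 1 := by omega
          have e2 : n + 1 + 1 - (q + 1) = n + 1 - q := by omega
          have e3 : n + 1 + 1 - q = (n + 1 - q) + 1 := by omega
          rw [e1, e2, e3, genPoly_succ (n + 1 - q) (q + 1)]
          simp only [Nat.add_eq_zero_iff, one_ne_zero, and_false, if_false, add_zero]
        · have e1 : n + 2 + 1 - (q + 1) = 0 := by omega
          have e2 : n + 1 + 1 - (q + 1) = 0 := by omega
          have e3 : n + 1 + 1 - q = 0 := by omega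
          have e4 : n + 1 - q = 0 := by omega
          simp [e1, e2, e3, e4]

/-- Both roots of `λ² - (z + z̄ x) λ + x` have modulus one if `|x| = 1` and `|z| ≤ 1`. -/
lemma exists_unit_roots {z x : ℂ} (hz : ‖z‖ ≤ 1) (hx : ‖x‖ = 1) :
    ∃ l m : ℂ, ‖l‖ = 1 ∧ ‖m‖ = 1 ∧ l + m = z + starRingEnd ℂ z * x ∧ l * m = x := by
  obtain ⟨e, he⟩ : ∃ e : ℂ, e ^ 2 = x := IsAlgClosed.exists_pow_nat_eq x two_pos
  have hen : ‖e‖ = 1 := by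
    rw [← he, norm_pow] at hx
    exact (pow_eq_one_iff_of_nonneg (norm_nonneg e) two_ne_zero).mp hx
  have hee : e * starRingEnd ℂ e = 1 := by
    rw [Complex.mul_conj, Complex.normSq_eq_norm_sq, hen]; simp
  -- Scaling the unknown by a square root `e` of `x` turns the quadratic into `μ² - 2 t μ + 1` with
  -- `t` real and `|t| ≤ 1`; its roots are `exp (± i arccos t)`.
  set t := (starRingEnd ℂ e * z).re with ht
  have ht1 : |t| ≤ 1 := (Complex.abs_re_le_norm _).trans (by simpa [hen] using hz)
  have hcos : Complex.cos (Real.arccos t : ℂ) = t := by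
    rw [← Complex.ofReal_cos, Real.cos_arccos (abs_le.mp ht1).1 (abs_le.mp ht1).2]
  have h2t : 2 * (t : ℂ) = starRingEnd ℂ e * z + e * starRingEnd ℂ z := by
    have := Complex.add_conj (starRingEnd ℂ e * z)
    simp only [map_mul, Complex.conj_conj] at this
    rw [this, ht]
    push_cast
    ring
  refine ⟨e * Complex.exp (Real.arccos t * Complex.I),
    e * Complex.exp (-Real.arccos t * Complex.I), ?_, ?_, ?_, ?_⟩
  · rw [norm_mul, hen, Complex.norm_exp_ofReal_mul_I, one_mul]
  · rw [norm_mul, hen, ← Complex.ofReal_neg, Complex.norm_exp_ofReal_mul_I, one_mul]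
  · rw [← mul_add, ← Complex.two_cos, hcos, h2t, ← he]
    linear_combination z * hee
  · rw [mul_mul_mul_comm, ← Complex.exp_add, ← he]
    simp [sq]

/-- With unimodular characteristic roots `l`, `m`, the value is the complete homogeneous sum `∑
l^(n-k) m^k`, which has `n + 1` terms of modulus one. -/
lemma norm_eval_rowPoly_le {z x : ℂ} (hz : ‖z‖ ≤ 1) (hx : ‖x‖ = 1) (n : ℕ) :
    ‖(rowPoly z n).eval x‖ ≤ n + 1 := by
  obtain ⟨l, m, hl, hm, hs, hp⟩ := exists_unit_roots hz hx
  have key : ∀ n, (rowPoly z (n + 1)).eval x = l * (rowPoly z n).eval x + m ^ (n + 1) := by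
    intro n
    induction n with
    | zero => simp [rowPoly]; linear_combination -hs
    | succ n ih =>
      have : (rowPoly z (n + 2)).eval x
          = (l + m) * (rowPoly z (n + 1)).eval x - x * (rowPoly z n).eval x := by
        rw [rowPoly, hs]; simp
      rw [this]
      linear_combination m * ih + (rowPoly z n).eval x * hp
  induction n with
  | zero => simp [rowPoly]
  | succ n ih =>
    rw [key]
    refine (norm_add_le _ _).trans ?_
    rw [norm_mul, norm_pow, hl, hm, one_pow, one_mul]
    push_cast
    linarith

lemma iteratedDeriv_eval (p : Polynomial ℂ) (n : ℕ) :
    iteratedDeriv n (fun x => p.eval x) = fun x => (Polynomial.derivative^[n] p).eval x := by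
  induction n generalizing p with
  | zero => simp
  | succ n ih =>
    have : deriv (fun x => p.eval x) = fun x => p.derivative.eval x := by ext; simp
    rw [iteratedDeriv_succ', this, ih, Function.iterate_succ_apply]

/-- Cauchy's estimate on the unit circle for a coefficient of `rowPoly`. -/
lemma norm_genPoly_succ_le {z : ℂ} (hz : ‖z‖ ≤ 1) (i j : ℕ) :
    ‖genPoly (i + 1) (j + 1) z‖ ≤ i + j + 1 := by
  have h1 := coeff_rowPoly z (i + j) j
  rw [show i + j + 1 - j = i + 1 by omega] at h1
  rw [← h1]
  have h2 := Complex.norm_iteratedDeriv_le_of_forall_mem_sphere_norm_le (c := 0) (R := 1)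
    (C := ((i + j : ℕ) : ℝ) + 1) (f := fun x => (rowPoly z (i + j)).eval x) j one_pos
    ((rowPoly z (i + j)).differentiable.diffContOnCl)
    (fun x hx => norm_eval_rowPoly_le hz (by simpa using hx) _)
  simp only [iteratedDeriv_eval] at h2
  rw [← Polynomial.coeff_zero_eq_eval_zero,
    Polynomial.coeff_iterate_derivative, zero_add, Nat.descFactorial_self, nsmul_eq_mul,
    norm_mul, Complex.norm_natCast, one_pow, div_one] at h2
  have := le_of_mul_le_mul_left h2 (by positivity)
  simpa using this

lemma norm_genPoly_le {z : ℂ} (hz : ‖z‖ ≤ 1) (i j : ℕ) : ‖genPoly i j z‖ ≤ i + j + 1 := by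
  rcases i with _ | i
  · simp; positivity
  rcases j with _ | j
  · simp; positivity
  refine (norm_genPoly_succ_le hz i j).trans ?_
  push_cast
  linarith

/-! ### The Rodrigues formula -/

open Polynomial in
-- Splitting one factor `X + z` into `X` and `z`, and then peeling off one factor `1 - z̄ (X + z)`
-- from the term with `X`, gives these coefficients the recursion of `genPoly`, up to the sign
-- `(-1)^k`.
lemma coeff_mul_pow_eq_genPoly (z : ℂ) (m k : ℕ) :
    ((X + C z) ^ m * (1 - C (starRingEnd ℂ z) * (X + C z)) ^ k).coeff k
      = (-1) ^ k * genPoly (m + 1) (k + 1) z := by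
  set w := starRingEnd ℂ z with hw
  induction m generalizing k with
  | zero =>
    have h : ∀ k, genPoly 1 (k + 1) z = w ^ k := by
      intro k
      induction k with
      | zero => simp
      | succ k ih => rw [genPoly_succ, ih]; simp [pow_succ', hw]
    have e : (1 : ℂ[X]) - C w * (X + C z) = C (-w) * X + C (1 - w * z) := by
      simp only [map_neg, map_sub, map_mul, map_one]; ring
    rw [pow_zero, one_mul, h, e]
    have hd : (C (-w) * X + C (1 - w * z)).natDegree ≤ 1 := natDegree_linear_le
    have := coeff_pow_of_natDegree_le hd (m := k)
    rw [mul_one] at this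
    rw [this, coeff_add, coeff_C_mul, coeff_X_one, coeff_C_succ, mul_one, add_zero, neg_pow]
  | succ m ihm =>
    induction k with
    | zero =>
      have h : ∀ k, genPoly (k + 1) 1 z = z ^ k := by
        intro k
        induction k with
        | zero => simp
        | succ k ih => rw [genPoly_succ, ih]; simp [pow_succ']
      rw [h, coeff_zero_eq_eval_zero]
      simp
    | succ k ihk =>
      have e : (X + C z) ^ (m + 1) * (1 - C w * (X + C z)) ^ (k + 1)
          = X * ((X + C z) ^ m * (1 - C w * (X + C z)) ^ k
              - C w * ((X + C z) ^ (m + 1) * (1 - C w * (X + C z)) ^ k))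
            + C z * ((X + C z) ^ m * (1 - C w * (X + C z)) ^ (k + 1)) := by ring
      rw [e, coeff_add, coeff_X_mul, coeff_sub, coeff_C_mul, coeff_C_mul, ihm, ihm, ihk,
        genPoly_succ (m + 1) (k + 1), ← hw]
      simp only [Nat.add_eq_zero_iff, one_ne_zero, and_false, if_false]
      ring

/-- A `k`-th derivative at `z` divided by `k!` is the `k`-th coefficient of the Taylor shift by `z`;
here `z̄` stays a frozen constant. -/
lemma zernikePoly_eq {n k : ℕ} (z : ℂ) :
    zernikePoly n k z = (-1) ^ k * genPoly (n - k + 1) (k + 1) z := by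
  set p : Polynomial ℂ := Polynomial.X ^ (n - k)
    * (1 - Polynomial.C (starRingEnd ℂ z) * Polynomial.X) ^ k with hp
  have h1 : (fun ζ : ℂ => ζ ^ (n - k) * (1 - ζ * starRingEnd ℂ z) ^ k) = fun ζ => p.eval ζ := by
    ext ζ; simp [hp, mul_comm ζ]
  rw [zernikePoly, h1]
  simp only [iteratedDeriv_eval]
  rw [← coeff_mul_pow_eq_genPoly]
  have h2 : (Polynomial.X + Polynomial.C z) ^ (n - k)
      * (1 - Polynomial.C (starRingEnd ℂ z) * (Polynomial.X + Polynomial.C z)) ^ k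
      = Polynomial.taylor z p := by
    simp [hp]
  rw [h2, Polynomial.taylor_coeff, ← Polynomial.factorial_smul_hasseDeriv]
  have : (k.factorial : ℂ) ≠ 0 := by exact_mod_cast k.factorial_ne_zero
  simp [this]

/-! ### Polynomial bounds for all derivatives -/

/-- A coefficient of `G²` is a diagonal sum of Zernike polynomials with weights at most linear in
the index. The weight costs one power of the index and the number of terms another. -/
lemma norm_iteratedFDeriv_genPolySq_le {k m : ℕ} {C : ℝ} {z : ℂ} (hC : 0 ≤ C)
    (h : ∀ i j, ‖iteratedFDeriv ℝ k (genPoly i j) z‖ ≤ C * ((i : ℝ) + j + 1) ^ m) (i j : ℕ) :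
    ‖iteratedFDeriv ℝ k (genPolySq i j) z‖ ≤ C * ((i : ℝ) + j + 1) ^ (m + 2) := by
  induction i, j using genSolve_induction with
  | hl j =>
    have : genPolySq 0 j = fun _ => 0 := by ext; simp
    rw [this, iteratedFDeriv_fun_zero]
    simp; positivity
  | hr i =>
    have : genPolySq i 0 = fun _ => 0 := by ext; simp
    rw [this, iteratedFDeriv_fun_zero]
    simp; positivity
  | h i j _ _ h3 =>
    have e : genPolySq (i + 1) (j + 1)
        = genPolySq i j + ((i : ℂ) + j + 1) • genPoly (i + 1) (j + 1) := by
      ext z; simp [genPolySq_eq_add]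
    have h1 : ContDiff ℝ k (genPolySq i j) := (contDiff_genPolySq i j).of_le (by exact_mod_cast le_top)
    have h2 : ContDiff ℝ k (genPoly (i + 1) (j + 1)) :=
      (contDiff_genPoly _ _).of_le (by exact_mod_cast le_top)
    have h5 : ContDiff ℝ k (((i : ℂ) + j + 1) • genPoly (i + 1) (j + 1)) :=
      (contDiff_const (c := (i : ℂ) + j + 1)).mul h2
    rw [e, iteratedFDeriv_add_apply h1.contDiffAt h5.contDiffAt,
      iteratedFDeriv_const_smul_apply h2.contDiffAt]
    refine (norm_add_le _ _).trans ?_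
    rw [norm_smul]
    have hn : ‖(i : ℂ) + j + 1‖ = (i : ℝ) + j + 1 := by
      rw [← Nat.cast_add, ← Nat.cast_succ, Complex.norm_natCast]; push_cast; ring
    rw [hn]
    have h4 := h (i + 1) (j + 1)
    push_cast at h4 ⊢
    -- One diagonal step changes `M` by `2`, and the induction closes because `(M - 2)² + (M - 2) ≤
    -- M²`, without enlarging `C`.
    set M : ℝ := (i : ℝ) + 1 + (j + 1) + 1 with hM
    have hM2 : (i : ℝ) + j + 1 = M - 2 := by rw [hM]; ring
    rw [hM2] at h3 ⊢
    have hM3 : 0 ≤ M - 2 := by rw [← hM2]; positivity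
    calc _ ≤ C * (M - 2) ^ (m + 2) + (M - 2) * (C * M ^ m) := by gcongr
      _ = C * ((M - 2) ^ m * (M - 2) ^ 2 + (M - 2) * M ^ m) := by ring
      _ ≤ C * (M ^ m * (M - 2) ^ 2 + (M - 2) * M ^ m) := by gcongr; linarith
      _ = C * M ^ m * ((M - 2) ^ 2 + (M - 2)) := by ring
      _ ≤ C * M ^ m * M ^ 2 := by gcongr; nlinarith
      _ = C * M ^ (m + 2) := by ring

/-- Differentiating a coefficient of `G` gives two coefficients of `G²`, so each derivative costs a
factor `2` and two powers of the index. -/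
lemma norm_iteratedFDeriv_genPoly_le {z : ℂ} (hz : ‖z‖ ≤ 1) (k i j : ℕ) :
    ‖iteratedFDeriv ℝ k (genPoly i j) z‖ ≤ 2 ^ k * ((i : ℝ) + j + 1) ^ (2 * k + 1) := by
  induction k generalizing i j with
  | zero => simpa using norm_genPoly_le hz i j
  | succ k ih =>
    have hD := norm_iteratedFDeriv_genPolySq_le (by positivity) ih
    have e : fderiv ℝ (genPoly i j)
        = (fun z => genPolySq (i - 1) j z • ContinuousLinearMap.id ℝ ℂ)
          + fun z => genPolySq i (j - 1) z • (Complex.conjCLE : ℂ →L[ℝ] ℂ) :=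
      funext fun z => (hasFDerivAt_genPoly i j z).fderiv
    have hs : ∀ (a b : ℕ) (A : ℂ →L[ℝ] ℂ), ‖A‖ ≤ 1 → (a : ℝ) + b ≤ i + j →
        ‖iteratedFDeriv ℝ k (fun z => genPolySq a b z • A) z‖
          ≤ 2 ^ k * ((i : ℝ) + j + 1) ^ (2 * (k + 1) + 1) := by
      intro a b A hA hab
      have h1 : ContDiff ℝ k (genPolySq a b) :=
        (contDiff_genPolySq a b).of_le (by exact_mod_cast le_top)
      set L : ℂ →L[ℝ] ℂ →L[ℝ] ℂ := (ContinuousLinearMap.lsmul ℝ ℂ).flip A with hL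
      have hL1 : ‖L‖ ≤ 1 := ContinuousLinearMap.opNorm_le_bound _ zero_le_one fun x => by
        rw [hL, ContinuousLinearMap.flip_apply, ContinuousLinearMap.lsmul_apply, norm_smul, mul_comm]
        gcongr
      have e2 : (fun z => genPolySq a b z • A) = L ∘ genPolySq a b := by ext; simp [hL]
      rw [e2]
      calc _ ≤ ‖L‖ * ‖iteratedFDeriv ℝ k (genPolySq a b) z‖ :=
            L.norm_iteratedFDeriv_comp_left h1.contDiffAt le_rfl
        _ ≤ 1 * (2 ^ k * ((a : ℝ) + b + 1) ^ (2 * k + 1 + 2)) := by gcongr; exact hD a b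
        _ ≤ 2 ^ k * ((i : ℝ) + j + 1) ^ (2 * (k + 1) + 1) := by
          rw [one_mul, show 2 * (k + 1) + 1 = 2 * k + 1 + 2 by ring]; gcongr
    have hc : ∀ (a b : ℕ) (A : ℂ →L[ℝ] ℂ), ContDiff ℝ k (fun z => genPolySq a b z • A) :=
      fun a b A => ((contDiff_genPolySq a b).of_le (by exact_mod_cast le_top)).smul contDiff_const
    rw [← norm_iteratedFDeriv_fderiv, e,
      iteratedFDeriv_add_apply (hc _ _ _).contDiffAt (hc _ _ _).contDiffAt]
    refine (norm_add_le _ _).trans ?_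
    have h1 := hs (i - 1) j (ContinuousLinearMap.id ℝ ℂ) ContinuousLinearMap.norm_id_le
      (by gcongr; omega)
    have h2 := hs i (j - 1) (Complex.conjCLE : ℂ →L[ℝ] ℂ) (by simp)
      (by gcongr; omega)
    calc _ ≤ _ := add_le_add h1 h2
      _ = _ := by ring

/-! ### Derivatives along vector fields on the closed unit disk -/

/-- The derivative of `F` along the vector field `v`, on the closed unit disk. -/
noncomputable def along (v F : ℂ → ℂ) (z : ℂ) : ℂ :=
  fderivWithin ℝ F (Metric.closedBall (0 : ℂ) 1) z (v z)

lemma uniqueDiffOn_closedBall {r : ℝ} (hr : 0 < r) :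
    UniqueDiffOn ℝ (Metric.closedBall (0 : ℂ) r) :=
  uniqueDiffOn_convex (convex_closedBall _ _) (by
    rw [interior_closedBall _ hr.ne']; exact ⟨0, by simpa using hr⟩)

/-- The circle is a null set, so integrals may be computed on the open disk, where genuine two-sided
derivatives exist. -/
lemma volume_restrict_ball_eq (r : ℝ) :
    (volume : Measure ℂ).restrict (Metric.closedBall 0 r)
      = volume.restrict (Metric.ball 0 r) := by
  refine (Measure.restrict_congr_set (ae_eq_of_subset_of_measure_ge Metric.ball_subset_closedBall
    ?_ Metric.isOpen_ball.measurableSet.nullMeasurableSet measure_closedBall_lt_top.ne)).symm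
  rw [Measure.addHaar_closedBall_eq_addHaar_ball]

lemma IsSmooth.continuousOn {r : ℝ} {F : ℂ → ℂ} (hF : IsSmooth r F) :
    ContinuousOn F (Metric.closedBall 0 r) := ContDiffOn.continuousOn hF

lemma _root_.ContDiff.isSmooth {F : ℂ → ℂ} (hF : ContDiff ℝ ∞ F) (r : ℝ) : IsSmooth r F :=
  hF.contDiffOn

lemma IsSmooth.add {r : ℝ} {F G : ℂ → ℂ} (hF : IsSmooth r F) (hG : IsSmooth r G) :
    IsSmooth r (fun z => F z + G z) := ContDiffOn.add hF hG

lemma IsSmooth.sub {r : ℝ} {F G : ℂ → ℂ} (hF : IsSmooth r F) (hG : IsSmooth r G) :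
    IsSmooth r (fun z => F z - G z) := ContDiffOn.sub hF hG

lemma IsSmooth.mul {r : ℝ} {F G : ℂ → ℂ} (hF : IsSmooth r F) (hG : IsSmooth r G) :
    IsSmooth r (fun z => F z * G z) := ContDiffOn.mul hF hG

lemma IsSmooth.integrableOn {r : ℝ} {F : ℂ → ℂ} (hF : IsSmooth r F) :
    IntegrableOn F (Metric.closedBall 0 r) :=
  hF.continuousOn.integrableOn_compact (isCompact_closedBall _ _)

lemma IsSmooth.differentiableWithinAt {F : ℂ → ℂ} (hF : IsSmooth 1 F) {z : ℂ}
    (hz : z ∈ Metric.closedBall (0 : ℂ) 1) :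
    DifferentiableWithinAt ℝ F (Metric.closedBall (0 : ℂ) 1) z :=
  (ContDiffOn.differentiableOn hF (by simp)) z hz

lemma IsSmooth.fderivWithin {F : ℂ → ℂ} (hF : IsSmooth 1 F) :
    ContDiffOn ℝ ∞ (fderivWithin ℝ F (Metric.closedBall (0 : ℂ) 1))
      (Metric.closedBall (0 : ℂ) 1) :=
  ContDiffOn.fderivWithin hF (uniqueDiffOn_closedBall one_pos) (by simp)

lemma IsSmooth.along {v F : ℂ → ℂ} (hF : IsSmooth 1 F) (hv : ContDiff ℝ ∞ v) :
    IsSmooth 1 (along v F) :=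
  hF.fderivWithin.clm_apply hv.contDiffOn

lemma IsSmooth.hasFDerivAt {F : ℂ → ℂ} (hF : IsSmooth 1 F) {z : ℂ}
    (hz : z ∈ Metric.ball (0 : ℂ) 1) :
    HasFDerivAt F (_root_.fderivWithin ℝ F (Metric.closedBall (0 : ℂ) 1) z) z :=
  (hF.differentiableWithinAt (Metric.ball_subset_closedBall hz)).hasFDerivWithinAt.hasFDerivAt
    (mem_of_superset (Metric.isOpen_ball.mem_nhds hz) Metric.ball_subset_closedBall)

lemma along_of_hasFDerivAt {v F : ℂ → ℂ} {F' : ℂ →L[ℝ] ℂ} {z : ℂ} (hF : HasFDerivAt F F' z)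
    (hz : z ∈ Metric.closedBall (0 : ℂ) 1) : along v F z = F' (v z) := by
  rw [along, hF.hasFDerivWithinAt.fderivWithin (uniqueDiffOn_closedBall one_pos z hz)]

lemma along_mul {F G : ℂ → ℂ} (v : ℂ → ℂ) (hF : IsSmooth 1 F) (hG : IsSmooth 1 G) {z : ℂ}
    (hz : z ∈ Metric.closedBall (0 : ℂ) 1) :
    along v (fun z => F z * G z) z = F z * along v G z + G z * along v F z := by
  rw [along, fderivWithin_fun_mul (uniqueDiffOn_closedBall one_pos z hz)
    (hF.differentiableWithinAt hz) (hG.differentiableWithinAt hz)]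
  simp [along]

/-! ### Vanishing integrals of derivatives -/

/-- Fubini, and the fundamental theorem of calculus on each horizontal chord: both endpoints lie on
the circle, where `F` vanishes. -/
lemma integral_along_one_eq_zero {F : ℂ → ℂ} (hF : IsSmooth 1 F) (h0 : ∀ z, ‖z‖ = 1 → F z = 0) :
    ∫ z in Metric.closedBall (0 : ℂ) 1, along (fun _ => 1) F z = 0 := by
  have hg := hF.along (v := fun _ => 1) contDiff_const
  set g := along (fun _ => 1) F with hgdef
  rw [← integral_indicator Metric.isClosed_closedBall.measurableSet,
    ← Complex.volume_preserving_equiv_real_prod.symm.integral_comp'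
      (g := indicator (Metric.closedBall (0 : ℂ) 1) g)]
  have hint : Integrable (fun p : ℝ × ℝ => indicator (Metric.closedBall (0 : ℂ) 1) g
      (Complex.measurableEquivRealProd.symm p)) (volume.prod volume) :=
    Complex.volume_preserving_equiv_real_prod.symm.integrable_comp_emb
      (MeasurableEquiv.measurableEmbedding _) |>.mpr
        (hg.integrableOn.integrable_indicator Metric.isClosed_closedBall.measurableSet)
  rw [Measure.volume_eq_prod, integral_prod_symm _ hint]
  refine integral_eq_zero_of_ae (Eventually.of_forall fun y => ?_)
  simp only [Pi.zero_apply]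
  have hmem : ∀ x : ℝ, Complex.measurableEquivRealProd.symm (x, y) ∈ Metric.closedBall (0 : ℂ) 1
      ↔ x ^ 2 ≤ 1 - y ^ 2 := by
    intro x
    rw [mem_closedBall_zero_iff, ← sq_le_one_iff₀ (norm_nonneg _), ← Complex.normSq_eq_norm_sq,
      Complex.normSq_apply]
    simp
    constructor <;> intro h <;> nlinarith
  rcases lt_or_ge 1 (y ^ 2) with hy | hy
  · refine integral_eq_zero_of_ae (Eventually.of_forall fun x => indicator_of_notMem ?_ _)
    rw [hmem]
    nlinarith [sq_nonneg x]
  set a := √(1 - y ^ 2) with ha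
  have ha0 : 0 ≤ a := Real.sqrt_nonneg _
  have ha2 : a ^ 2 = 1 - y ^ 2 := Real.sq_sqrt (by linarith)
  have e : (fun x : ℝ => indicator (Metric.closedBall (0 : ℂ) 1) g
      (Complex.measurableEquivRealProd.symm (x, y)))
      = indicator (Icc (-a) a) (fun x : ℝ => g (x + y * Complex.I)) := by
    ext x
    have h1 : Complex.measurableEquivRealProd.symm (x, y) = x + y * Complex.I := by
      simp [Complex.ext_iff]
    by_cases hx : x ∈ Icc (-a) a
    · rw [indicator_of_mem hx, indicator_of_mem, h1]
      rw [hmem, ← ha2]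
      exact sq_le_sq' hx.1 hx.2
    · rw [indicator_of_notMem hx, indicator_of_notMem]
      rw [hmem, ← ha2]
      exact fun h => hx (abs_le.mp (abs_le_of_sq_le_sq h ha0))
  have hS : ∀ x ∈ Icc (-a) a, ((x : ℂ) + y * Complex.I) ∈ Metric.closedBall (0 : ℂ) 1 := by
    intro x hx
    have : x ^ 2 ≤ a ^ 2 := sq_le_sq' hx.1 hx.2
    rw [mem_closedBall_zero_iff, ← sq_le_one_iff₀ (norm_nonneg _), ← Complex.normSq_eq_norm_sq,
      Complex.normSq_add_mul_I]
    linarith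
  have hcont : ContinuousOn (fun x : ℝ => (x : ℂ) + y * Complex.I) (Icc (-a) a) := by fun_prop
  rw [e, integral_indicator measurableSet_Icc, integral_Icc_eq_integral_Ioc,
    ← intervalIntegral.integral_of_le (by linarith),
    intervalIntegral.integral_eq_sub_of_hasDerivAt_of_le (by linarith)
      (f := fun x : ℝ => F (x + y * Complex.I)) (hF.continuousOn.comp hcont hS)]
  · have hb : ∀ x : ℝ, x ^ 2 = a ^ 2 → F (x + y * Complex.I) = 0 := by
      intro x hx
      refine h0 _ ?_
      rw [← pow_left_inj₀ (norm_nonneg _) zero_le_one two_ne_zero, ← Complex.normSq_eq_norm_sq,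
        Complex.normSq_add_mul_I]
      linarith
    rw [hb a rfl, hb (-a) (by ring), sub_zero]
  · intro x hx
    have hx' : ((x : ℂ) + y * Complex.I) ∈ Metric.ball (0 : ℂ) 1 := by
      have : x ^ 2 < a ^ 2 := sq_lt_sq' hx.1 hx.2
      rw [mem_ball_zero_iff, ← sq_lt_one_iff₀ (norm_nonneg _), ← Complex.normSq_eq_norm_sq,
        Complex.normSq_add_mul_I]
      linarith
    have h1 : HasDerivAt (fun x : ℝ => (x : ℂ) + y * Complex.I) 1 x :=
      (Complex.ofRealCLM.hasDerivAt).add_const _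
    exact (hF.hasFDerivAt hx').comp_hasDerivAt x h1
  · exact ContinuousOn.intervalIntegrable_of_Icc (by linarith) (hg.continuousOn.comp hcont hS)

lemma setIntegral_mul_unit {u : ℂ} (hu : ‖u‖ = 1) (g : ℂ → ℂ) :
    ∫ z in Metric.closedBall (0 : ℂ) 1, g (u * z) = ∫ z in Metric.closedBall (0 : ℂ) 1, g z := by
  set ρ := rotation ⟨u, mem_sphere_zero_iff_norm.mpr hu⟩ with hρ
  have h := ρ.measurePreserving.setIntegral_preimage_emb
    (ρ.toHomeomorph : ℂ ≃ₜ ℂ).measurableEmbedding g (Metric.closedBall (0 : ℂ) 1)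
  have e : ρ ⁻¹' Metric.closedBall (0 : ℂ) 1 = Metric.closedBall (0 : ℂ) 1 := by
    ext z; simp
  rw [← h, e]
  rfl

/-- A quarter turn reduces this to the horizontal direction. -/
lemma integral_along_I_eq_zero {F : ℂ → ℂ} (hF : IsSmooth 1 F) (h0 : ∀ z, ‖z‖ = 1 → F z = 0) :
    ∫ z in Metric.closedBall (0 : ℂ) 1, along (fun _ => Complex.I) F z = 0 := by
  have hm : MapsTo (fun z : ℂ => Complex.I * z) (Metric.closedBall 0 1) (Metric.closedBall 0 1) := by
    intro z hz; simpa using hz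
  have hFI : IsSmooth 1 (fun z => F (Complex.I * z)) :=
    ContDiffOn.comp hF (by fun_prop) hm
  refine Eq.trans ?_ (integral_along_one_eq_zero hFI fun z hz => h0 _ (by simpa using hz))
  refine (setIntegral_mul_unit Complex.norm_I _).symm.trans ?_
  refine setIntegral_congr_fun (Metric.isClosed_closedBall (x := (0 : ℂ))).measurableSet
    fun z hz => ?_
  have hI : HasFDerivWithinAt (fun z : ℂ => Complex.I * z)
      (Complex.I • ContinuousLinearMap.id ℝ ℂ) (Metric.closedBall 0 1) z := by
    simpa using ((hasFDerivAt_id (𝕜 := ℝ) z).const_mul Complex.I).hasFDerivWithinAt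
  have := ((hF.differentiableWithinAt (hm hz)).hasFDerivWithinAt.comp z hI hm).fderivWithin
    (uniqueDiffOn_closedBall one_pos z hz)
  simp only [along]
  rw [show (fun z => F (Complex.I * z)) = F ∘ fun z => Complex.I * z from rfl, this]
  simp

/-- The rotation vector field. -/
lemma integral_along_rotation_eq_zero {F : ℂ → ℂ} (hF : IsSmooth 1 F) :
    ∫ z in Metric.closedBall (0 : ℂ) 1, along (fun z => Complex.I * z) F z = 0 := by
  have hg := hF.along (v := fun z => Complex.I * z) (by fun_prop)
  set g := along (fun z => Complex.I * z) F with hgdef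
  set S := Metric.closedBall (0 : ℂ) 1 with hS
  have hunit : ∀ t : ℝ, ‖Complex.exp (t * Complex.I)‖ = 1 := Complex.norm_exp_ofReal_mul_I
  have hcont : ContinuousOn (fun p : ℝ × ℂ => g (Complex.exp (p.1 * Complex.I) * p.2))
      (Icc 0 (2 * Real.pi) ×ˢ S) := by
    refine hg.continuousOn.comp (by fun_prop) fun p hp => ?_
    simpa [hunit, hS] using hp.2
  have hint : Integrable (fun p : ℝ × ℂ => g (Complex.exp (p.1 * Complex.I) * p.2))
      ((volume.restrict (Ioc 0 (2 * Real.pi))).prod (volume.restrict S)) := by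
    rw [Measure.prod_restrict]
    exact (hcont.integrableOn_compact (isCompact_Icc.prod (isCompact_closedBall _ _))).mono_set
      (prod_mono_left Ioc_subset_Icc_self)
  have key : ∀ z ∈ Metric.ball (0 : ℂ) 1,
      ∫ t in Ioc 0 (2 * Real.pi), g (Complex.exp (t * Complex.I) * z) = 0 := by
    intro z hz
    have hmem : ∀ t : ℝ, Complex.exp (t * Complex.I) * z ∈ Metric.ball (0 : ℂ) 1 := by
      intro t; simpa [hunit] using hz
    rw [← intervalIntegral.integral_of_le (by positivity),
      intervalIntegral.integral_eq_sub_of_hasDerivAt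
        (f := fun t : ℝ => F (Complex.exp (t * Complex.I) * z))]
    · simp
    · intro t _
      have h1 : HasDerivAt (fun t : ℝ => Complex.exp (t * Complex.I) * z)
          (Complex.I * (Complex.exp (t * Complex.I) * z)) t := by
        have := (((Complex.ofRealCLM.hasDerivAt (x := t)).mul_const Complex.I).cexp).mul_const z
        refine this.congr_deriv ?_
        simp only [Complex.ofRealCLM_apply, Complex.ofReal_one, one_mul]
        ring
      exact (hF.hasFDerivAt (hmem t)).comp_hasDerivAt t h1
    · refine ContinuousOn.intervalIntegrable ?_
      exact hg.continuousOn.comp (by fun_prop) fun t _ => Metric.ball_subset_closedBall (hmem t)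
  -- The integral of `g` is unchanged when `g` is rotated; averaging over all angles and swapping
  -- integrals leaves `∫ d/dt F(e^{it} z) dt` over a full period, which is zero. No boundary values
  -- enter.
  have h1 : ∫ t in Ioc 0 (2 * Real.pi), ∫ z in S, g (Complex.exp (t * Complex.I) * z) = 0 := by
    rw [integral_integral_swap hint, hS, volume_restrict_ball_eq]
    exact setIntegral_eq_zero_of_forall_eq_zero key
  have h2 : ∀ t : ℝ, ∫ z in S, g (Complex.exp (t * Complex.I) * z) = ∫ z in S, g z :=
    fun t => setIntegral_mul_unit (hunit t) g
  simp only [h2] at h1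
  simpa [Real.pi_ne_zero, Real.pi_pos.le] using h1

/-! ### The operator of the unit disk in divergence form -/

/-- The function `1 - |z|²`. -/
noncomputable def bdryDefect (z : ℂ) : ℂ := 1 - z * starRingEnd ℂ z

lemma contDiff_conj : ContDiff ℝ ∞ (fun z : ℂ => starRingEnd ℂ z) := Complex.conjCLE.contDiff

lemma contDiff_bdryDefect : ContDiff ℝ ∞ bdryDefect :=
  contDiff_const.sub (contDiff_id.mul contDiff_conj)

lemma bdryDefect_of_norm_eq_one {z : ℂ} (hz : ‖z‖ = 1) : bdryDefect z = 0 := by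
  rw [bdryDefect, Complex.mul_conj, Complex.normSq_eq_norm_sq, hz]; simp

/-- The operator `1 - ∂ₓ (1 - ρ²) ∂ₓ - ∂_y (1 - ρ²) ∂_y - ∂_θ²` on the closed unit disk, which
agrees with `euclideanOp`. -/
noncomputable def divOp (u : ℂ → ℂ) (z : ℂ) : ℂ :=
  u z - along (fun _ => 1) (fun z => bdryDefect z * along (fun _ => 1) u z) z
    - along (fun _ => Complex.I) (fun z => bdryDefect z * along (fun _ => Complex.I) u z) z
    - along (fun z => Complex.I * z) (along (fun z => Complex.I * z) u) z

lemma contDiff_rotation : ContDiff ℝ ∞ (fun z : ℂ => Complex.I * z) :=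
  contDiff_const.mul contDiff_id

lemma IsSmooth.divOp {u : ℂ → ℂ} (hu : IsSmooth 1 u) : IsSmooth 1 (divOp u) :=
  ((hu.sub (((contDiff_bdryDefect.isSmooth 1).mul (hu.along contDiff_const)).along
    contDiff_const)).sub (((contDiff_bdryDefect.isSmooth 1).mul (hu.along contDiff_const)).along
    contDiff_const)).sub ((hu.along contDiff_rotation).along contDiff_rotation)

/-- Integration by parts, for a vector field `v` and a weight `a` such that the derivatives along
`v` of the multiples of `a` have integral zero. -/
lemma integral_mul_along_along {v a : ℂ → ℂ} (hv : ContDiff ℝ ∞ v) (ha : ContDiff ℝ ∞ a)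
    (h0 : ∀ F, IsSmooth 1 F →
      ∫ z in Metric.closedBall (0 : ℂ) 1, along v (fun z => a z * F z) z = 0)
    {φ ψ : ℂ → ℂ} (hφ : IsSmooth 1 φ) (hψ : IsSmooth 1 ψ) :
    ∫ z in Metric.closedBall (0 : ℂ) 1, φ z * along v (fun z => a z * along v ψ z) z
      = -∫ z in Metric.closedBall (0 : ℂ) 1, a z * (along v φ z * along v ψ z) := by
  have haψ : IsSmooth 1 (fun z => a z * along v ψ z) := (ha.isSmooth 1).mul (hψ.along hv)
  have h := h0 _ (hφ.mul (hψ.along hv))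
  have e : ∀ z ∈ Metric.closedBall (0 : ℂ) 1, along v (fun z => a z * (φ z * along v ψ z)) z
      = φ z * along v (fun z => a z * along v ψ z) z + a z * (along v φ z * along v ψ z) := by
    intro z hz
    have e1 : (fun z => a z * (φ z * along v ψ z)) = fun z => φ z * (a z * along v ψ z) := by
      ext z; ring
    rw [e1, along_mul v hφ haψ hz]
    ring
  rw [setIntegral_congr_fun Metric.isClosed_closedBall.measurableSet e,
    integral_add (hφ.mul (haψ.along hv)).integrableOn
      ((ha.isSmooth 1).mul ((hφ.along hv).mul (hψ.along hv))).integrableOn] at h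
  linear_combination h

/-- Both sides equal a symmetric Dirichlet-type form. Boundary terms vanish for every smooth pair:
`1 - ρ²` is zero on the circle and the rotation field is tangent to it. -/
lemma integral_mul_divOp {φ ψ : ℂ → ℂ} (hφ : IsSmooth 1 φ) (hψ : IsSmooth 1 ψ) :
    ∫ z in Metric.closedBall (0 : ℂ) 1, φ z * divOp ψ z
      = ∫ z in Metric.closedBall (0 : ℂ) 1, ψ z * divOp φ z := by
  have hb : ∀ F : ℂ → ℂ, ∀ z, ‖z‖ = 1 → bdryDefect z * F z = 0 := fun F z hz => by
    rw [bdryDefect_of_norm_eq_one hz, zero_mul]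
  have h1 := fun {φ ψ : ℂ → ℂ} (hφ : IsSmooth 1 φ) (hψ : IsSmooth 1 ψ) =>
    integral_mul_along_along (v := fun _ => 1) contDiff_const contDiff_bdryDefect
      (fun F hF => integral_along_one_eq_zero ((contDiff_bdryDefect.isSmooth 1).mul hF) (hb F))
      hφ hψ
  have h2 := fun {φ ψ : ℂ → ℂ} (hφ : IsSmooth 1 φ) (hψ : IsSmooth 1 ψ) =>
    integral_mul_along_along (v := fun _ => Complex.I) contDiff_const contDiff_bdryDefect
      (fun F hF => integral_along_I_eq_zero ((contDiff_bdryDefect.isSmooth 1).mul hF) (hb F))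
      hφ hψ
  have h3 := fun {φ ψ : ℂ → ℂ} (hφ : IsSmooth 1 φ) (hψ : IsSmooth 1 ψ) =>
    integral_mul_along_along (v := fun z => Complex.I * z) (a := fun _ => 1) contDiff_rotation
      contDiff_const
      (fun F hF => by simpa only [one_mul] using integral_along_rotation_eq_zero hF) hφ hψ
  have key : ∀ {φ ψ : ℂ → ℂ}, IsSmooth 1 φ → IsSmooth 1 ψ →
      ∫ z in Metric.closedBall (0 : ℂ) 1, φ z * divOp ψ z
      = (∫ z in Metric.closedBall (0 : ℂ) 1, φ z * ψ z)
      + (∫ z in Metric.closedBall (0 : ℂ) 1,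
          bdryDefect z * (along (fun _ => 1) φ z * along (fun _ => 1) ψ z))
      + (∫ z in Metric.closedBall (0 : ℂ) 1, bdryDefect z *
          (along (fun _ => Complex.I) φ z * along (fun _ => Complex.I) ψ z))
      + ∫ z in Metric.closedBall (0 : ℂ) 1,
          1 * (along (fun z => Complex.I * z) φ z * along (fun z => Complex.I * z) ψ z) := by
    intro φ ψ hφ hψ
    have i0 := hφ.mul hψ
    have i1 := hφ.mul (((contDiff_bdryDefect.isSmooth 1).mul
      (hψ.along (v := fun _ => 1) contDiff_const)).along (v := fun _ => 1) contDiff_const)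
    have i2 := hφ.mul (((contDiff_bdryDefect.isSmooth 1).mul
      (hψ.along (v := fun _ => Complex.I) contDiff_const)).along
        (v := fun _ => Complex.I) contDiff_const)
    have i3 := hφ.mul ((hψ.along contDiff_rotation).along contDiff_rotation)
    have j1 := h1 hφ hψ
    have j2 := h2 hφ hψ
    have j3 := h3 hφ hψ
    simp only [one_mul] at j3 ⊢
    simp only [divOp, mul_sub]
    rw [integral_sub ((i0.sub i1).sub i2).integrableOn i3.integrableOn,
      integral_sub (i0.sub i1).integrableOn i2.integrableOn,
      integral_sub i0.integrableOn i1.integrableOn, j1, j2, j3]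
    ring
  rw [key hφ hψ, key hψ hφ]
  simp only [mul_comm]

/-- The second-order expression of `divOp` in the interior. -/
lemma divOp_eq {u : ℂ → ℂ} {f₁ : ℂ → ℂ →L[ℝ] ℂ} {f₂ : ℂ →L[ℝ] ℂ →L[ℝ] ℂ} {z : ℂ}
    (hz : z ∈ Metric.ball (0 : ℂ) 1) (h₁ : ∀ y ∈ Metric.ball (0 : ℂ) 1, HasFDerivAt u (f₁ y) y)
    (h₂ : HasFDerivAt f₁ f₂ z) :
    divOp u z = u z - bdryDefect z * (f₂ 1 1 + f₂ Complex.I Complex.I) + 3 * f₁ z z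
      - f₂ (Complex.I * z) (Complex.I * z) := by
  have hzc := Metric.ball_subset_closedBall hz
  have hU : ∀ᶠ y in 𝓝 z, y ∈ Metric.ball (0 : ℂ) 1 := Metric.isOpen_ball.mem_nhds hz
  have hal : ∀ v : ℂ → ℂ, along v u =ᶠ[𝓝 z] fun y => f₁ y (v y) := fun v =>
    hU.mono fun y hy => along_of_hasFDerivAt (h₁ y hy) (Metric.ball_subset_closedBall hy)
  have hb : HasFDerivAt bdryDefect (-(z • (Complex.conjCLE : ℂ →L[ℝ] ℂ)
      + starRingEnd ℂ z • ContinuousLinearMap.id ℝ ℂ)) z := by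
    have hc : HasFDerivAt (𝕜 := ℝ) (fun z : ℂ => starRingEnd ℂ z)
      (Complex.conjCLE : ℂ →L[ℝ] ℂ) z := Complex.conjCLE.hasFDerivAt
    exact ((hasFDerivAt_id (𝕜 := ℝ) z).mul hc).const_sub 1
  have hconst : ∀ c : ℂ, along (fun _ => c) (fun z => bdryDefect z * along (fun _ => c) u z) z
      = -(z * starRingEnd ℂ c + starRingEnd ℂ z * c) * f₁ z c + bdryDefect z * f₂ c c := by
    intro c
    have h3 : HasFDerivAt (along (fun _ => c) u) _ z :=
      (h₂.clm_apply (hasFDerivAt_const c z)).congr_of_eventuallyEq (hal fun _ => c)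
    have h5 : HasFDerivAt (fun z => bdryDefect z * along (fun _ => c) u z) _ z := hb.mul h3
    rw [along_of_hasFDerivAt h5 hzc, (hal fun _ => c).self_of_nhds]
    simp
    ring
  have hrot : along (fun z => Complex.I * z) (along (fun z => Complex.I * z) u) z
      = f₂ (Complex.I * z) (Complex.I * z) - f₁ z z := by
    have h4 : HasFDerivAt (fun z : ℂ => Complex.I * z) (Complex.I • ContinuousLinearMap.id ℝ ℂ) z := by
      simpa using (hasFDerivAt_id (𝕜 := ℝ) z).const_mul Complex.I
    have h3 : HasFDerivAt (along (fun z => Complex.I * z) u) _ z :=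
      (h₂.clm_apply h4).congr_of_eventuallyEq (hal fun z => Complex.I * z)
    rw [along_of_hasFDerivAt h3 hzc]
    have : Complex.I * (Complex.I * z) = -z := by rw [← mul_assoc, Complex.I_mul_I]; ring
    simp [this]
    ring
  -- Expanding `z` in the real basis `1, i` shows that the gradient of `1 - |z|²` contributes `2 f₁
  -- z z`; the rotation term supplies the third copy.
  have hlin : 2 * f₁ z z = (z + starRingEnd ℂ z) * f₁ z 1
      + (-(z * Complex.I) + starRingEnd ℂ z * Complex.I) * f₁ z Complex.I := by
    have e : z = z.re • (1 : ℂ) + z.im • Complex.I := by simp [Complex.re_add_im]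
    have e1 : f₁ z z = z.re * f₁ z 1 + z.im * f₁ z Complex.I := by
      have := congrArg (f₁ z) e
      rwa [map_add, map_smul, map_smul, Complex.real_smul, Complex.real_smul] at this
    have e2 : z + starRingEnd ℂ z = 2 * z.re := by rw [Complex.add_conj]; push_cast; ring
    have e3 : z - starRingEnd ℂ z = 2 * z.im * Complex.I := by
      rw [Complex.sub_conj]; push_cast; ring
    rw [e1, e2]
    linear_combination Complex.I * f₁ z Complex.I * e3
      + 2 * z.im * f₁ z Complex.I * Complex.I_mul_I
  rw [divOp, hconst, hconst, hrot]
  simp only [map_one, mul_one, Complex.conj_I]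
  linear_combination -hlin

/-- The first two derivatives of `u` along a curve. -/
lemma derivs_along_curve {u : ℂ → ℂ} {f₁ : ℂ → ℂ →L[ℝ] ℂ} {f₂ : ℂ →L[ℝ] ℂ →L[ℝ] ℂ}
    {U : Set ℂ} (hU : IsOpen U) (h₁ : ∀ y ∈ U, HasFDerivAt u (f₁ y) y)
    {γ γ' : ℝ → ℂ} {γ'' : ℂ} {t : ℝ} (ht : γ t ∈ U) (h₂ : HasFDerivAt f₁ f₂ (γ t))
    (hγ : ∀ s, HasDerivAt γ (γ' s) s) (hγ' : HasDerivAt γ' γ'' t) :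
    deriv (fun s => u (γ s)) t = f₁ (γ t) (γ' t) ∧
      iteratedDeriv 2 (fun s => u (γ s)) t = f₂ (γ' t) (γ' t) + f₁ (γ t) γ'' := by
  have h : ∀ᶠ s in 𝓝 t, HasDerivAt (fun s => u (γ s)) (f₁ (γ s) (γ' s)) s := by
    filter_upwards [(hγ t).continuousAt.eventually_mem (hU.mem_nhds ht)] with s hs
    exact (h₁ _ hs).comp_hasDerivAt s (hγ s)
  refine ⟨h.self_of_nhds.deriv, ?_⟩
  have e : deriv (fun s => u (γ s)) =ᶠ[𝓝 t] fun s => f₁ (γ s) (γ' s) := h.mono fun s hs => hs.deriv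
  rw [iteratedDeriv_succ, iteratedDeriv_one, e.deriv_eq]
  have h3 : HasDerivAt (fun s => f₁ (γ s)) (f₂ (γ' t)) t := h₂.comp_hasDerivAt t (hγ t)
  exact (h3.clm_apply hγ').deriv

/-- The trace of a bilinear form is invariant under rotating the frame; the cross terms cancel
without symmetry of `B`. -/
lemma trace_rotate (B : ℂ →L[ℝ] ℂ →L[ℝ] ℂ) (x y : ℂ) {a b : ℝ} (h : a ^ 2 + b ^ 2 = 1) :
    B (a • x + b • y) (a • x + b • y) + B ((-b) • x + a • y) ((-b) • x + a • y)
      = B x x + B y y := by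
  have h' : (a : ℂ) ^ 2 + (b : ℂ) ^ 2 = 1 := by exact_mod_cast h
  simp only [map_add, map_smul, add_apply, smul_apply]
  simp only [Complex.real_smul, Complex.ofReal_neg]
  linear_combination (B x x + B y y) * h'

/-- In the frame `e = e^{iθ}`, `i e` both operators are combinations of `u`, the radial derivative
and the two pure second derivatives; rotation invariance of the trace matches the Laplacian. -/
lemma euclideanOp_eq_divOp {u : ℂ → ℂ} (hu : IsSmooth 1 u) {z : ℂ}
    (hz : z ∈ Metric.ball (0 : ℂ) 1) (hz0 : z ≠ 0) : euclideanOp u z = divOp u z := by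
  have hU := Metric.isOpen_ball.mem_nhds hz
  set f₁ := fderivWithin ℝ u (Metric.closedBall (0 : ℂ) 1) with hf₁
  have h₁ : ∀ y ∈ Metric.ball (0 : ℂ) 1, HasFDerivAt u (f₁ y) y := fun y hy => hu.hasFDerivAt hy
  have h₂ : HasFDerivAt f₁ (fderiv ℝ f₁ z) z := by
    have : ContDiffAt ℝ ∞ f₁ z := hu.fderivWithin.contDiffAt
      (mem_of_superset hU Metric.ball_subset_closedBall)
    exact (this.differentiableAt (by simp)).hasFDerivAt
  set f₂ := fderiv ℝ f₁ z with hf₂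
  rw [divOp_eq hz h₁ h₂]
  set ρ : ℝ := ‖z‖ with hρ
  have hρ0 : ρ ≠ 0 := norm_ne_zero_iff.mpr hz0
  set θ : ℝ := Complex.arg z with hθ
  set e : ℂ := Complex.exp (θ * Complex.I) with he
  have hze : (ρ : ℂ) * e = z := Complex.norm_mul_exp_arg_mul_I z
  have hrad' : ∀ r : ℝ, HasDerivAt (fun r : ℝ => (r : ℂ) * e) e r := fun r => by
    simpa using (Complex.ofRealCLM.hasDerivAt (x := r)).mul_const e
  obtain ⟨hrad, hrad2⟩ := derivs_along_curve Metric.isOpen_ball h₁ (t := ρ)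
    (by rw [hze]; exact hz) (by rw [hze]; exact h₂) hrad' (hasDerivAt_const ρ e)
  have hang' : ∀ t : ℝ, HasDerivAt (fun t : ℝ => (ρ : ℂ) * Complex.exp (t * Complex.I))
      (Complex.I * (ρ * Complex.exp (t * Complex.I))) t := fun t => by
    refine ((((Complex.ofRealCLM.hasDerivAt (x := t)).mul_const Complex.I).cexp).const_mul
      (ρ : ℂ)).congr_deriv ?_
    simp only [Complex.ofRealCLM_apply, Complex.ofReal_one, one_mul]
    ring
  obtain ⟨-, hang2⟩ := derivs_along_curve Metric.isOpen_ball h₁ (t := θ)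
    (by rw [← he, hze]; exact hz) (by rw [← he, hze]; exact h₂) hang'
    ((hang' θ).const_mul Complex.I)
  have hII : Complex.I * (Complex.I * z) = -z := by
    rw [← mul_assoc, Complex.I_mul_I, neg_one_mul]
  rw [← he, hze, hII, map_neg, ← sub_eq_add_neg] at hang2
  rw [hze, map_zero, add_zero] at hrad2
  rw [hze] at hrad
  have E : euclideanOp u z = u z - (((1 - ρ ^ 2 : ℝ) : ℂ) * f₂ e e
      + ((1 / ρ - 3 * ρ : ℝ) : ℂ) * f₁ z e
      + ((1 / ρ ^ 2 : ℝ) : ℂ) * (f₂ (Complex.I * z) (Complex.I * z) - f₁ z z)) := by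
    simp only [euclideanOp]
    rw [← hρ, ← hθ, ← he, hrad2, hrad, hang2]
  have hee : e * starRingEnd ℂ e = 1 := by
    rw [Complex.mul_conj, Complex.normSq_eq_norm_sq, he, Complex.norm_exp_ofReal_mul_I]; simp
  have hbd : bdryDefect z = ((1 - ρ ^ 2 : ℝ) : ℂ) := by
    rw [bdryDefect, Complex.mul_conj, Complex.normSq_eq_norm_sq]; push_cast; rfl
  have hz1 : f₁ z z = ρ * f₁ z e := by
    have : z = ρ • e := by rw [Complex.real_smul, hze]
    have := congrArg (f₁ z) this
    rwa [map_smul, Complex.real_smul] at this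
  have hz2 : f₂ (Complex.I * z) (Complex.I * z) = ρ ^ 2 * f₂ (Complex.I * e) (Complex.I * e) := by
    have : Complex.I * z = ρ • (Complex.I * e) := by rw [Complex.real_smul, ← hze]; ring
    rw [this, map_smul, map_smul]
    simp
    ring
  have htr : f₂ 1 1 + f₂ Complex.I Complex.I = f₂ e e + f₂ (Complex.I * e) (Complex.I * e) := by
    have h5 : e = e.re • (1 : ℂ) + e.im • Complex.I := by simp [Complex.re_add_im]
    have h6 : Complex.I * e = (-e.im) • (1 : ℂ) + e.re • Complex.I := by
      apply Complex.ext <;> simp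
    have h7 : e.re ^ 2 + e.im ^ 2 = 1 := by
      rw [Complex.mul_conj, Complex.normSq_apply] at hee
      have : e.re * e.re + e.im * e.im = 1 := by exact_mod_cast hee
      rw [← this]; ring
    rw [h6, ← trace_rotate f₂ 1 Complex.I h7, ← h5]
  have hρc : (ρ : ℂ) ≠ 0 := by exact_mod_cast hρ0
  rw [E, hbd, htr, hz2, hz1]
  push_cast
  field_simp
  ring

/-! ### The Zernike polynomials as eigenfunctions -/

lemma isSmooth_genPoly (i j : ℕ) : IsSmooth 1 (genPoly i j) := (contDiff_genPoly i j).isSmooth 1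

lemma isSmooth_genPolySq (i j : ℕ) : IsSmooth 1 (genPolySq i j) :=
  (contDiff_genPolySq i j).isSmooth 1

lemma along_genPoly (v : ℂ → ℂ) (i j : ℕ) {z : ℂ} (hz : z ∈ Metric.closedBall (0 : ℂ) 1) :
    along v (genPoly i j) z
      = genPolySq (i - 1) j z * v z + genPolySq i (j - 1) z * starRingEnd ℂ (v z) := by
  rw [along_of_hasFDerivAt (hasFDerivAt_genPoly i j z) hz]
  simp

/-- The left side is `divOp` of the Zernike polynomial in terms of `∂_z`, `∂_z̄`: the entries of `2
G³` are second derivatives and those of `G²` first derivatives. Combining the relations for `a ∂_a`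
and `b ∂_b` at neighbouring indices leaves the square of `1 + a ∂_a + b ∂_b`. -/
lemma genPoly_eigen_identity (p q : ℕ) (z : ℂ) :
    genPoly (p + 1) (q + 1) z - 4 * bdryDefect z * genPolyCube p q z
      + 3 * (z * genPolySq p (q + 1) z + starRingEnd ℂ z * genPolySq (p + 1) q z)
      + (z ^ 2 * genPolyCube (p - 1) (q + 1) z
        - 2 * (z * starRingEnd ℂ z) * genPolyCube p q z
        + starRingEnd ℂ z ^ 2 * genPolyCube (p + 1) (q - 1) z)
      = ((p : ℂ) + q + 1) ^ 2 * genPoly (p + 1) (q + 1) z := by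
  have h1 := mul_genPoly_left p q z
  have h2 := mul_genPoly_right p q z
  have h3 : ((p : ℂ) - 1) * genPolySq p (q + 1) z
      = z * genPolyCube (p - 1) (q + 1) z - genPolyCube (p - 1) q z := by
    rcases p with _ | p
    · simp
    · simpa using mul_genPolySq_left p q z
  have h4 : ((q : ℂ) - 1) * genPolySq (p + 1) q z
      = starRingEnd ℂ z * genPolyCube (p + 1) (q - 1) z - genPolyCube p (q - 1) z := by
    rcases q with _ | q
    · simp
    · simpa using mul_genPolySq_right p q z
  have h5 : (q : ℂ) * genPolySq p (q + 1) z
      = starRingEnd ℂ z * genPolyCube p q z - genPolyCube (p - 1) q z := by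
    rcases p with _ | p
    · simp
    · simpa using mul_genPolySq_right p q z
  have h6 : (p : ℂ) * genPolySq (p + 1) q z
      = z * genPolyCube p q z - genPolyCube p (q - 1) z := by
    rcases q with _ | q
    · simp
    · simpa using mul_genPolySq_left p q z
  have h7 : genPolyCube p q z = genPolyCube (p - 1) (q - 1) z + ((p : ℂ) + q) * genPolySq p q z := by
    rcases p with _ | p
    · simp
    rcases q with _ | q
    · simp
    rw [genPolyCube_eq_add]
    push_cast
    ring_nf
  have h8 : z * genPolyCube (p - 1) q z + starRingEnd ℂ z * genPolyCube p (q - 1) z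
      = genPolyCube p q z + genPolyCube (p - 1) (q - 1) z - 2 * genPolySq p q z := by
    rcases p with _ | p
    · simp
    rcases q with _ | q
    · simp
    rw [genPolyCube_succ]
    simp only [Nat.add_sub_cancel]
    ring
  rw [bdryDefect]
  linear_combination -z * h3 - starRingEnd ℂ z * h4 - z * h5 - starRingEnd ℂ z * h6 + 2 * h8
    - (p + q + 2) * (h1 + h2) - 2 * h7

lemma divOp_genPoly (p q : ℕ) {z : ℂ} (hz : z ∈ Metric.ball (0 : ℂ) 1) :
    divOp (genPoly (p + 1) (q + 1)) z = ((p : ℂ) + q + 1) ^ 2 * genPoly (p + 1) (q + 1) z := by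
  have h2 := ((hasFDerivAt_genPolySq p (q + 1) z).smul_const (ContinuousLinearMap.id ℝ ℂ)).add
    ((hasFDerivAt_genPolySq (p + 1) q z).smul_const (Complex.conjCLE : ℂ →L[ℝ] ℂ))
  rw [divOp_eq hz (fun y _ => hasFDerivAt_genPoly (p + 1) (q + 1) y) h2,
    ← genPoly_eigen_identity]
  simp
  linear_combination (-(bdryDefect z + z ^ 2) * genPolyCube (p - 1) (q + 1) z
    + 2 * (bdryDefect z + z * starRingEnd ℂ z) * genPolyCube p q z
    - (bdryDefect z + starRingEnd ℂ z ^ 2) * genPolyCube (p + 1) (q - 1) z) * Complex.I_mul_I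

lemma integral_genPoly_mul_divOp (p q : ℕ) {u : ℂ → ℂ} (hu : IsSmooth 1 u) :
    ∫ z in Metric.closedBall (0 : ℂ) 1, genPoly (p + 1) (q + 1) z * divOp u z
      = ((p : ℂ) + q + 1) ^ 2
        * ∫ z in Metric.closedBall (0 : ℂ) 1, genPoly (p + 1) (q + 1) z * u z := by
  rw [integral_mul_divOp (isSmooth_genPoly _ _) hu, volume_restrict_ball_eq,
    ← integral_const_mul]
  refine setIntegral_congr_fun Metric.isOpen_ball.measurableSet fun z hz => ?_
  simp only [divOp_genPoly p q hz]
  ring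

/-! ### Orthogonality and norms on the unit disk. -/

/-- Symmetry of `divOp` separates different degrees `p + q`, and the rotation field, with eigenvalue
`i (p - q)`, separates the angular frequencies. The indices of the second factor appear swapped
because swapping them is conjugation. -/
lemma integral_genPoly_mul_eq_zero {i j k l : ℕ} (h : (i, j) ≠ (l, k)) :
    ∫ z in Metric.closedBall (0 : ℂ) 1, genPoly i j z * genPoly k l z = 0 := by
  rcases i with _ | p
  · simp
  rcases j with _ | q
  · simp
  rcases k with _ | r
  · simp
  rcases l with _ | s
  · simp
  set A := ∫ z in Metric.closedBall (0 : ℂ) 1, genPoly (p + 1) (q + 1) z * genPoly (r + 1) (s + 1) z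
    with hA
  have h1 : ((p : ℂ) + q + 1) ^ 2 * A = ((r : ℂ) + s + 1) ^ 2 * A := by
    have e1 := integral_genPoly_mul_divOp p q (isSmooth_genPoly (r + 1) (s + 1))
    have e2 := integral_genPoly_mul_divOp r s (isSmooth_genPoly (p + 1) (q + 1))
    rw [integral_mul_divOp (isSmooth_genPoly _ _) (isSmooth_genPoly _ _), e2] at e1
    simp only [mul_comm (genPoly (r + 1) (s + 1) _)] at e1
    exact e1.symm
  have h2 : Complex.I * (((p : ℂ) - q) + (r - s)) * A = 0 := by
    have e := integral_along_rotation_eq_zero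
      ((isSmooth_genPoly (p + 1) (q + 1)).mul (isSmooth_genPoly (r + 1) (s + 1)))
    rw [hA, ← integral_const_mul]
    refine Eq.trans ?_ e
    refine setIntegral_congr_fun Metric.isClosed_closedBall.measurableSet fun z hz => ?_
    rw [along_mul _ (isSmooth_genPoly _ _) (isSmooth_genPoly _ _) hz, along_genPoly _ _ _ hz,
      along_genPoly _ _ _ hz]
    simp only [Nat.add_sub_cancel, map_mul, Complex.conj_I]
    linear_combination Complex.I * genPoly (r + 1) (s + 1) z
        * (mul_genPoly_left p q z - mul_genPoly_right p q z)
      + Complex.I * genPoly (p + 1) (q + 1) z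
        * (mul_genPoly_left r s z - mul_genPoly_right r s z)
  by_contra hA0
  have h3 := mul_right_cancel₀ hA0 h1
  have h4 : ((p : ℂ) - q) + (r - s) = 0 := by
    simpa [hA0] using h2
  have h5 : p + q + 1 = r + s + 1 := by
    have : (p + q + 1) ^ 2 = (r + s + 1) ^ 2 := by exact_mod_cast h3
    exact Nat.pow_left_injective two_ne_zero this
  have h6 : p + r = q + s := by
    have : (p : ℂ) + r = q + s := by linear_combination h4
    exact_mod_cast this
  apply h
  ext <;> simp <;> omega

/-- The first factor is a sum of Zernike polynomials down a diagonal, and the second is the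
conjugate of one strictly further up the same diagonal. The shift `m` is what lets the induction
descend. -/
lemma integral_genPolySq_mul_genPoly (i j m : ℕ) :
    ∫ z in Metric.closedBall (0 : ℂ) 1, genPolySq i j z * genPoly (j + m + 1) (i + m + 1) z = 0 := by
  induction i, j using genSolve_induction generalizing m with
  | hl j => simp
  | hr i => simp
  | h i j _ _ h3 =>
    have e : ∀ z, genPolySq (i + 1) (j + 1) z * genPoly (j + 1 + m + 1) (i + 1 + m + 1) z
        = genPolySq i j z * genPoly (j + (m + 1) + 1) (i + (m + 1) + 1) z
          + ((i : ℂ) + j + 1)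
            * (genPoly (i + 1) (j + 1) z * genPoly (j + 1 + m + 1) (i + 1 + m + 1) z) := by
      intro z
      rw [genPolySq_eq_add, show j + 1 + m = j + (m + 1) by ring, show i + 1 + m = i + (m + 1) by ring]
      ring
    simp only [e]
    rw [integral_add ((isSmooth_genPolySq _ _).mul (isSmooth_genPoly _ _)).integrableOn
      ((((isSmooth_genPoly _ _).mul (isSmooth_genPoly _ _)).integrableOn).const_mul _), h3 (m + 1),
      integral_const_mul, integral_genPoly_mul_eq_zero (by simp; omega)]
    simp

/-- Write `P` for the polynomial. The function `F = |P|² - 1` vanishes on the circle, so the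
divergence of `F · (x, y)`, which is `2 F + r ∂_r F`, integrates to zero. By Euler's relation `r ∂_r
P = (p + q) P + 2 Q` with `Q` a coefficient of `G²` orthogonal to `P`, leaving `2 (p + q + 1) ∫ |P|²
= 2π`. -/
lemma integral_genPoly_mul_conj (p q : ℕ) :
    ∫ z in Metric.closedBall (0 : ℂ) 1, genPoly (p + 1) (q + 1) z * genPoly (q + 1) (p + 1) z
      = Real.pi / ((p : ℂ) + q + 1) := by
  set P := genPoly (p + 1) (q + 1) with hP
  set P' := genPoly (q + 1) (p + 1) with hP'
  have sP : IsSmooth 1 P := isSmooth_genPoly _ _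
  have sP' : IsSmooth 1 P' := isSmooth_genPoly _ _
  set F : ℂ → ℂ := fun z => P z * P' z - 1 with hF
  have sF : IsSmooth 1 F := (sP.mul sP').sub (contDiff_const.isSmooth 1)
  have hF0 : ∀ z, ‖z‖ = 1 → F z = 0 := by
    intro z hz
    have hzz : z * starRingEnd ℂ z = 1 := by
      rw [Complex.mul_conj, Complex.normSq_eq_norm_sq, hz]; simp
    simp only [hF, hP, hP', genPoly_of_norm_eq_one hz]
    have : z ^ p * starRingEnd ℂ z ^ q * (z ^ q * starRingEnd ℂ z ^ p)
        = (z * starRingEnd ℂ z) ^ p * (z * starRingEnd ℂ z) ^ q := by ring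
    rw [this, hzz]; simp
  have cre : ContDiff ℝ ∞ (fun z : ℂ => (z.re : ℂ)) :=
    Complex.ofRealCLM.contDiff.comp Complex.reCLM.contDiff
  have cim : ContDiff ℝ ∞ (fun z : ℂ => (z.im : ℂ)) :=
    Complex.ofRealCLM.contDiff.comp Complex.imCLM.contDiff
  have sx : IsSmooth 1 (fun z => (z.re : ℂ) * F z) := (cre.isSmooth 1).mul sF
  have sy : IsSmooth 1 (fun z => (z.im : ℂ) * F z) := (cim.isSmooth 1).mul sF
  have h1 := integral_along_one_eq_zero sx (fun z hz => by rw [hF0 z hz, mul_zero])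
  have h2 := integral_along_I_eq_zero sy (fun z hz => by rw [hF0 z hz, mul_zero])
  have e : ∀ z ∈ Metric.closedBall (0 : ℂ) 1,
      along (fun _ => 1) (fun z => (z.re : ℂ) * F z) z
        + along (fun _ => Complex.I) (fun z => (z.im : ℂ) * F z) z
      = (2 * ((p : ℂ) + q + 1)) * (P z * P' z) + 2 * (genPolySq p q z * P' z)
        + 2 * (genPolySq q p z * P z) - 2 := by
    intro z hz
    have dre : HasFDerivAt (fun z : ℂ => (z.re : ℂ)) (Complex.ofRealCLM.comp Complex.reCLM) z :=
      (Complex.ofRealCLM.comp Complex.reCLM).hasFDerivAt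
    have dim : HasFDerivAt (fun z : ℂ => (z.im : ℂ)) (Complex.ofRealCLM.comp Complex.imCLM) z :=
      (Complex.ofRealCLM.comp Complex.imCLM).hasFDerivAt
    have dF : ∀ c : ℂ, along (fun _ => c) F z = along (fun _ => c) (fun z => P z * P' z) z := by
      intro c
      simp only [along, hF]
      rw [fderivWithin_sub_const]
    rw [along_mul _ (cre.isSmooth 1) sF hz, along_mul _ (cim.isSmooth 1) sF hz, dF, dF,
      along_mul _ sP sP' hz, along_mul _ sP sP' hz, along_of_hasFDerivAt dre hz,
      along_of_hasFDerivAt dim hz]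
    simp only [hP, hP', along_genPoly _ _ _ hz, Nat.add_sub_cancel, hF, map_one, Complex.conj_I]
    have i1 := mul_genPoly_left p q z
    have i2 := mul_genPoly_right p q z
    have i3 := mul_genPoly_left q p z
    have i4 := mul_genPoly_right q p z
    have hz1 : (z.re : ℂ) + z.im * Complex.I = z := Complex.re_add_im z
    have hz2 : (z.re : ℂ) - z.im * Complex.I = starRingEnd ℂ z := by
      apply Complex.ext <;> simp
    simp only [ContinuousLinearMap.comp_apply, Complex.ofRealCLM_apply, Complex.reCLM_apply,
      Complex.imCLM_apply, Complex.one_re, Complex.I_im, Complex.ofReal_one]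
    linear_combination
      genPoly (p + 1) (q + 1) z * (genPolySq q (p + 1) z * hz1 + genPolySq (q + 1) p z * hz2)
      + genPoly (q + 1) (p + 1) z * (genPolySq p (q + 1) z * hz1 + genPolySq (p + 1) q z * hz2)
      - genPoly (q + 1) (p + 1) z * (i1 + i2) - genPoly (p + 1) (q + 1) z * (i3 + i4)
  have h3 : ∫ z in Metric.closedBall (0 : ℂ) 1,
      ((2 * ((p : ℂ) + q + 1)) * (P z * P' z) + 2 * (genPolySq p q z * P' z)
        + 2 * (genPolySq q p z * P z) - 2) = 0 := by
    rw [← setIntegral_congr_fun Metric.isClosed_closedBall.measurableSet e,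
      integral_add (sx.along contDiff_const).integrableOn (sy.along contDiff_const).integrableOn,
      h1, h2, add_zero]
  have s1 : IsSmooth 1 (fun z => (2 * ((p : ℂ) + q + 1)) * (P z * P' z)) :=
    (contDiff_const.isSmooth 1).mul (sP.mul sP')
  have s2 : IsSmooth 1 (fun z => 2 * (genPolySq p q z * P' z)) :=
    (contDiff_const.isSmooth 1).mul ((isSmooth_genPolySq _ _).mul sP')
  have s3 : IsSmooth 1 (fun z => 2 * (genPolySq q p z * P z)) :=
    (contDiff_const.isSmooth 1).mul ((isSmooth_genPolySq _ _).mul sP)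
  rw [integral_sub ((s1.add s2).add s3).integrableOn (contDiff_const.isSmooth 1).integrableOn,
    integral_add (s1.add s2).integrableOn s3.integrableOn,
    integral_add s1.integrableOn s2.integrableOn, integral_const_mul, integral_const_mul,
    integral_const_mul] at h3
  have z1 := integral_genPolySq_mul_genPoly p q 0
  have z2 := integral_genPolySq_mul_genPoly q p 0
  simp only [add_zero] at z1 z2
  rw [z1, z2] at h3
  have hv : ∫ z in Metric.closedBall (0 : ℂ) 1, (2 : ℂ) = 2 * Real.pi := by
    rw [setIntegral_const]
    simp [Measure.real, Complex.volume_closedBall, mul_comm]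
  rw [hv] at h3
  have hn : (p : ℂ) + q + 1 ≠ 0 := by
    have : ((p + q + 1 : ℕ) : ℂ) ≠ 0 := by exact_mod_cast (p + q).succ_ne_zero
    simpa using this
  field_simp
  linear_combination h3 / 2

/-! ### Smoothness of the intertwining diffeomorphism and change of variables -/

section DiskMap

variable {κ R : ℝ}

lemma one_sub_pos (hκ : R ^ 2 * |κ| < 1) {z : ℂ} (hz : z ∈ Metric.closedBall (0 : ℂ) R) :
    0 < 1 - κ * ‖z‖ ^ 2 := by
  linarith [(abs_lt.mp (mul_sq_abs_lt_one hκ (norm_nonneg z) (by simpa using hz))).2]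

lemma one_add_pos (hκ : R ^ 2 * |κ| < 1) {z : ℂ} (hz : z ∈ Metric.closedBall (0 : ℂ) R) :
    0 < 1 + κ * ‖z‖ ^ 2 := by
  linarith [(abs_lt.mp (mul_sq_abs_lt_one hκ (norm_nonneg z) (by simpa using hz))).1]

lemma one_sub_radius_pos (hR : 0 < R) (hκ : R ^ 2 * |κ| < 1) : 0 < 1 - κ * R ^ 2 := by
  linarith [(abs_lt.mp (mul_sq_abs_lt_one hκ hR.le le_rfl)).2]

lemma weight_pos (hκ : R ^ 2 * |κ| < 1) {z : ℂ} (hz : z ∈ Metric.closedBall (0 : ℂ) R) :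
    0 < weight κ z :=
  div_pos (one_add_pos hκ hz) (one_sub_pos hκ hz)

lemma weight_ne_zero (hκ : R ^ 2 * |κ| < 1) {z : ℂ} (hz : z ∈ Metric.closedBall (0 : ℂ) R) :
    (weight κ z : ℂ) ≠ 0 := by exact_mod_cast (weight_pos hκ hz).ne'

lemma mapsTo_diskMap (hR : 0 < R) (hκ : R ^ 2 * |κ| < 1) :
    MapsTo (diskMap κ R) (Metric.closedBall 0 R) (Metric.closedBall 0 1) := by
  intro z hz
  have h1 := one_sub_pos hκ hz
  have h2 := one_sub_radius_pos hR hκ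
  have hz' : ‖z‖ ≤ R := by simpa using hz
  -- The bound rests on `R (1 - κ r²) - r (1 - κ R²) = (R - r)(1 + κ R r)`.
  have h3 : 0 < 1 + κ * (R * ‖z‖) := by
    have : |κ * (R * ‖z‖)| < 1 := by
      rw [abs_mul, abs_of_nonneg (by positivity : 0 ≤ R * ‖z‖)]
      calc |κ| * (R * ‖z‖) ≤ |κ| * (R * R) := by gcongr
        _ < 1 := by linarith
    linarith [(abs_lt.mp this).1]
  rw [mem_closedBall_zero_iff, diskMap, norm_mul, Complex.norm_real,
    Real.norm_of_nonneg (by positivity), div_div, div_mul_eq_mul_div, div_le_one (by positivity)]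
  nlinarith [mul_nonneg (sub_nonneg.mpr hz') h3.le]

/-- With `q = |ζ|²` the expression is the convex combination `(1 - q)(1 - κR²)² + q (1 + κR²)²`. -/
lemma discriminant_pos (hR : 0 < R) (hκ : R ^ 2 * |κ| < 1) {ζ : ℂ}
    (hζ : ζ ∈ Metric.closedBall (0 : ℂ) 1) :
    0 < (1 - κ * R ^ 2) ^ 2 + 4 * κ * R ^ 2 * ‖ζ‖ ^ 2 := by
  have hζ' : ‖ζ‖ ≤ 1 := by simpa using hζ
  have h2 := abs_lt.mp (mul_sq_abs_lt_one hκ hR.le le_rfl)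
  have hq : ‖ζ‖ ^ 2 ≤ 1 := by nlinarith [norm_nonneg ζ]
  have h3 : 0 < (1 + κ * R ^ 2) ^ 2 := pow_pos (by linarith) 2
  have h4 : 0 < (1 - κ * R ^ 2) ^ 2 := pow_pos (by linarith) 2
  nlinarith [mul_nonneg (sub_nonneg.mpr hq) h4.le, mul_nonneg (sq_nonneg ‖ζ‖) h3.le,
    mul_nonneg (sub_nonneg.mpr hq) h3.le, mul_nonneg (sq_nonneg ‖ζ‖) h4.le]

lemma mapsTo_diskMapInv (hR : 0 < R) (hκ : R ^ 2 * |κ| < 1) :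
    MapsTo (diskMapInv κ R) (Metric.closedBall 0 1) (Metric.closedBall 0 R) := by
  intro ζ hζ
  have h2 := one_sub_radius_pos hR hκ
  have hζ' : ‖ζ‖ ≤ 1 := by simpa using hζ
  have hD := discriminant_pos hR hκ hζ
  set S := √((1 - κ * R ^ 2) ^ 2 + 4 * κ * R ^ 2 * ‖ζ‖ ^ 2) with hS
  have hS0 : 0 < S := Real.sqrt_pos.mpr hD
  -- The difference of squares is `4 (1 - κR²) |ζ| (1 - |ζ|)`.
  have key : 2 * ‖ζ‖ - (1 - κ * R ^ 2) ≤ S := by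
    refine Real.le_sqrt_of_sq_le ?_
    nlinarith [mul_nonneg (mul_nonneg h2.le (norm_nonneg ζ)) (sub_nonneg.mpr hζ')]
  rw [mem_closedBall_zero_iff, diskMapInv, ← hS, norm_mul, Complex.norm_real,
    Real.norm_of_nonneg (by positivity), div_mul_eq_mul_div, div_le_iff₀ (by positivity)]
  nlinarith

lemma image_diskMap (hR : 0 < R) (hκ : R ^ 2 * |κ| < 1) :
    diskMap κ R '' Metric.closedBall 0 R = Metric.closedBall 0 1 :=
  (mapsTo_diskMap hR hκ).image_subset.antisymm fun _ hζ =>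
    ⟨_, mapsTo_diskMapInv hR hκ hζ, diskMap_diskMapInv hR hκ hζ⟩

lemma contDiff_normSq : ContDiff ℝ ∞ (fun z : ℂ => ‖z‖ ^ 2) := contDiff_norm_sq ℝ

lemma contDiffOn_weight (hκ : R ^ 2 * |κ| < 1) :
    ContDiffOn ℝ ∞ (weight κ) (Metric.closedBall (0 : ℂ) R) :=
  (contDiff_const.add (contDiff_const.mul contDiff_normSq)).contDiffOn.div
    (contDiff_const.sub (contDiff_const.mul contDiff_normSq)).contDiffOn
    fun _ hz => (one_sub_pos hκ hz).ne'

lemma isSmooth_weight (hκ : R ^ 2 * |κ| < 1) : IsSmooth R (fun z => (weight κ z : ℂ)) :=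
  Complex.ofRealCLM.contDiff.comp_contDiffOn (contDiffOn_weight hκ)

lemma isSmooth_diskMap (hκ : R ^ 2 * |κ| < 1) : IsSmooth R (diskMap κ R) := by
  have h : ContDiffOn ℝ ∞ (fun z : ℂ => (1 - κ * R ^ 2) / (1 - κ * ‖z‖ ^ 2) / R)
      (Metric.closedBall (0 : ℂ) R) :=
    (contDiffOn_const.div (contDiff_const.sub (contDiff_const.mul contDiff_normSq)).contDiffOn
      fun _ hz => (one_sub_pos hκ hz).ne').div_const _
  exact (Complex.ofRealCLM.contDiff.comp_contDiffOn h).mul contDiffOn_id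

lemma isSmooth_diskMapInv (hR : 0 < R) (hκ : R ^ 2 * |κ| < 1) : IsSmooth 1 (diskMapInv κ R) := by
  have hs : ContDiffOn ℝ ∞ (fun ζ : ℂ => √((1 - κ * R ^ 2) ^ 2 + 4 * κ * R ^ 2 * ‖ζ‖ ^ 2))
      (Metric.closedBall (0 : ℂ) 1) :=
    (contDiff_const.add (contDiff_const.mul contDiff_normSq)).contDiffOn.sqrt
      fun _ hζ => (discriminant_pos hR hκ hζ).ne'
  have h : ContDiffOn ℝ ∞ (fun ζ : ℂ => 2 * R / (1 - κ * R ^ 2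
      + √((1 - κ * R ^ 2) ^ 2 + 4 * κ * R ^ 2 * ‖ζ‖ ^ 2))) (Metric.closedBall (0 : ℂ) 1) :=
    contDiffOn_const.div (contDiffOn_const.add hs) fun _ _ =>
      (add_pos_of_pos_of_nonneg (one_sub_radius_pos hR hκ) (Real.sqrt_nonneg _)).ne'
  exact (Complex.ofRealCLM.contDiff.comp_contDiffOn h).mul contDiffOn_id

/-- `w Φ^* u`. -/
noncomputable def pull (κ R : ℝ) (u : ℂ → ℂ) (z : ℂ) : ℂ := weight κ z * u (diskMap κ R z)

/-- `(Φ⁻¹)^* (φ / w)`. -/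
noncomputable def push (κ R : ℝ) (φ : ℂ → ℂ) (ζ : ℂ) : ℂ :=
  φ (diskMapInv κ R ζ) / weight κ (diskMapInv κ R ζ)

lemma isSmooth_pull (hR : 0 < R) (hκ : R ^ 2 * |κ| < 1) {u : ℂ → ℂ} (hu : IsSmooth 1 u) :
    IsSmooth R (pull κ R u) :=
  (isSmooth_weight hκ).mul (ContDiffOn.comp hu (isSmooth_diskMap hκ) (mapsTo_diskMap hR hκ))

lemma isSmooth_push (hR : 0 < R) (hκ : R ^ 2 * |κ| < 1) {φ : ℂ → ℂ} (hφ : IsSmooth R φ) :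
    IsSmooth 1 (push κ R φ) := by
  have h : ContDiffOn ℝ ∞ (fun ζ => (weight κ (diskMapInv κ R ζ))⁻¹) (Metric.closedBall 0 1) :=
    ((contDiffOn_weight hκ).comp (isSmooth_diskMapInv hR hκ) (mapsTo_diskMapInv hR hκ)).inv
      fun _ hζ => (weight_pos hκ (mapsTo_diskMapInv hR hκ hζ)).ne'
  have e : push κ R φ = fun ζ => φ (diskMapInv κ R ζ) * ((weight κ (diskMapInv κ R ζ))⁻¹ : ℝ) := by
    ext ζ
    rw [push, div_eq_mul_inv, Complex.ofReal_inv]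
  rw [e]
  exact (ContDiffOn.comp hφ (isSmooth_diskMapInv hR hκ) (mapsTo_diskMapInv hR hκ)).mul
    (Complex.ofRealCLM.contDiff.comp_contDiffOn h)

lemma pull_push (hR : 0 < R) (hκ : R ^ 2 * |κ| < 1) (φ : ℂ → ℂ) {z : ℂ}
    (hz : z ∈ Metric.closedBall (0 : ℂ) R) : pull κ R (push κ R φ) z = φ z := by
  rw [pull, push, diskMapInv_diskMap hR hκ hz, mul_div_cancel₀ _ (weight_ne_zero hκ hz)]

lemma det_clm_complex (A : ℂ →L[ℝ] ℂ) :
    A.det = (A 1).re * (A Complex.I).im - (A Complex.I).re * (A 1).im := by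
  rw [ContinuousLinearMap.det, ← LinearMap.det_toMatrix Complex.basisOneI, Matrix.det_fin_two]
  simp [LinearMap.toMatrix_apply]

/-- A rank-one perturbation of `h · id`: it acts by `h + g |z|²` on `z` and by `h` on the orthogonal
direction. -/
lemma det_of_rank_one {A : ℂ →L[ℝ] ℂ} {h g : ℝ} {z : ℂ}
    (hA : ∀ v, A v = (h : ℂ) * v + ((g * (z.re * v.re + z.im * v.im) : ℝ) : ℂ) * z) :
    A.det = h ^ 2 + h * g * ‖z‖ ^ 2 := by
  rw [det_clm_complex, hA, hA, ← Complex.normSq_eq_norm_sq, Complex.normSq_apply]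
  simp
  ring

lemma hasFDerivAt_diskMap (hκ : R ^ 2 * |κ| < 1) {z : ℂ} (hz : z ∈ Metric.closedBall (0 : ℂ) R) :
    ∃ A : ℂ →L[ℝ] ℂ, HasFDerivAt (diskMap κ R) A z ∧ A.det
      = ((1 - κ * R ^ 2) / R) ^ 2 * ((1 + κ * ‖z‖ ^ 2) / (1 - κ * ‖z‖ ^ 2) ^ 3) := by
  have hd := (one_sub_pos hκ hz).ne'
  set c := (1 - κ * R ^ 2) / R with hc
  have hn : HasFDerivAt (fun z : ℂ => 1 - κ * ‖z‖ ^ 2) (-(κ • ((2 : ℝ) • innerSL ℝ z))) z := by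
    refine (((hasStrictFDerivAt_norm_sq z).hasFDerivAt.const_mul κ).const_sub 1).congr_fderiv ?_
    rw [two_smul, two_smul]
  have hh : HasFDerivAt (fun z : ℂ => c * (1 - κ * ‖z‖ ^ 2)⁻¹)
      (c • (-((1 - κ * ‖z‖ ^ 2) ^ 2)⁻¹ • (-(κ • ((2 : ℝ) • innerSL ℝ z))))) z :=
    (HasDerivAt.comp_hasFDerivAt (h₂ := fun t : ℝ => t⁻¹) z (hasDerivAt_inv hd) hn).const_mul c
  have hhc : HasFDerivAt (fun z : ℂ => ((c * (1 - κ * ‖z‖ ^ 2)⁻¹ : ℝ) : ℂ)) _ z :=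
    Complex.ofRealCLM.hasFDerivAt.comp z hh
  have hm : HasFDerivAt (fun z : ℂ => ((c * (1 - κ * ‖z‖ ^ 2)⁻¹ : ℝ) : ℂ) * z) _ z :=
    hhc.mul (hasFDerivAt_id (𝕜 := ℝ) z)
  have e : diskMap κ R = fun z : ℂ => ((c * (1 - κ * ‖z‖ ^ 2)⁻¹ : ℝ) : ℂ) * z := by
    ext z
    rw [diskMap, hc]
    congr 2
    ring
  rw [e]
  refine ⟨_, hm, ?_⟩
  rw [det_of_rank_one (h := c * (1 - κ * ‖z‖ ^ 2)⁻¹)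
    (g := c * ((1 - κ * ‖z‖ ^ 2) ^ 2)⁻¹ * (2 * κ)) (z := z) fun v => ?_]
  · field_simp
    ring
  · simp only [add_apply, smul_apply, ContinuousLinearMap.comp_apply, neg_apply,
      innerSL_apply_apply, Complex.ofRealCLM_apply, ContinuousLinearMap.id_apply, smul_eq_mul,
      Complex.inner, Complex.mul_re, Complex.conj_re, Complex.conj_im]
    push_cast
    ring

lemma measurable_density (κ : ℝ) :
    Measurable fun z : ℂ => weight κ z * (1 / (1 + κ * ‖z‖ ^ 2) ^ 2) := by
  unfold weight
  fun_prop

lemma density_nonneg (hκ : R ^ 2 * |κ| < 1) {z : ℂ} (hz : z ∈ Metric.closedBall (0 : ℂ) R) :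
    0 ≤ weight κ z * (1 / (1 + κ * ‖z‖ ^ 2) ^ 2) :=
  mul_nonneg (weight_pos hκ hz).le (by positivity)

lemma ae_mem_disk (κ R : ℝ) : ∀ᵐ z ∂(weightedVolume κ R), z ∈ Metric.closedBall (0 : ℂ) R :=
  (withDensity_absolutelyContinuous _ _).ae_le
    (ae_restrict_mem Metric.isClosed_closedBall.measurableSet)

lemma isFiniteMeasure_weightedVolume (hκ : R ^ 2 * |κ| < 1) :
    IsFiniteMeasure (weightedVolume κ R) := by
  have h1 : ContinuousOn (fun z : ℂ => 1 / (1 + κ * ‖z‖ ^ 2) ^ 2) (Metric.closedBall 0 R) := by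
    refine continuousOn_const.div (Continuous.continuousOn (by fun_prop)) fun z hz => ?_
    exact (pow_pos (one_add_pos hκ hz) 2).ne'
  exact isFiniteMeasure_withDensity_ofReal
    (((contDiffOn_weight hκ).continuousOn.mul h1).integrableOn_compact
      (isCompact_closedBall _ _)).2

/-- The change of variables `Φ` in integrals. -/
lemma integral_weight_sq_mul_comp (hR : 0 < R) (hκ : R ^ 2 * |κ| < 1) (F : ℂ → ℂ) :
    ∫ z, (weight κ z : ℂ) ^ 2 * F (diskMap κ R z) ∂(weightedVolume κ R)
      = ((R / (1 - κ * R ^ 2) : ℝ) : ℂ) ^ 2 * ∫ ζ in Metric.closedBall (0 : ℂ) 1, F ζ := by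
  have hc := one_sub_radius_pos hR hκ
  have hmeas : MeasurableSet (Metric.closedBall (0 : ℂ) R) :=
    Metric.isClosed_closedBall.measurableSet
  choose! A hA hdet using fun (z : ℂ) (hz : z ∈ Metric.closedBall (0 : ℂ) R) =>
    hasFDerivAt_diskMap hκ hz
  have hinj : InjOn (diskMap κ R) (Metric.closedBall 0 R) := fun x hx y hy hxy => by
    rw [← diskMapInv_diskMap hR hκ hx, hxy, diskMapInv_diskMap hR hκ hy]
  rw [← image_diskMap hR hκ, integral_image_eq_integral_abs_det_fderiv_smul volume hmeas
    (fun z hz => (hA z hz).hasFDerivWithinAt) hinj, weightedVolume,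
    integral_withDensity_eq_integral_toReal_smul (measurable_density κ).ennreal_ofReal
      (Eventually.of_forall fun _ => ENNReal.ofReal_lt_top), ← integral_const_mul]
  -- The weight is chosen for this: `w² · w (1 + κ|z|²)⁻² = (1 + κ|z|²) / (1 - κ|z|²)³`, which is
  -- the Jacobian of `Φ` up to the constant.
  refine setIntegral_congr_fun hmeas fun z hz => ?_
  have h1 := one_sub_pos hκ hz
  have h2 := one_add_pos hκ hz
  rw [hdet z hz, abs_of_nonneg (by positivity), ENNReal.toReal_ofReal (density_nonneg hκ hz),
    Complex.real_smul, Complex.real_smul, ← mul_assoc, ← mul_assoc]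
  congr 1
  norm_cast
  rw [weight]
  field_simp

end DiskMap

/-! ### Smooth functions as elements of `L²` -/

section SmoothL2

variable {κ R : ℝ}

lemma aestronglyMeasurable_of_isSmooth {u : ℂ → ℂ} (hu : IsSmooth R u) :
    AEStronglyMeasurable u (weightedVolume κ R) :=
  (hu.continuousOn.aestronglyMeasurable Metric.isClosed_closedBall.measurableSet).mono_ac
    (withDensity_absolutelyContinuous _ _)

lemma exists_bound_of_isSmooth {u : ℂ → ℂ} (hu : IsSmooth R u) :
    ∃ C : ℝ, ∀ z ∈ Metric.closedBall (0 : ℂ) R, ‖u z‖ ≤ C :=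
  (isCompact_closedBall (0 : ℂ) R).exists_bound_of_continuousOn hu.continuousOn

lemma memLp_of_isSmooth (hκ : R ^ 2 * |κ| < 1) {u : ℂ → ℂ} (hu : IsSmooth R u) :
    MemLp u 2 (weightedVolume κ R) := by
  have := isFiniteMeasure_weightedVolume hκ
  obtain ⟨C, hC⟩ := exists_bound_of_isSmooth hu
  exact MemLp.of_bound (aestronglyMeasurable_of_isSmooth hu) C
    ((ae_mem_disk κ R).mono fun z hz => hC z hz)

/-- A smooth function as an element of `L²`. -/
noncomputable def smoothL2 (hκ : R ^ 2 * |κ| < 1) {u : ℂ → ℂ} (hu : IsSmooth R u) : L2 κ R :=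
  (memLp_of_isSmooth hκ hu).toLp u

lemma coeFn_smoothL2 (hκ : R ^ 2 * |κ| < 1) {u : ℂ → ℂ} (hu : IsSmooth R u) :
    smoothL2 hκ hu =ᵐ[weightedVolume κ R] u := MemLp.coeFn_toLp _

lemma inner_smoothL2 (hκ : R ^ 2 * |κ| < 1) {u : ℂ → ℂ} (hu : IsSmooth R u) (f : L2 κ R) :
    inner ℂ (smoothL2 hκ hu) f = ∫ z, f z * starRingEnd ℂ (u z) ∂(weightedVolume κ R) := by
  rw [L2.inner_def]
  refine integral_congr_ae ((coeFn_smoothL2 hκ hu).mono fun z hz => ?_)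
  simp only [RCLike.inner_apply, hz]

/-! ### Transport of inner products and of the operator to the unit disk. -/

/-- The Jacobian factor `(R / (1 - κ R²))²` of the change of variables. -/
noncomputable def scaleSq (κ R : ℝ) : ℝ := (R / (1 - κ * R ^ 2)) ^ 2

lemma scaleSq_pos (hR : 0 < R) (hκ : R ^ 2 * |κ| < 1) : 0 < scaleSq κ R :=
  pow_pos (div_pos hR (one_sub_radius_pos hR hκ)) 2

lemma integral_mul_conj_pull (hR : 0 < R) (hκ : R ^ 2 * |κ| < 1) (u v : ℂ → ℂ) :
    ∫ z, pull κ R v z * starRingEnd ℂ (pull κ R u z) ∂(weightedVolume κ R)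
      = scaleSq κ R * ∫ ζ in Metric.closedBall (0 : ℂ) 1, v ζ * starRingEnd ℂ (u ζ) := by
  rw [scaleSq, Complex.ofReal_pow,
    ← integral_weight_sq_mul_comp hR hκ (fun ζ => v ζ * starRingEnd ℂ (u ζ))]
  congr 1
  ext z
  simp only [pull, map_mul, Complex.conj_ofReal]
  ring

lemma integral_congr_pull_push (hR : 0 < R) (hκ : R ^ 2 * |κ| < 1) (φ g : ℂ → ℂ) :
    ∫ z, φ z * starRingEnd ℂ (g z) ∂(weightedVolume κ R)
      = ∫ z, pull κ R (push κ R φ) z * starRingEnd ℂ (g z) ∂(weightedVolume κ R) :=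
  integral_congr_ae ((ae_mem_disk κ R).mono fun z hz => by simp only [pull_push hR hκ φ hz])

lemma inner_smoothL2_pull (hR : 0 < R) (hκ : R ^ 2 * |κ| < 1) {u φ : ℂ → ℂ} (hu : IsSmooth 1 u)
    (hφ : IsSmooth R φ) :
    inner ℂ (smoothL2 hκ (isSmooth_pull hR hκ hu)) (smoothL2 hκ hφ)
      = scaleSq κ R * ∫ ζ in Metric.closedBall (0 : ℂ) 1, push κ R φ ζ * starRingEnd ℂ (u ζ) := by
  rw [inner_smoothL2, ← integral_mul_conj_pull hR hκ, ← integral_congr_pull_push hR hκ]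
  refine integral_congr_ae ((coeFn_smoothL2 hκ hφ).mono fun z hz => ?_)
  simp only [hz]

lemma push_pull (hR : 0 < R) (hκ : R ^ 2 * |κ| < 1) (u : ℂ → ℂ) {ζ : ℂ}
    (hζ : ζ ∈ Metric.closedBall (0 : ℂ) 1) : push κ R (pull κ R u) ζ = u ζ := by
  rw [push, pull, diskMap_diskMapInv hR hκ hζ,
    mul_div_cancel_left₀ _ (weight_ne_zero hκ (mapsTo_diskMapInv hR hκ hζ))]

lemma divOp_congr {u v : ℂ → ℂ} (h : EqOn u v (Metric.closedBall (0 : ℂ) 1)) :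
    EqOn (divOp u) (divOp v) (Metric.closedBall (0 : ℂ) 1) := by
  have ha : ∀ {u v : ℂ → ℂ} (w : ℂ → ℂ), EqOn u v (Metric.closedBall (0 : ℂ) 1) →
      EqOn (along w u) (along w v) (Metric.closedBall (0 : ℂ) 1) := fun w h z hz => by
    rw [along, along, fderivWithin_congr h (h hz)]
  have hm : ∀ (w : ℂ → ℂ), EqOn (fun z => bdryDefect z * along w u z)
      (fun z => bdryDefect z * along w v z) (Metric.closedBall (0 : ℂ) 1) := fun w z hz => by
    simp only [ha w h hz]
  intro z hz
  rw [divOp, divOp, h hz, ha _ (hm _) hz, ha _ (hm _) hz, ha _ (ha _ h) hz]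

lemma diskMap_mem_ball (hR : 0 < R) (hκ : R ^ 2 * |κ| < 1) {z : ℂ}
    (hz : z ∈ Metric.ball (0 : ℂ) R) : diskMap κ R z ∈ Metric.ball (0 : ℂ) 1 := by
  have h1 := one_sub_pos hκ (Metric.ball_subset_closedBall hz)
  have h2 := one_sub_radius_pos hR hκ
  have hz' : ‖z‖ < R := by simpa using hz
  have h3 : 0 < 1 + κ * (R * ‖z‖) := by
    have : |κ * (R * ‖z‖)| < 1 := by
      rw [abs_mul, abs_of_nonneg (by positivity : 0 ≤ R * ‖z‖)]
      calc |κ| * (R * ‖z‖) ≤ |κ| * (R * R) := by gcongr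
        _ < 1 := by linarith
    linarith [(abs_lt.mp this).1]
  rw [mem_ball_zero_iff, diskMap, norm_mul, Complex.norm_real,
    Real.norm_of_nonneg (by positivity), div_div, div_mul_eq_mul_div, div_lt_one (by positivity)]
  nlinarith [mul_pos (sub_pos.mpr hz') h3]

lemma diskMap_ne_zero (hR : 0 < R) (hκ : R ^ 2 * |κ| < 1) {z : ℂ}
    (hz : z ∈ Metric.closedBall (0 : ℂ) R) (h0 : z ≠ 0) : diskMap κ R z ≠ 0 :=
  mul_ne_zero (Complex.ofReal_ne_zero.mpr (div_pos (div_pos (one_sub_radius_pos hR hκ)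
    (one_sub_pos hκ hz)) hR).ne') h0

/-- The boundary circle and the origin, where the polar formula cannot be compared with `divOp`, are
both null. -/
lemma ae_mem_ball_ne_zero (κ R : ℝ) :
    ∀ᵐ z ∂(weightedVolume κ R), z ∈ Metric.ball (0 : ℂ) R ∧ z ≠ 0 := by
  refine (withDensity_absolutelyContinuous _ _).ae_le ?_
  rw [volume_restrict_ball_eq]
  exact (ae_restrict_mem Metric.isOpen_ball.measurableSet).and
    (ae_restrict_of_ae (compl_mem_ae_iff.mpr (measure_singleton (0 : ℂ))))

lemma diskOp_ae_eq (hR : 0 < R) (hκ : R ^ 2 * |κ| < 1) {φ : ℂ → ℂ} (hφ : IsSmooth R φ) :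
    diskOp κ R φ =ᵐ[weightedVolume κ R] pull κ R (divOp (push κ R φ)) := by
  filter_upwards [ae_mem_ball_ne_zero κ R] with z hz
  rw [pull, ← euclideanOp_eq_divOp (isSmooth_push hR hκ hφ) (diskMap_mem_ball hR hκ hz.1)
    (diskMap_ne_zero hR hκ (Metric.ball_subset_closedBall hz.1) hz.2)]
  rfl

end SmoothL2

/-! ### The orthonormal family of Zernike functions -/

section Zernike

variable {κ R : ℝ}

lemma zernikePoly_eq_fun {n k : ℕ} :
    zernikePoly n k = fun z => (-1) ^ k * genPoly (n - k + 1) (k + 1) z :=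
  funext fun z => zernikePoly_eq z

lemma isSmooth_zernikePoly (n k : ℕ) : IsSmooth 1 (zernikePoly n k) := by
  rw [zernikePoly_eq_fun]
  exact (contDiff_const.isSmooth 1).mul (isSmooth_genPoly _ _)

lemma isSmooth_zernike (hR : 0 < R) (hκ : R ^ 2 * |κ| < 1) (n k : ℕ) :
    IsSmooth R (zernike κ R n k) := isSmooth_pull hR hκ (isSmooth_zernikePoly n k)

lemma conj_zernikePoly (n k : ℕ) (z : ℂ) :
    starRingEnd ℂ (zernikePoly n k z) = (-1) ^ k * genPoly (k + 1) (n - k + 1) z := by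
  rw [zernikePoly_eq, map_mul, conj_genPoly]
  simp

/-- This is the orthogonality on the unit disk, transported by `pull`; the norm depends on `n` alone
because `(n - k) + k = n`. -/
lemma inner_zernike (hR : 0 < R) (hκ : R ^ 2 * |κ| < 1) {n k m l : ℕ} (hk : k ≤ n) (hl : l ≤ m) :
    inner ℂ (smoothL2 hκ (isSmooth_zernike hR hκ n k)) (smoothL2 hκ (isSmooth_zernike hR hκ m l))
      = if n = m ∧ k = l then ((scaleSq κ R * (Real.pi / (n + 1)) : ℝ) : ℂ) else 0 := by
  refine (inner_smoothL2_pull hR hκ (isSmooth_zernikePoly n k) (isSmooth_zernike hR hκ m l)).trans ?_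
  have e : ∫ ζ in Metric.closedBall (0 : ℂ) 1,
      push κ R (zernike κ R m l) ζ * starRingEnd ℂ (zernikePoly n k ζ)
      = (-1) ^ (k + l) * ∫ ζ in Metric.closedBall (0 : ℂ) 1,
        genPoly (m - l + 1) (l + 1) ζ * genPoly (k + 1) (n - k + 1) ζ := by
    rw [← integral_const_mul]
    refine setIntegral_congr_fun Metric.isClosed_closedBall.measurableSet fun ζ hζ => ?_
    have : push κ R (zernike κ R m l) ζ = zernikePoly m l ζ := push_pull hR hκ _ hζ
    simp only [this, conj_zernikePoly]
    rw [zernikePoly_eq]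
    ring
  rw [e]
  split_ifs with h
  · obtain ⟨rfl, rfl⟩ := h
    rw [integral_genPoly_mul_conj, ← two_mul, pow_mul]
    have : ((n - k : ℕ) : ℂ) + k = n := by rw [← Nat.cast_add, Nat.sub_add_cancel hk]
    rw [this]
    push_cast
    ring
  · rw [integral_genPoly_mul_eq_zero]
    · simp
    · intro h'
      simp only [Prod.mk.injEq] at h'
      omega

/-- The `L²` norm of `zernike κ R n k`. -/
noncomputable def zernikeNorm (κ R : ℝ) (n : ℕ) : ℝ := √(scaleSq κ R * (Real.pi / (n + 1)))

lemma zernikeNorm_pos (hR : 0 < R) (hκ : R ^ 2 * |κ| < 1) (n : ℕ) : 0 < zernikeNorm κ R n :=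
  Real.sqrt_pos.mpr (mul_pos (scaleSq_pos hR hκ) (by positivity))

lemma sq_zernikeNorm (hR : 0 < R) (hκ : R ^ 2 * |κ| < 1) (n : ℕ) :
    zernikeNorm κ R n ^ 2 = scaleSq κ R * (Real.pi / (n + 1)) :=
  Real.sq_sqrt (mul_pos (scaleSq_pos hR hκ) (by positivity)).le

lemma eLpNorm_zernike (hR : 0 < R) (hκ : R ^ 2 * |κ| < 1) {n k : ℕ} (hk : k ≤ n) :
    (eLpNorm (zernike κ R n k) 2 (weightedVolume κ R)).toReal = zernikeNorm κ R n := by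
  have h1 := Lp.norm_toLp _ (memLp_of_isSmooth hκ (isSmooth_zernike hR hκ n k))
  have h2 := inner_self_eq_norm_sq_to_K (𝕜 := ℂ) (smoothL2 hκ (isSmooth_zernike hR hκ n k))
  rw [inner_zernike hR hκ hk hk, if_pos ⟨rfl, rfl⟩, ← sq_zernikeNorm hR hκ] at h2
  have h3 : zernikeNorm κ R n ^ 2 = ‖smoothL2 hκ (isSmooth_zernike hR hκ n k)‖ ^ 2 := by
    refine Complex.ofReal_injective (h2.trans ?_)
    push_cast
    rfl
  rw [← h1]
  exact ((pow_left_inj₀ (zernikeNorm_pos hR hκ n).le (norm_nonneg _) two_ne_zero).mp h3).symm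

lemma zernikeHat_eq (hR : 0 < R) (hκ : R ^ 2 * |κ| < 1) {n k : ℕ} (hk : k ≤ n) :
    zernikeHat κ R n k = fun z => ((zernikeNorm κ R n)⁻¹ : ℂ) * zernike κ R n k z := by
  ext z
  rw [zernikeHat, eLpNorm_zernike hR hκ hk, div_eq_inv_mul]

/-- The normalized Zernike functions in `L²`. -/
noncomputable def zernikeVec (hR : 0 < R) (hκ : R ^ 2 * |κ| < 1) (i : Σ n : ℕ, Fin (n + 1)) :
    L2 κ R :=
  ((zernikeNorm κ R i.1)⁻¹ : ℂ) • smoothL2 hκ (isSmooth_zernike hR hκ i.1 i.2)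

lemma coeFn_zernikeVec (hR : 0 < R) (hκ : R ^ 2 * |κ| < 1) (i : Σ n : ℕ, Fin (n + 1)) :
    zernikeVec hR hκ i =ᵐ[weightedVolume κ R] zernikeHat κ R i.1 i.2 := by
  filter_upwards [Lp.coeFn_smul ((zernikeNorm κ R i.1)⁻¹ : ℂ)
    (smoothL2 hκ (isSmooth_zernike hR hκ i.1 i.2)),
    coeFn_smoothL2 hκ (isSmooth_zernike hR hκ i.1 i.2)] with z h1 h2
  rw [zernikeVec, h1, Pi.smul_apply, h2, zernikeHat_eq hR hκ (Nat.le_of_lt_succ i.2.2), smul_eq_mul]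

lemma orthonormal_zernikeVec (hR : 0 < R) (hκ : R ^ 2 * |κ| < 1) :
    Orthonormal ℂ (zernikeVec hR hκ) := by
  rw [orthonormal_iff_ite]
  rintro ⟨n, k⟩ ⟨m, l⟩
  rw [zernikeVec, zernikeVec, inner_smul_left, inner_smul_right,
    inner_zernike hR hκ (Nat.le_of_lt_succ k.2) (Nat.le_of_lt_succ l.2)]
  by_cases h : n = m ∧ (k : ℕ) = l
  · obtain ⟨rfl, h⟩ := h
    obtain rfl := Fin.ext h
    rw [if_pos ⟨rfl, rfl⟩, if_pos rfl, ← sq_zernikeNorm hR hκ]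
    have : (zernikeNorm κ R n : ℂ) ≠ 0 := by exact_mod_cast (zernikeNorm_pos hR hκ n).ne'
    simp only [map_inv₀, Complex.conj_ofReal, Complex.ofReal_pow]
    field_simp
  · rw [if_neg h, if_neg]
    · simp
    · intro h'
      simp only [Sigma.mk.injEq] at h'
      obtain ⟨rfl, h'⟩ := h'
      exact h ⟨rfl, by rw [eq_of_heq h']⟩

/-! ### Completeness -/

lemma conj_mul_self_genPoly (i j : ℕ) (z : ℂ) :
    ((i : ℂ) + j + 1) * (starRingEnd ℂ z * genPoly (i + 1) (j + 1) z)
      = i * genPoly i (j + 1) z + (j + 1) * genPoly (i + 1) (j + 2) z := by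
  have := congrArg (starRingEnd ℂ) (mul_self_genPoly j i z)
  simp only [map_mul, map_add, conj_genPoly, map_one, Complex.conj_natCast] at this
  linear_combination this

lemma integral_mul_pull_genPoly (hR : 0 < R) (hκ : R ^ 2 * |κ| < 1) {f : L2 κ R}
    (hf : ∀ i, inner ℂ (zernikeVec hR hκ i) f = 0) (i j : ℕ) :
    ∫ z, f z * pull κ R (genPoly i j) z ∂(weightedVolume κ R) = 0 := by
  rcases i with _ | p
  · simp [pull]
  rcases j with _ | q
  · simp [pull]
  have h := hf ⟨p + q, ⟨p, by omega⟩⟩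
  rw [zernikeVec, inner_smul_left, mul_eq_zero] at h
  have hN : (zernikeNorm κ R (p + q) : ℂ) ≠ 0 := by exact_mod_cast (zernikeNorm_pos hR hκ _).ne'
  rcases h with h | h
  · simp [hN] at h
  rw [inner_smoothL2] at h
  have e : ∀ z, f z * pull κ R (genPoly (p + 1) (q + 1)) z
      = (-1) ^ p * (f z * starRingEnd ℂ (zernike κ R (p + q) p z)) := by
    intro z
    have : ((-1 : ℂ)) ^ p * (-1) ^ p = 1 := by rw [← mul_pow]; simp
    rw [zernike, map_mul, conj_zernikePoly, Complex.conj_ofReal, Nat.add_sub_cancel_left, pull]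
    linear_combination -(f z * weight κ z * genPoly (p + 1) (q + 1) (diskMap κ R z)) * this
  simp only [e]
  rw [integral_const_mul, h, mul_zero]

/-- The intertwining diffeomorphism as a continuous function on the closed disk. -/
noncomputable def diskMapC (hκ : R ^ 2 * |κ| < 1) : C(Metric.closedBall (0 : ℂ) R, ℂ) :=
  ⟨fun z => diskMap κ R z, (isSmooth_diskMap hκ).continuousOn.domRestrict⟩

/-- The span of the functions `Φ^* genPoly i j` in the continuous functions. -/
noncomputable def genSpan (hκ : R ^ 2 * |κ| < 1) :
    Submodule ℂ C(Metric.closedBall (0 : ℂ) R, ℂ) :=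
  Submodule.span ℂ (range fun p : ℕ × ℕ =>
    (⟨genPoly p.1 p.2, (contDiff_genPoly p.1 p.2).continuous⟩ : C(ℂ, ℂ)).comp (diskMapC hκ))

/-- Stone–Weierstrass. The three-term relations make the span stable under multiplication by `Φ` and
its conjugate, and it contains `1`; hence it contains the star algebra generated by `Φ`, which
separates points because `Φ` is injective. -/
lemma dense_genSpan (hR : 0 < R) (hκ : R ^ 2 * |κ| < 1)
    (x : C(Metric.closedBall (0 : ℂ) R, ℂ)) : x ∈ closure (genSpan hκ : Set _) := by
  set M := genSpan hκ with hM
  set Φ := diskMapC hκ with hΦ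
  set P : ℕ → ℕ → C(Metric.closedBall (0 : ℂ) R, ℂ) := fun i j =>
    (⟨genPoly i j, (contDiff_genPoly i j).continuous⟩ : C(ℂ, ℂ)).comp Φ with hP
  have hPM : ∀ i j, P i j ∈ M := fun i j => Submodule.subset_span ⟨(i, j), rfl⟩
  have hmul : ∀ y : C(Metric.closedBall (0 : ℂ) R, ℂ), (∀ i j, y * P i j ∈ M) →
      ∀ m ∈ M, y * m ∈ M := by
    intro y hy m hm
    induction hm using Submodule.span_induction with
    | mem m hm => obtain ⟨p, rfl⟩ := hm; exact hy _ _
    | zero => rw [mul_zero]; exact M.zero_mem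
    | add a b _ _ ha hb => rw [mul_add]; exact M.add_mem ha hb
    | smul c a _ ha => rw [mul_smul_comm]; exact M.smul_mem c ha
  have hzero : ∀ y i j, i = 0 ∨ j = 0 → y * P i j ∈ M := by
    intro y i j h
    have : P i j = 0 := by
      ext z
      rcases h with rfl | rfl <;> simp [hP]
    rw [this, mul_zero]
    exact M.zero_mem
  have hne : ∀ p q : ℕ, (p : ℂ) + q + 1 ≠ 0 := fun p q => by
    have : ((p + q + 1 : ℕ) : ℂ) ≠ 0 := by exact_mod_cast (p + q).succ_ne_zero
    simpa using this
  have h1 : ∀ m ∈ M, Φ * m ∈ M := by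
    refine hmul Φ fun i j => ?_
    rcases i with _ | p
    · exact hzero _ _ _ (Or.inl rfl)
    rcases j with _ | q
    · exact hzero _ _ _ (Or.inr rfl)
    have : Φ * P (p + 1) (q + 1) = ((p : ℂ) + q + 1)⁻¹ •
        (((p : ℂ) + 1) • P (p + 2) (q + 1) + (q : ℂ) • P (p + 1) q) := by
      ext z
      have := mul_self_genPoly p q (Φ z)
      simp only [hP, ContinuousMap.mul_apply, ContinuousMap.comp_apply, ContinuousMap.coe_mk,
        ContinuousMap.smul_apply, ContinuousMap.add_apply, smul_eq_mul]
      rw [← this, inv_mul_cancel_left₀ (hne p q)]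
    rw [this]
    exact M.smul_mem _ (M.add_mem (M.smul_mem _ (hPM _ _)) (M.smul_mem _ (hPM _ _)))
  have h2 : ∀ m ∈ M, star Φ * m ∈ M := by
    refine hmul (star Φ) fun i j => ?_
    rcases i with _ | p
    · exact hzero _ _ _ (Or.inl rfl)
    rcases j with _ | q
    · exact hzero _ _ _ (Or.inr rfl)
    have : star Φ * P (p + 1) (q + 1) = ((p : ℂ) + q + 1)⁻¹ •
        ((p : ℂ) • P p (q + 1) + ((q : ℂ) + 1) • P (p + 1) (q + 2)) := by
      ext z
      have := conj_mul_self_genPoly p q (Φ z)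
      simp only [hP, ContinuousMap.mul_apply, ContinuousMap.comp_apply, ContinuousMap.coe_mk,
        ContinuousMap.smul_apply, ContinuousMap.add_apply, smul_eq_mul, ContinuousMap.star_apply]
      rw [← this, ← starRingEnd_apply, inv_mul_cancel_left₀ (hne p q)]
    rw [this]
    exact M.smul_mem _ (M.add_mem (M.smul_mem _ (hPM _ _)) (M.smul_mem _ (hPM _ _)))
  have h3 : ∀ y ∈ StarAlgebra.adjoin ℂ {Φ}, ∀ m ∈ M, y * m ∈ M := by
    intro y hy
    change y ∈ (StarAlgebra.adjoin ℂ {Φ}).toSubalgebra at hy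
    rw [StarAlgebra.adjoin_toSubalgebra] at hy
    induction hy using Algebra.adjoin_induction with
    | mem y hy =>
      rcases hy with hy | hy
      · rw [mem_singleton_iff.mp hy]; exact h1
      · have : y = star Φ := by
          rw [Set.mem_star, mem_singleton_iff] at hy
          rw [← hy, star_star]
        rw [this]; exact h2
    | algebraMap r =>
      intro m hm
      rw [← Algebra.smul_def]
      exact M.smul_mem r hm
    | add a b _ _ ha hb => intro m hm; rw [add_mul]; exact M.add_mem (ha m hm) (hb m hm)
    | mul a b _ _ ha hb => intro m hm; rw [mul_assoc]; exact ha _ (hb m hm)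
  have hone : (1 : C(Metric.closedBall (0 : ℂ) R, ℂ)) ∈ M := by
    have : (1 : C(Metric.closedBall (0 : ℂ) R, ℂ)) = P 1 1 := by ext z; simp [hP]
    rw [this]; exact hPM 1 1
  have hsep : (StarAlgebra.adjoin ℂ {Φ}).SeparatesPoints := by
    intro a b hab
    refine ⟨Φ, ⟨Φ, StarAlgebra.subset_adjoin ℂ _ rfl, rfl⟩, fun h => hab (Subtype.ext ?_)⟩
    have h' : diskMap κ R a = diskMap κ R b := h
    rw [← diskMapInv_diskMap hR hκ a.2, h', diskMapInv_diskMap hR hκ b.2]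
  have htop := ContinuousMap.starSubalgebra_topologicalClosure_eq_top_of_separatesPoints
    (StarAlgebra.adjoin ℂ {Φ}) hsep
  have hx : x ∈ (StarAlgebra.adjoin ℂ {Φ}).topologicalClosure := by rw [htop]; trivial
  refine closure_mono (fun y hy => ?_) hx
  have := h3 y hy 1 hone
  rwa [mul_one] at this

lemma integrable_mul_of_isSmooth {g u : ℂ → ℂ} (hg : Integrable g (weightedVolume κ R))
    (hu : IsSmooth R u) : Integrable (fun z => g z * u z) (weightedVolume κ R) := by
  obtain ⟨C, hC⟩ := exists_bound_of_isSmooth hu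
  exact hg.mul_bdd (c := C) (aestronglyMeasurable_of_isSmooth hu)
    ((ae_mem_disk κ R).mono fun z hz => hC z hz)

/-- Elements of the span live on the subtype; integration needs a representative on all of `ℂ`, on
which orthogonality to `g` can be stated. -/
lemma exists_isSmooth_of_mem_genSpan (hR : 0 < R) (hκ : R ^ 2 * |κ| < 1) {g : ℂ → ℂ}
    (hg : Integrable g (weightedVolume κ R))
    (h : ∀ i j, ∫ z, g z * genPoly i j (diskMap κ R z) ∂(weightedVolume κ R) = 0)
    {m : C(Metric.closedBall (0 : ℂ) R, ℂ)} (hm : m ∈ genSpan hκ) :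
    ∃ u : ℂ → ℂ, IsSmooth R u ∧ (∀ z : Metric.closedBall (0 : ℂ) R, u z = m z) ∧
      ∫ z, g z * u z ∂(weightedVolume κ R) = 0 := by
  induction hm using Submodule.span_induction with
  | mem m hm =>
    obtain ⟨p, rfl⟩ := hm
    exact ⟨fun z => genPoly p.1 p.2 (diskMap κ R z), ContDiffOn.comp (isSmooth_genPoly _ _)
      (isSmooth_diskMap hκ) (mapsTo_diskMap hR hκ), fun z => rfl, h p.1 p.2⟩
  | zero => exact ⟨fun _ => 0, contDiff_const.isSmooth R, fun _ => rfl, by simp⟩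
  | add a b _ _ ha hb =>
    obtain ⟨u, hu, hu1, hu2⟩ := ha
    obtain ⟨v, hv, hv1, hv2⟩ := hb
    refine ⟨fun z => u z + v z, hu.add hv, fun z => by simp [hu1, hv1], ?_⟩
    simp only [mul_add]
    rw [integral_add (integrable_mul_of_isSmooth hg hu) (integrable_mul_of_isSmooth hg hv), hu2,
      hv2, add_zero]
  | smul c a _ ha =>
    obtain ⟨u, hu, hu1, hu2⟩ := ha
    refine ⟨fun z => c * u z, (contDiff_const.isSmooth R).mul hu, fun z => by simp [hu1], ?_⟩
    simp only [mul_left_comm _ c]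
    rw [integral_const_mul, hu2, mul_zero]

lemma norm_integral_le_of_genPoly (hR : 0 < R) (hκ : R ^ 2 * |κ| < 1) {g h : ℂ → ℂ}
    (hg : Integrable g (weightedVolume κ R))
    (hgen : ∀ i j, ∫ z, g z * genPoly i j (diskMap κ R z) ∂(weightedVolume κ R) = 0)
    (hh : IsSmooth R h) {ε : ℝ} (hε : 0 < ε) :
    ‖∫ z, g z * h z ∂(weightedVolume κ R)‖ ≤ ε * ∫ z, ‖g z‖ ∂(weightedVolume κ R) := by
  set x : C(Metric.closedBall (0 : ℂ) R, ℂ) :=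
    ⟨fun z => h z, hh.continuousOn.domRestrict⟩ with hx
  obtain ⟨m, hm, hxm⟩ := Metric.mem_closure_iff.mp (dense_genSpan hR hκ x) ε hε
  obtain ⟨u, hu, hu1, hu2⟩ := exists_isSmooth_of_mem_genSpan hR hκ hg hgen hm
  rw [← sub_zero (∫ z, g z * h z ∂(weightedVolume κ R)), ← hu2,
    ← integral_sub (integrable_mul_of_isSmooth hg hh) (integrable_mul_of_isSmooth hg hu),
    ← integral_const_mul]
  refine norm_integral_le_of_norm_le (hg.norm.const_mul ε) ?_
  filter_upwards [ae_mem_disk κ R] with z hz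
  have h2 : dist (x ⟨z, hz⟩) (m ⟨z, hz⟩) ≤ ε := (ContinuousMap.dist_apply_le_dist _).trans hxm.le
  rw [← hu1 ⟨z, hz⟩, dist_eq_norm] at h2
  rw [← mul_sub, norm_mul, mul_comm]
  exact mul_le_mul_of_nonneg_right h2 (norm_nonneg _)

/-- The function `w f` annihilates every `Φ^* genPoly`, hence by uniform density every smooth test
function, and therefore vanishes almost everywhere; `w` has no zeros on the disk. -/
lemma eq_zero_of_inner_zernikeVec (hR : 0 < R) (hκ : R ^ 2 * |κ| < 1) {f : L2 κ R}
    (hf : ∀ i, inner ℂ (zernikeVec hR hκ i) f = 0) : f = 0 := by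
  have hfin := isFiniteMeasure_weightedVolume hκ
  set g : ℂ → ℂ := fun z => f z * weight κ z with hg
  have hgi : Integrable g (weightedVolume κ R) :=
    integrable_mul_of_isSmooth ((Lp.memLp f).integrable (by norm_num)) (isSmooth_weight hκ)
  have hgen : ∀ i j, ∫ z, g z * genPoly i j (diskMap κ R z) ∂(weightedVolume κ R) = 0 := by
    intro i j
    rw [← integral_mul_pull_genPoly hR hκ hf i j]
    simp only [hg, pull, mul_assoc]
  have hzero : ∀ᵐ z ∂(weightedVolume κ R), g z = 0 := by
    refine ae_eq_zero_of_integral_contDiff_smul_eq_zero hgi.locallyIntegrable fun h hh _ => ?_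
    have hhs : IsSmooth R (fun z => (h z : ℂ)) :=
      (Complex.ofRealCLM.contDiff.comp hh).isSmooth R
    have hI : 0 ≤ ∫ z, ‖g z‖ ∂(weightedVolume κ R) := integral_nonneg fun _ => norm_nonneg _
    have e : ∫ z, h z • g z ∂(weightedVolume κ R) = ∫ z, g z * h z ∂(weightedVolume κ R) :=
      integral_congr_ae (Eventually.of_forall fun z => by
        simp only [Complex.real_smul]; ring)
    rw [e, ← norm_le_zero_iff]
    refine le_of_forall_pos_le_add fun ε hε => ?_
    -- The `+ 1` in the denominator avoids treating a vanishing integral of `‖g‖` separately.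
    have := norm_integral_le_of_genPoly hR hκ hgi hgen hhs
      (ε := ε / ((∫ z, ‖g z‖ ∂(weightedVolume κ R)) + 1)) (by positivity)
    rw [zero_add]
    refine this.trans ?_
    rw [div_mul_eq_mul_div, div_le_iff₀ (by positivity)]
    nlinarith
  refine Lp.eq_zero_iff_ae_eq_zero.mpr ?_
  filter_upwards [hzero, ae_mem_disk κ R] with z h1 h2
  simpa [hg, weight_ne_zero hκ h2] using h1

/-- The Hilbert basis of normalized Zernike functions. -/
noncomputable def zernikeBasis (hR : 0 < R) (hκ : R ^ 2 * |κ| < 1) :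
    HilbertBasis (Σ n : ℕ, Fin (n + 1)) ℂ (L2 κ R) :=
  HilbertBasis.mkOfOrthogonalEqBot (orthonormal_zernikeVec hR hκ) (by
    rw [eq_bot_iff]
    intro f hf
    refine (Submodule.mem_bot ℂ).mpr (eq_zero_of_inner_zernikeVec hR hκ fun i => ?_)
    exact (Submodule.mem_orthogonal _ _).mp hf _ (Submodule.subset_span (mem_range_self i)))

lemma zernikeBasis_apply (hR : 0 < R) (hκ : R ^ 2 * |κ| < 1) (i : Σ n : ℕ, Fin (n + 1)) :
    zernikeBasis hR hκ i = zernikeVec hR hκ i :=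
  congrFun (HilbertBasis.coe_mkOfOrthogonalEqBot _ _) i

end Zernike

section Scale

variable {κ R : ℝ}

/-! ### The operator in the Zernike basis -/

lemma integral_pull_divOp_mul_conj_zernike (hR : 0 < R) (hκ : R ^ 2 * |κ| < 1) {n k : ℕ}
    (hk : k ≤ n) {φ : ℂ → ℂ} (hφ : IsSmooth R φ) :
    ∫ z, pull κ R (divOp (push κ R φ)) z * starRingEnd ℂ (zernike κ R n k z) ∂(weightedVolume κ R)
      = ((n : ℂ) + 1) ^ 2
        * ∫ z, φ z * starRingEnd ℂ (zernike κ R n k z) ∂(weightedVolume κ R) := by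
  have e : zernike κ R n k = pull κ R (zernikePoly n k) := rfl
  rw [integral_congr_pull_push hR hκ φ, e, integral_mul_conj_pull hR hκ,
    integral_mul_conj_pull hR hκ]
  have h := integral_genPoly_mul_divOp k (n - k) (isSmooth_push hR hκ hφ)
  have hn : (k : ℂ) + ((n - k : ℕ) : ℂ) = n := by rw [← Nat.cast_add, Nat.add_sub_cancel' hk]
  rw [hn] at h
  have hc : ∀ u : ℂ → ℂ, ∫ ζ in Metric.closedBall (0 : ℂ) 1, u ζ * starRingEnd ℂ (zernikePoly n k ζ)
      = (-1) ^ k * ∫ ζ in Metric.closedBall (0 : ℂ) 1, genPoly (k + 1) (n - k + 1) ζ * u ζ := by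
    intro u
    rw [← integral_const_mul]
    refine integral_congr_ae (Eventually.of_forall fun ζ => ?_)
    simp only [conj_zernikePoly]
    ring
  rw [hc, hc, h]
  ring

lemma divOp_const_mul (c : ℂ) {u : ℂ → ℂ} (hu : IsSmooth 1 u) {z : ℂ}
    (hz : z ∈ Metric.ball (0 : ℂ) 1) : divOp (fun z => c * u z) z = c * divOp u z := by
  have hf : HasFDerivAt (fderivWithin ℝ u (Metric.closedBall (0 : ℂ) 1)) _ z :=
    ((hu.fderivWithin.contDiffAt (mem_of_superset (Metric.isOpen_ball.mem_nhds hz)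
      Metric.ball_subset_closedBall)).differentiableAt (by simp)).hasFDerivAt
  rw [divOp_eq hz (fun y hy => hu.hasFDerivAt hy) hf,
    divOp_eq hz (fun y hy => (hu.hasFDerivAt hy).const_mul c) (hf.const_smul c)]
  simp
  ring

lemma diskOp_zernike_ae_eq (hR : 0 < R) (hκ : R ^ 2 * |κ| < 1) {n k : ℕ} (hk : k ≤ n) :
    diskOp κ R (zernike κ R n k)
      =ᵐ[weightedVolume κ R] fun z => ((n : ℂ) + 1) ^ 2 * zernike κ R n k z := by
  filter_upwards [diskOp_ae_eq hR hκ (isSmooth_zernike hR hκ n k), ae_mem_ball_ne_zero κ R]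
    with z h1 h2
  have hb := diskMap_mem_ball hR hκ h2.1
  have h3 : divOp (push κ R (zernike κ R n k)) (diskMap κ R z)
      = ((n : ℂ) + 1) ^ 2 * zernikePoly n k (diskMap κ R z) := by
    rw [divOp_congr (u := push κ R (zernike κ R n k)) (v := zernikePoly n k) (fun ζ hζ => push_pull hR hκ _ hζ)
      (Metric.ball_subset_closedBall hb), zernikePoly_eq_fun,
      divOp_const_mul _ (isSmooth_genPoly _ _) hb, divOp_genPoly _ _ hb]
    have hn : ((n - k : ℕ) : ℂ) + k = n := by rw [← Nat.cast_add, Nat.sub_add_cancel hk]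
    rw [hn]
    ring
  rw [h1, pull, h3, zernike]
  ring

/-- The eigenvalue `(n + 1)²`. -/
noncomputable def eigenvalue (i : Σ n : ℕ, Fin (n + 1)) : ℝ := ((i.1 : ℝ) + 1) ^ 2

lemma eigenvalue_pos (i : Σ n : ℕ, Fin (n + 1)) : 0 < eigenvalue i := by
  unfold eigenvalue; positivity

lemma inner_zernikeBasis (hR : 0 < R) (hκ : R ^ 2 * |κ| < 1) (i : Σ n : ℕ, Fin (n + 1))
    (f : L2 κ R) :
    inner ℂ (zernikeBasis hR hκ i) f = (zernikeNorm κ R i.1 : ℂ)⁻¹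
      * ∫ z, f z * starRingEnd ℂ (zernike κ R i.1 i.2 z) ∂(weightedVolume κ R) := by
  rw [zernikeBasis_apply, zernikeVec, inner_smul_left, inner_smoothL2]
  simp

/-- Testing the weak relation against a Zernike function is legitimate because it is smooth up to
the boundary, and the operator acts on it by a scalar. -/
lemma IsImage.inner_eq (hR : 0 < R) (hκ : R ^ 2 * |κ| < 1) {f g : L2 κ R} (h : IsImage κ R f g)
    (i : Σ n : ℕ, Fin (n + 1)) :
    inner ℂ (zernikeBasis hR hκ i) g = eigenvalue i * inner ℂ (zernikeBasis hR hκ i) f := by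
  rw [inner_zernikeBasis, inner_zernikeBasis, ← h _ (isSmooth_zernike hR hκ i.1 i.2)]
  have e : ∫ z, f z * starRingEnd ℂ (diskOp κ R (zernike κ R i.1 i.2) z) ∂(weightedVolume κ R)
      = ((i.1 : ℂ) + 1) ^ 2
        * ∫ z, f z * starRingEnd ℂ (zernike κ R i.1 i.2 z) ∂(weightedVolume κ R) := by
    rw [← integral_const_mul]
    refine integral_congr_ae
      ((diskOp_zernike_ae_eq hR hκ (Nat.le_of_lt_succ i.2.2)).mono fun z hz => ?_)
    simp only [hz, map_mul, map_pow, map_add, map_one, Complex.conj_natCast]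
    ring
  rw [e, eigenvalue]
  push_cast
  ring

/-- Here the test function is arbitrary, so the symmetry of `divOp` is what moves the operator onto
the Zernike function. -/
lemma isImage_zernikeBasis (hR : 0 < R) (hκ : R ^ 2 * |κ| < 1) (i : Σ n : ℕ, Fin (n + 1)) :
    IsImage κ R (zernikeBasis hR hκ i) ((eigenvalue i : ℂ) • zernikeBasis hR hκ i) := by
  intro φ hφ
  have hk := Nat.le_of_lt_succ i.2.2
  have hb : zernikeBasis hR hκ i =ᵐ[weightedVolume κ R]
      fun z => ((zernikeNorm κ R i.1)⁻¹ : ℂ) * zernike κ R i.1 i.2 z := by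
    rw [zernikeBasis_apply, ← zernikeHat_eq hR hκ hk]
    exact coeFn_zernikeVec hR hκ i
  have h1 := congrArg (starRingEnd ℂ) (integral_pull_divOp_mul_conj_zernike hR hκ hk hφ)
  rw [map_mul, ← integral_conj, ← integral_conj] at h1
  simp only [map_mul, Complex.conj_conj, map_pow, map_add, map_one, Complex.conj_natCast] at h1
  have h2 : ∫ z, zernikeBasis hR hκ i z * starRingEnd ℂ (diskOp κ R φ z) ∂(weightedVolume κ R)
      = ((zernikeNorm κ R i.1)⁻¹ : ℂ) * ∫ z, starRingEnd ℂ (pull κ R (divOp (push κ R φ)) z)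
        * zernike κ R i.1 i.2 z ∂(weightedVolume κ R) := by
    rw [← integral_const_mul]
    refine integral_congr_ae ?_
    filter_upwards [hb, diskOp_ae_eq hR hκ hφ] with z hz hz'
    rw [hz, hz']
    ring
  have h3 : ∫ z, ((eigenvalue i : ℂ) • zernikeBasis hR hκ i : L2 κ R) z * starRingEnd ℂ (φ z)
      ∂(weightedVolume κ R)
      = ((zernikeNorm κ R i.1)⁻¹ : ℂ) * (((i.1 : ℂ) + 1) ^ 2
        * ∫ z, starRingEnd ℂ (φ z) * zernike κ R i.1 i.2 z ∂(weightedVolume κ R)) := by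
    rw [← integral_const_mul, ← integral_const_mul]
    refine integral_congr_ae ?_
    filter_upwards [hb, Lp.coeFn_smul (eigenvalue i : ℂ) (zernikeBasis hR hκ i)] with z hz hz'
    rw [hz', Pi.smul_apply, hz, eigenvalue, smul_eq_mul]
    push_cast
    ring
  rw [h2, h3, h1]

/-! ### Coefficient description of the scales -/

/-- If a relation `A` acts diagonally in the Hilbert basis `e`, its powers computed in any
eigenbasis are diagonal in `e` as well. -/
lemma IsPowerImage.inner_eq {H ι : Type} [NormedAddCommGroup H] [InnerProductSpace ℂ H]
    {A : H → H → Prop} {e : HilbertBasis ι ℂ H} {ν : ι → ℝ}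
    (hA : ∀ f g, A f g → ∀ i, inner ℂ (e i) g = ν i * inner ℂ (e i) f) {t : ℝ} {f g : H}
    (h : IsPowerImage A t f g) (i : ι) :
    inner ℂ (e i) g = ((ν i ^ t : ℝ) : ℂ) * inner ℂ (e i) f := by
  obtain ⟨J, b, lam, hb, hfg⟩ := h
  have h1 := b.hasSum_inner_mul_inner (e i) g
  have h2 := (b.hasSum_inner_mul_inner (e i) f).mul_left (((ν i ^ t : ℝ) : ℂ))
  refine h1.unique (h2.congr_fun ?_)
  intro j
  rw [hfg j]
  have h3 := hA _ _ (hb j).2 i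
  rw [inner_smul_right] at h3
  -- Eigenvectors for different eigenvalues are orthogonal: `e i` meets only those `b j` with `lam j
  -- = ν i`, so the choice of eigenbasis does not matter.
  by_cases h0 : inner ℂ (e i) (b j) = 0
  · simp [h0]
  · have : lam j = ν i := by exact_mod_cast mul_right_cancel₀ h0 h3
    rw [this]
    ring

lemma mem_hilbertScale_iff (hR : 0 < R) (hκ : R ^ 2 * |κ| < 1) {s : ℝ} {f : L2 κ R} :
    f ∈ hilbertScale κ R s ↔ ∃ g : L2 κ R, ∀ i, inner ℂ (zernikeBasis hR hκ i) g
      = (((i.1 : ℝ) + 1) ^ s : ℝ) * inner ℂ (zernikeBasis hR hκ i) f := by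
  have hpow : ∀ i : Σ n : ℕ, Fin (n + 1), eigenvalue i ^ (s / 2) = ((i.1 : ℝ) + 1) ^ s := by
    intro i
    rw [eigenvalue, ← Real.rpow_natCast, ← Real.rpow_mul (by positivity)]
    congr 1
    push_cast
    ring
  constructor
  · rintro ⟨g, hg⟩
    refine ⟨g, fun i => ?_⟩
    rw [← hpow]
    exact hg.inner_eq (fun f g h i => h.inner_eq hR hκ i) i
  · rintro ⟨g, hg⟩
    refine ⟨g, _, zernikeBasis hR hκ, eigenvalue,
      fun i => ⟨eigenvalue_pos i, isImage_zernikeBasis hR hκ i⟩, fun i => ?_⟩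
    rw [hpow]
    exact hg i

/-- Bessel's inequality in one direction, Riesz–Fischer in the other. -/
lemma exists_inner_eq_iff_summable {H ι : Type} [NormedAddCommGroup H] [InnerProductSpace ℂ H]
    [CompleteSpace H] (e : HilbertBasis ι ℂ H) (c : ι → ℂ) :
    (∃ g : H, ∀ i, inner ℂ (e i) g = c i) ↔ Summable fun i => ‖c i‖ ^ 2 := by
  constructor
  · rintro ⟨g, hg⟩
    simpa only [hg] using e.orthonormal.inner_products_summable g
  · intro h
    have hm : Memℓp c 2 := by
      refine memℓp_gen ?_
      simpa using h
    refine ⟨e.repr.symm ⟨c, hm⟩, fun i => ?_⟩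
    rw [← e.repr_apply_apply, LinearIsometryEquiv.apply_symm_apply]

lemma mem_hilbertScale_iff_summable (hR : 0 < R) (hκ : R ^ 2 * |κ| < 1) {s : ℝ} {f : L2 κ R} :
    f ∈ hilbertScale κ R s ↔ Summable fun i : Σ n : ℕ, Fin (n + 1) =>
      ((i.1 : ℝ) + 1) ^ (2 * s) * ‖inner ℂ (zernikeBasis hR hκ i) f‖ ^ 2 := by
  rw [mem_hilbertScale_iff hR hκ, exists_inner_eq_iff_summable (zernikeBasis hR hκ) fun i =>
    (((i.1 : ℝ) + 1) ^ s : ℝ) * inner ℂ (zernikeBasis hR hκ i) f]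
  refine summable_congr fun i => ?_
  have hp : 0 ≤ ((i.1 : ℝ) + 1) := by positivity
  rw [norm_mul, mul_pow, Complex.norm_real, Real.norm_of_nonneg (Real.rpow_nonneg hp s),
    ← Real.rpow_natCast, ← Real.rpow_mul hp, mul_comm s]
  norm_num

lemma summable_rows_iff (a : (Σ n : ℕ, Fin (n + 1)) → ℝ) (ha : ∀ i, 0 ≤ a i) (w : ℕ → ℝ)
    (hw : ∀ n, 0 ≤ w n) :
    Summable (fun i : Σ n : ℕ, Fin (n + 1) => w i.1 * a i) ↔
      Summable fun n => w n * ∑ k : Fin (n + 1), a ⟨n, k⟩ := by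
  rw [summable_sigma_of_nonneg fun i => mul_nonneg (hw _) (ha _)]
  simp only [tsum_fintype, Finset.mul_sum]
  exact ⟨fun h => h.2, fun h => ⟨fun n => (hasSum_fintype _).summable, h⟩⟩

lemma sum_rows_eq {H : Type} [AddCommMonoid H] (c : ℕ → ℕ → H) (N : ℕ) :
    ∑ i ∈ (Finset.range N).sigma (fun n => (Finset.univ : Finset (Fin (n + 1)))), c i.1 i.2
      = ∑ n ∈ Finset.range N, ∑ k ∈ Finset.range (n + 1), c n k := by
  rw [Finset.sum_sigma]
  exact Finset.sum_congr rfl fun n _ => Fin.sum_univ_eq_sum_range (fun k => c n k) (n + 1)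

lemma tendsto_eLpNorm_iff (hR : 0 < R) (hκ : R ^ 2 * |κ| < 1) (f : L2 κ R) (c : ℕ → ℕ → ℂ) :
    Tendsto (fun N : ℕ => eLpNorm (fun z => f z - ∑ n ∈ Finset.range N,
      ∑ k ∈ Finset.range (n + 1), c n k * zernikeHat κ R n k z) 2 (weightedVolume κ R))
      atTop (𝓝 0) ↔
    Tendsto (fun N : ℕ => ∑ i ∈ (Finset.range N).sigma
      (fun n => (Finset.univ : Finset (Fin (n + 1)))), c i.1 i.2 • zernikeBasis hR hκ i)
      atTop (𝓝 f) := by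
  have e : ∀ N : ℕ, eLpNorm (fun z => f z - ∑ n ∈ Finset.range N,
      ∑ k ∈ Finset.range (n + 1), c n k * zernikeHat κ R n k z) 2 (weightedVolume κ R)
      = edist (∑ i ∈ (Finset.range N).sigma (fun n => (Finset.univ : Finset (Fin (n + 1)))),
        c i.1 i.2 • zernikeBasis hR hκ i) f := by
    intro N
    rw [edist_comm, Lp.edist_def]
    refine eLpNorm_congr_ae ?_
    have h1 : ∀ᵐ z ∂(weightedVolume κ R), ∀ i, zernikeBasis hR hκ i z = zernikeHat κ R i.1 i.2 z :=
      ae_all_iff.mpr fun i => by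
        rw [zernikeBasis_apply]; exact coeFn_zernikeVec hR hκ i
    have h2 : ∀ᵐ z ∂(weightedVolume κ R), ∀ i : Σ n : ℕ, Fin (n + 1),
        (c i.1 i.2 • zernikeBasis hR hκ i : L2 κ R) z = c i.1 i.2 * zernikeBasis hR hκ i z :=
      ae_all_iff.mpr fun i => Lp.coeFn_smul _ _
    filter_upwards [h1, h2, Lp.coeFn_finsetSum
      ((Finset.range N).sigma (fun n => (Finset.univ : Finset (Fin (n + 1)))))
      (fun i => c i.1 i.2 • zernikeBasis hR hκ i)] with z h1 h2 h3
    rw [Pi.sub_apply, h3, ← sum_rows_eq (fun n k => c n k * zernikeHat κ R n k z)]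
    simp only [Finset.sum_apply]
    congr 1
    exact Finset.sum_congr rfl fun i _ => by rw [h2, h1]
  simp only [e]
  exact (tendsto_iff_edist_tendsto_0).symm

lemma mem_zernikeScale_iff_summable (hR : 0 < R) (hκ : R ^ 2 * |κ| < 1) {s : ℝ} {f : L2 κ R} :
    f ∈ zernikeScale κ R s ↔ Summable fun i : Σ n : ℕ, Fin (n + 1) =>
      ((i.1 : ℝ) + 1) ^ (2 * s) * ‖inner ℂ (zernikeBasis hR hκ i) f‖ ^ 2 := by
  have hw : ∀ n : ℕ, 0 ≤ ((n : ℝ) + 1) ^ (2 * s) := fun n => by positivity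
  have hT : Tendsto (fun N : ℕ => (Finset.range N).sigma
      (fun n => (Finset.univ : Finset (Fin (n + 1))))) atTop atTop := by
    refine tendsto_atTop_finset_of_monotone ?_ fun i => ⟨i.1 + 1, by simp⟩
    intro N M h
    exact Finset.sigma_mono (Finset.range_mono h) fun _ => le_rfl
  rw [summable_rows_iff (fun i => ‖inner ℂ (zernikeBasis hR hκ i) f‖ ^ 2) (fun i => by positivity)
    (fun n => ((n : ℝ) + 1) ^ (2 * s)) hw]
  constructor
  · rintro ⟨c, h1, h2⟩
    rw [tendsto_eLpNorm_iff hR hκ] at h1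
    have hc : ∀ i : Σ n : ℕ, Fin (n + 1), inner ℂ (zernikeBasis hR hκ i) f = c i.1 i.2 := by
      intro i
      have h3 := (tendsto_const_nhds (x := zernikeBasis hR hκ i)).inner h1 (𝕜 := ℂ)
      refine tendsto_nhds_unique h3 (tendsto_const_nhds.congr' ?_)
      -- Once the row of `i` is included, the `i`-th coefficient of the partial sum no longer
      -- changes, so the limit determines `c`.
      filter_upwards [hT.eventually (eventually_ge_atTop {i})] with N hN
      rw [(zernikeBasis hR hκ).orthonormal.inner_right_sum _ (hN (Finset.mem_singleton_self i))]
    refine h2.congr fun n => ?_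
    simp only [hc]
    rw [Fin.sum_univ_eq_sum_range (fun k => ‖c n k‖ ^ 2) (n + 1)]
  · intro h
    -- Entries with `k > n` never enter the sums, so the default `0` plays no role.
    refine ⟨fun n k => if hk : k < n + 1 then inner ℂ (zernikeBasis hR hκ ⟨n, ⟨k, hk⟩⟩) f else 0,
      ?_, ?_⟩
    · rw [tendsto_eLpNorm_iff hR hκ]
      have h1 := ((zernikeBasis hR hκ).hasSum_repr f).comp hT
      refine h1.congr fun N => Finset.sum_congr rfl fun i _ => ?_
      simp only [HilbertBasis.repr_apply_apply]
      rw [dif_pos i.2.2]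
    · refine h.congr fun n => ?_
      rw [← Fin.sum_univ_eq_sum_range]
      congr 1
      exact Finset.sum_congr rfl fun k _ => by simp only [dif_pos k.2]

lemma hilbertScale_eq_zernikeScale (hR : 0 < R) (hκ : R ^ 2 * |κ| < 1) (s : ℝ) :
    hilbertScale κ R s = zernikeScale κ R s := by
  ext f
  rw [mem_hilbertScale_iff_summable hR hκ, mem_zernikeScale_iff_summable hR hκ]

/-! ### Smooth functions belong to the whole scale -/

/-- The image is represented through `divOp`, which is smooth on the whole closed disk, unlike the
polar expression at the origin. -/
lemma exists_smooth_image (hR : 0 < R) (hκ : R ^ 2 * |κ| < 1) {f : L2 κ R}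
    (hf : f ∈ smoothFunctions κ R) : ∃ g ∈ smoothFunctions κ R, ∀ i,
      inner ℂ (zernikeBasis hR hκ i) g = eigenvalue i * inner ℂ (zernikeBasis hR hκ i) f := by
  obtain ⟨φ, hφ, hfφ⟩ := hf
  have hg := isSmooth_pull hR hκ (isSmooth_push hR hκ hφ).divOp
  refine ⟨smoothL2 hκ hg, ⟨_, hg, coeFn_smoothL2 hκ hg⟩, fun i => ?_⟩
  rw [inner_zernikeBasis, inner_zernikeBasis]
  have e1 : ∫ z, smoothL2 hκ hg z * starRingEnd ℂ (zernike κ R i.1 i.2 z) ∂(weightedVolume κ R)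
      = ∫ z, pull κ R (divOp (push κ R φ)) z * starRingEnd ℂ (zernike κ R i.1 i.2 z)
        ∂(weightedVolume κ R) :=
    integral_congr_ae ((coeFn_smoothL2 hκ hg).mono fun z hz => by simp only [hz])
  have e2 : ∫ z, f z * starRingEnd ℂ (zernike κ R i.1 i.2 z) ∂(weightedVolume κ R)
      = ∫ z, φ z * starRingEnd ℂ (zernike κ R i.1 i.2 z) ∂(weightedVolume κ R) :=
    integral_congr_ae (hfφ.mono fun z hz => by simp only [hz])
  rw [e1, e2, integral_pull_divOp_mul_conj_zernike hR hκ (Nat.le_of_lt_succ i.2.2) hφ, eigenvalue]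
  push_cast
  ring

lemma smoothFunctions_subset_hilbertScale (hR : 0 < R) (hκ : R ^ 2 * |κ| < 1) (s : ℝ) :
    smoothFunctions κ R ⊆ hilbertScale κ R s := by
  intro f hf
  have hiter : ∀ m : ℕ, ∃ g ∈ smoothFunctions κ R, ∀ i, inner ℂ (zernikeBasis hR hκ i) g
      = (eigenvalue i : ℂ) ^ m * inner ℂ (zernikeBasis hR hκ i) f := by
    intro m
    induction m with
    | zero => exact ⟨f, hf, by simp⟩
    | succ m ih =>
      obtain ⟨g, hg, hgi⟩ := ih
      obtain ⟨h, hh, hhi⟩ := exists_smooth_image hR hκ hg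
      exact ⟨h, hh, fun i => by rw [hhi, hgi]; ring⟩
  -- Applying the operator `m` times gives square-summability with weight `(n + 1)^(4m)`, which
  -- dominates `(n + 1)^(2s)`.
  obtain ⟨m, hm⟩ := exists_nat_ge s
  obtain ⟨g, -, hg⟩ := hiter m
  rw [mem_hilbertScale_iff_summable hR hκ]
  refine Summable.of_nonneg_of_le (fun i => by positivity) (fun i => ?_)
    ((zernikeBasis hR hκ).orthonormal.inner_products_summable g)
  rw [hg, norm_mul, mul_pow, ← Complex.ofReal_pow, Complex.norm_real,
    Real.norm_of_nonneg (pow_nonneg (eigenvalue_pos i).le m)]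
  gcongr
  rw [eigenvalue, ← pow_mul, ← pow_mul, ← Real.rpow_natCast]
  refine Real.rpow_le_rpow_of_exponent_le (by simp) ?_
  push_cast
  have : (0 : ℝ) ≤ m := Nat.cast_nonneg m
  linarith

end Scale

/-! ### Series of smooth functions on the closed disk -/

/-- Termwise differentiation holds in the open disk. The differentiated series converges uniformly
up to the circle, and a derivative that extends continuously to the closure of a convex open set is
the derivative there. -/
lemma hasFDerivWithinAt_tsum_closedBall {ι F : Type} [NormedAddCommGroup F] [NormedSpace ℝ F]
    [CompleteSpace F] {f : ι → ℂ → F} (hf : ∀ i, ContDiff ℝ ∞ (f i)) {v₀ v₁ : ι → ℝ}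
    (hv₀ : Summable v₀) (hv₁ : Summable v₁)
    (h₀ : ∀ i, ∀ z ∈ Metric.closedBall (0 : ℂ) 1, ‖f i z‖ ≤ v₀ i)
    (h₁ : ∀ i, ∀ z ∈ Metric.closedBall (0 : ℂ) 1, ‖fderiv ℝ (f i) z‖ ≤ v₁ i)
    {z : ℂ} (hz : z ∈ Metric.closedBall (0 : ℂ) 1) :
    HasFDerivWithinAt (fun z => ∑' i, f i z) (∑' i, fderiv ℝ (f i) z)
      (Metric.closedBall (0 : ℂ) 1) z := by
  have hcl : closure (Metric.ball (0 : ℂ) 1) = Metric.closedBall 0 1 :=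
    closure_ball 0 one_ne_zero
  have hin : ∀ y ∈ Metric.ball (0 : ℂ) 1,
      HasFDerivAt (fun z => ∑' i, f i z) (∑' i, fderiv ℝ (f i) y) y := fun y hy =>
    hasFDerivAt_tsum_of_isPreconnected hv₁ Metric.isOpen_ball
      (convex_ball (0 : ℂ) 1).isPreconnected
      (fun i x _ => ((hf i).differentiable (by simp) x).hasFDerivAt)
      (fun i x hx => h₁ i x (Metric.ball_subset_closedBall hx)) hy
      (hv₀.of_norm_bounded fun i => h₀ i y (Metric.ball_subset_closedBall hy)) hy
  have hc : ContinuousOn (fun z => ∑' i, f i z) (Metric.closedBall (0 : ℂ) 1) :=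
    continuousOn_tsum (fun i => (hf i).continuous.continuousOn) hv₀ h₀
  have hc' : ContinuousOn (fun z => ∑' i, fderiv ℝ (f i) z) (Metric.closedBall (0 : ℂ) 1) :=
    continuousOn_tsum (fun i => ((hf i).continuous_fderiv (by simp)).continuousOn) hv₁ h₁
  have := hasFDerivWithinAt_closure_of_tendsto_fderiv (f := fun z => ∑' i, f i z)
    (s := Metric.ball (0 : ℂ) 1) (x := z) (f' := ∑' i, fderiv ℝ (f i) z)
    (fun y hy => (hin y hy).differentiableAt.differentiableWithinAt) (convex_ball 0 1)
    Metric.isOpen_ball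
    (fun y hy => (hc y (hcl ▸ hy)).mono Metric.ball_subset_closedBall)
    (((hc' z hz).mono Metric.ball_subset_closedBall).tendsto.congr' (by
      filter_upwards [self_mem_nhdsWithin] with y hy using (hin y hy).fderiv.symm))
  rwa [hcl] at this

/-- Induction on `m` through the series of derivatives; the target space varies because that series
takes values in linear maps. -/
lemma contDiffOn_tsum_closedBall {ι : Type} (m : ℕ) {F : Type} [NormedAddCommGroup F]
    [NormedSpace ℝ F] [CompleteSpace F] {f : ι → ℂ → F} (hf : ∀ i, ContDiff ℝ ∞ (f i))
    (h : ∀ k : ℕ, ∃ v : ι → ℝ, Summable v ∧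
      ∀ i, ∀ z ∈ Metric.closedBall (0 : ℂ) 1, ‖iteratedFDeriv ℝ k (f i) z‖ ≤ v i) :
    ContDiffOn ℝ m (fun z => ∑' i, f i z) (Metric.closedBall (0 : ℂ) 1) := by
  obtain ⟨v₀, hv₀, h₀⟩ := h 0
  simp only [norm_iteratedFDeriv_zero] at h₀
  induction m generalizing F v₀ with
  | zero =>
    rw [Nat.cast_zero, contDiffOn_zero]
    exact continuousOn_tsum (fun i => (hf i).continuous.continuousOn) hv₀ h₀
  | succ m ih =>
    obtain ⟨v₁, hv₁, h₁⟩ := h 1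
    have h₁' : ∀ i, ∀ z ∈ Metric.closedBall (0 : ℂ) 1, ‖fderiv ℝ (f i) z‖ ≤ v₁ i := fun i z hz => by
      rw [← norm_iteratedFDeriv_zero (𝕜 := ℝ), norm_iteratedFDeriv_fderiv]
      exact h₁ i z hz
    rw [Nat.cast_add, Nat.cast_one, contDiffOn_succ_iff_hasFDerivWithinAt_of_uniqueDiffOn
      (uniqueDiffOn_closedBall one_pos)]
    refine ⟨fun h => absurd h (by simp), fun z => ∑' i, fderiv ℝ (f i) z, ?_, fun z hz =>
      hasFDerivWithinAt_tsum_closedBall hf hv₀ hv₁ h₀ h₁' hz⟩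
    refine ih (fun i => (hf i).fderiv_right (by simp)) (fun k => ?_) v₁ hv₁ h₁'
    obtain ⟨v, hv, hk⟩ := h (k + 1)
    exact ⟨v, hv, fun i z hz => by rw [norm_iteratedFDeriv_fderiv]; exact hk i z hz⟩

lemma isSmooth_tsum {ι : Type} {f : ι → ℂ → ℂ} (hf : ∀ i, ContDiff ℝ ∞ (f i))
    (h : ∀ k : ℕ, ∃ v : ι → ℝ, Summable v ∧
      ∀ i, ∀ z ∈ Metric.closedBall (0 : ℂ) 1, ‖iteratedFDeriv ℝ k (f i) z‖ ≤ v i) :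
    IsSmooth 1 (fun z => ∑' i, f i z) :=
  contDiffOn_infty.mpr fun m => contDiffOn_tsum_closedBall m hf h

/-! ### The intersection of the scale consists of smooth functions -/

section Reconstruction

variable {κ R : ℝ}

lemma contDiff_zernikePoly (n k : ℕ) : ContDiff ℝ ∞ (zernikePoly n k) := by
  rw [zernikePoly_eq_fun]
  exact contDiff_const.mul (contDiff_genPoly _ _)

lemma norm_iteratedFDeriv_zernikePoly_le {z : ℂ} (hz : ‖z‖ ≤ 1) (m : ℕ) {n k : ℕ} (hk : k ≤ n) :
    ‖iteratedFDeriv ℝ m (zernikePoly n k) z‖ ≤ 2 ^ m * (3 * ((n : ℝ) + 1)) ^ (2 * m + 1) := by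
  have e : zernikePoly n k = ((-1 : ℂ) ^ k) • genPoly (n - k + 1) (k + 1) := by
    rw [zernikePoly_eq_fun]; rfl
  rw [e, iteratedFDeriv_const_smul_apply ((contDiff_genPoly _ _).of_le (by
    exact_mod_cast le_top)).contDiffAt, norm_smul, norm_pow, norm_neg, norm_one, one_pow, one_mul]
  refine (norm_iteratedFDeriv_genPoly_le hz m _ _).trans ?_
  gcongr
  have : ((n - k : ℕ) : ℝ) + k = n := by rw [← Nat.cast_add, Nat.sub_add_cancel hk]
  push_cast
  have : (0 : ℝ) ≤ n := Nat.cast_nonneg n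
  linarith

/-- The true growth is `√(n + 1)`; a linear bound suffices and keeps the exponents integral. -/
lemma inv_zernikeNorm_le (hR : 0 < R) (hκ : R ^ 2 * |κ| < 1) (n : ℕ) :
    (zernikeNorm κ R n)⁻¹ ≤ (zernikeNorm κ R 0)⁻¹ * ((n : ℝ) + 1) := by
  have h0 := zernikeNorm_pos hR hκ 0
  have hn := zernikeNorm_pos hR hκ n
  have h : zernikeNorm κ R 0 ≤ ((n : ℝ) + 1) * zernikeNorm κ R n := by
    refine le_of_sq_le_sq ?_ (by positivity)
    rw [mul_pow, sq_zernikeNorm hR hκ, sq_zernikeNorm hR hκ]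
    have hs := scaleSq_pos hR hκ
    have : ((n : ℝ) + 1) ^ 2 * (scaleSq κ R * (Real.pi / (n + 1)))
        = ((n : ℝ) + 1) * (scaleSq κ R * Real.pi) := by
      field_simp
    rw [this, Nat.cast_zero, zero_add, div_one]
    refine le_mul_of_one_le_left (by positivity) (by simp)
  rw [inv_le_iff_one_le_mul₀ hn, mul_assoc, inv_mul_eq_div, one_le_div h0]
  exact h

lemma norm_inner_zernikeBasis_le (hR : 0 < R) (hκ : R ^ 2 * |κ| < 1) {f : L2 κ R} (p : ℕ)
    (hf : f ∈ hilbertScale κ R p) : ∃ K : ℝ, 0 ≤ K ∧ ∀ i,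
      ‖inner ℂ (zernikeBasis hR hκ i) f‖ ≤ K * (((i.1 : ℝ) + 1) ^ p)⁻¹ := by
  rw [mem_hilbertScale_iff_summable hR hκ] at hf
  refine ⟨√(∑' i : Σ n : ℕ, Fin (n + 1),
    ((i.1 : ℝ) + 1) ^ (2 * (p : ℝ)) * ‖inner ℂ (zernikeBasis hR hκ i) f‖ ^ 2), Real.sqrt_nonneg _,
    fun i => ?_⟩
  rw [← div_eq_mul_inv, le_div_iff₀ (by positivity)]
  refine Real.le_sqrt_of_sq_le ?_
  refine le_trans (le_of_eq ?_) (hf.le_tsum i fun _ _ => by positivity)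
  have : ((i.1 : ℝ) + 1) ^ (2 * (p : ℝ)) = (((i.1 : ℝ) + 1) ^ p) ^ 2 := by
    rw [← pow_mul, ← Real.rpow_natCast]
    congr 1
    push_cast
    ring
  rw [this]
  ring

/-- Row `n` has `n + 1` entries, so one power is lost and `∑ (n + 1)⁻²` remains. -/
lemma summable_inv_cube :
    Summable fun i : Σ n : ℕ, Fin (n + 1) => (((i.1 : ℝ) + 1) ^ 3)⁻¹ := by
  have h := (summable_rows_iff (fun _ => 1) (fun _ => zero_le_one)
    (fun n => (((n : ℝ) + 1) ^ 3)⁻¹) fun n => by positivity).mpr ?_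
  · simpa using h
  have h2 := (summable_nat_add_iff 1).mpr (Real.summable_nat_pow_inv.mpr (one_lt_two))
  refine h2.congr fun n => ?_
  have : (n : ℝ) + 1 ≠ 0 := by positivity
  simp
  field_simp

/-- The coefficient of `zernike κ R n k` in the expansion of `f`. -/
noncomputable def zernikeCoeff (hR : 0 < R) (hκ : R ^ 2 * |κ| < 1) (f : L2 κ R)
    (i : Σ n : ℕ, Fin (n + 1)) : ℂ :=
  (zernikeNorm κ R i.1 : ℂ)⁻¹ * inner ℂ (zernikeBasis hR hκ i) f

lemma exists_summable_bound (hR : 0 < R) (hκ : R ^ 2 * |κ| < 1) {f : L2 κ R}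
    (hf : ∀ p : ℕ, f ∈ hilbertScale κ R p) (m : ℕ) :
    ∃ v : (Σ n : ℕ, Fin (n + 1)) → ℝ, Summable v ∧ ∀ i, ∀ z ∈ Metric.closedBall (0 : ℂ) 1,
      ‖iteratedFDeriv ℝ m (fun z => zernikeCoeff hR hκ f i * zernikePoly i.1 i.2 z) z‖ ≤ v i := by
  -- The exponent `2m + 5` pays `2m + 1` for the derivatives, `1` for the normalization and `3` for
  -- summability over the double index.
  obtain ⟨K, hK0, hK⟩ := norm_inner_zernikeBasis_le hR hκ (2 * m + 5) (hf _)
  refine ⟨_, summable_inv_cube.mul_left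
    ((zernikeNorm κ R 0)⁻¹ * K * (2 ^ m * 3 ^ (2 * m + 1))), fun i z hz => ?_⟩
  have hz' : ‖z‖ ≤ 1 := by simpa using hz
  have e : (fun z => zernikeCoeff hR hκ f i * zernikePoly i.1 i.2 z)
      = zernikeCoeff hR hκ f i • zernikePoly i.1 i.2 := rfl
  have hn : (0 : ℝ) < (i.1 : ℝ) + 1 := by positivity
  have hN := inv_pos.mpr (zernikeNorm_pos hR hκ i.1)
  have hN0 := inv_pos.mpr (zernikeNorm_pos hR hκ 0)
  rw [e, iteratedFDeriv_const_smul_apply ((contDiff_zernikePoly _ _).of_le (by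
    exact_mod_cast le_top)).contDiffAt, norm_smul, zernikeCoeff, norm_mul, ← Complex.ofReal_inv,
    Complex.norm_real, Real.norm_of_nonneg hN.le]
  calc (zernikeNorm κ R i.1)⁻¹ * ‖inner ℂ (zernikeBasis hR hκ i) f‖
        * ‖iteratedFDeriv ℝ m (zernikePoly i.1 i.2) z‖
      ≤ ((zernikeNorm κ R 0)⁻¹ * ((i.1 : ℝ) + 1)) * (K * (((i.1 : ℝ) + 1) ^ (2 * m + 5))⁻¹)
        * (2 ^ m * (3 * ((i.1 : ℝ) + 1)) ^ (2 * m + 1)) := by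
        gcongr
        · exact inv_zernikeNorm_le hR hκ i.1
        · exact hK i
        · exact norm_iteratedFDeriv_zernikePoly_le hz' m (Nat.le_of_lt_succ i.2.2)
    _ = (zernikeNorm κ R 0)⁻¹ * K * (2 ^ m * 3 ^ (2 * m + 1)) * (((i.1 : ℝ) + 1) ^ 3)⁻¹ := by
        have hp : ((i.1 : ℝ) + 1) ^ (2 * m + 5)
            = ((i.1 : ℝ) + 1) ^ (2 * m + 1) * ((i.1 : ℝ) + 1) * ((i.1 : ℝ) + 1) ^ 3 := by ring
        rw [hp, mul_pow, mul_inv, mul_inv]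
        field_simp

/-- Termwise integration, justified by the summable uniform bound `b` and the finiteness of the
measure. -/
lemma hasSum_integral_zernike (hR : 0 < R) (hκ : R ^ 2 * |κ| < 1)
    {c : (Σ n : ℕ, Fin (n + 1)) → ℂ} {b : (Σ n : ℕ, Fin (n + 1)) → ℝ} (hb : Summable b)
    (hcb : ∀ i, ∀ ζ ∈ Metric.closedBall (0 : ℂ) 1, ‖c i * zernikePoly i.1 i.2 ζ‖ ≤ b i)
    (j : Σ n : ℕ, Fin (n + 1)) :
    HasSum (fun i => c i * inner ℂ (smoothL2 hκ (isSmooth_zernike hR hκ j.1 j.2))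
        (smoothL2 hκ (isSmooth_zernike hR hκ i.1 i.2)))
      (∫ z, pull κ R (fun ζ => ∑' i, c i * zernikePoly i.1 i.2 ζ) z
        * starRingEnd ℂ (zernike κ R j.1 j.2 z) ∂(weightedVolume κ R)) := by
  have := isFiniteMeasure_weightedVolume hκ
  set h : ℂ → ℂ := fun z => weight κ z * starRingEnd ℂ (zernike κ R j.1 j.2 z) with hh
  have hs : IsSmooth R h :=
    (isSmooth_weight hκ).mul
      (Complex.conjCLE.contDiff.comp_contDiffOn (isSmooth_zernike hR hκ j.1 j.2))
  obtain ⟨C, hC⟩ := exists_bound_of_isSmooth hs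
  set F : (Σ n : ℕ, Fin (n + 1)) → ℂ → ℂ := fun i z =>
    c i * zernikePoly i.1 i.2 (diskMap κ R z) * h z with hF
  have hFs : ∀ i, IsSmooth R (F i) := fun i =>
    ((contDiff_const.isSmooth R).mul (ContDiffOn.comp (isSmooth_zernikePoly i.1 i.2)
      (isSmooth_diskMap hκ) (mapsTo_diskMap hR hκ))).mul hs
  have hFb : ∀ i, ∀ᵐ z ∂(weightedVolume κ R), ‖F i z‖ ≤ b i * C := fun i => by
    filter_upwards [ae_mem_disk κ R] with z hz
    rw [hF, norm_mul]
    have h1 := hcb i _ (mapsTo_diskMap hR hκ hz)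
    exact mul_le_mul h1 (hC z hz) (norm_nonneg _) ((norm_nonneg _).trans h1)
  have hFi : ∀ i, Integrable (F i) (weightedVolume κ R) := fun i =>
    (memLp_of_isSmooth hκ (hFs i)).integrable (by norm_num)
  have key := hasSum_integral_of_summable_integral_norm hFi
    (Summable.of_nonneg_of_le (fun i => integral_nonneg fun _ => norm_nonneg _)
      (fun i => (le_abs_self _).trans (norm_integral_le_of_norm_le_const (f := fun z => ‖F i z‖)
        ((hFb i).mono fun z hz => by rwa [norm_norm]))) ((hb.mul_right C).mul_right _))
  have e1 : ∀ i, ∫ z, F i z ∂(weightedVolume κ R)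
      = c i * inner ℂ (smoothL2 hκ (isSmooth_zernike hR hκ j.1 j.2))
        (smoothL2 hκ (isSmooth_zernike hR hκ i.1 i.2)) := fun i => by
    rw [inner_smoothL2, ← integral_const_mul]
    refine integral_congr_ae ((coeFn_smoothL2 hκ (isSmooth_zernike hR hκ i.1 i.2)).mono
      fun z hz => ?_)
    simp only [hz, hF, hh, zernike]
    ring
  have e2 : ∫ z, ∑' i, F i z ∂(weightedVolume κ R)
      = ∫ z, pull κ R (fun ζ => ∑' i, c i * zernikePoly i.1 i.2 ζ) z
        * starRingEnd ℂ (zernike κ R j.1 j.2 z) ∂(weightedVolume κ R) := by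
    congr 1
    ext z
    simp only [hF, pull, tsum_mul_right, hh]
    ring
  rw [← e2]
  simpa only [e1] using key

/-- The Zernike series of `f`, summed pointwise on the unit disk, is smooth by the derivative
bounds. Its pullback has the same Zernike coefficients as `f`, so completeness identifies the two.
-/
lemma mem_smoothFunctions (hR : 0 < R) (hκ : R ^ 2 * |κ| < 1) {f : L2 κ R}
    (hf : ∀ p : ℕ, f ∈ hilbertScale κ R p) : f ∈ smoothFunctions κ R := by
  have hv : IsSmooth 1 fun z => ∑' i, zernikeCoeff hR hκ f i * zernikePoly i.1 i.2 z :=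
    isSmooth_tsum (fun i => contDiff_const.mul (contDiff_zernikePoly i.1 i.2))
      (exists_summable_bound hR hκ hf)
  have hu := isSmooth_pull hR hκ hv
  obtain ⟨b, hb, hcb⟩ := exists_summable_bound hR hκ hf 0
  simp only [norm_iteratedFDeriv_zero] at hcb
  refine ⟨_, hu, ?_⟩
  have hfu : f = smoothL2 hκ hu := by
    refine sub_eq_zero.mp (eq_zero_of_inner_zernikeVec hR hκ fun j => ?_)
    rw [← zernikeBasis_apply, inner_sub_right, sub_eq_zero, inner_zernikeBasis _ _ _ (smoothL2 _ _)]
    have e : ∫ z, smoothL2 hκ hu z * starRingEnd ℂ (zernike κ R j.1 j.2 z) ∂(weightedVolume κ R)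
        = zernikeCoeff hR hκ f j * ((zernikeNorm κ R j.1 ^ 2 : ℝ) : ℂ) := by
      refine (integral_congr_ae ((coeFn_smoothL2 hκ hu).mono fun z hz =>
        congrArg (· * starRingEnd ℂ (zernike κ R j.1 j.2 z)) hz)).trans
        ((hasSum_integral_zernike hR hκ hb hcb j).unique ?_)
      rw [sq_zernikeNorm hR hκ]
      convert hasSum_single (f := fun i : Σ n : ℕ, Fin (n + 1) => zernikeCoeff hR hκ f i
        * inner ℂ (smoothL2 hκ (isSmooth_zernike hR hκ j.1 j.2))
        (smoothL2 hκ (isSmooth_zernike hR hκ i.1 i.2))) j ?_ using 2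
      · rw [inner_zernike hR hκ (Nat.le_of_lt_succ j.2.2) (Nat.le_of_lt_succ j.2.2),
          if_pos ⟨rfl, rfl⟩]
      · rintro ⟨n, k⟩ hne
        rw [inner_zernike hR hκ (Nat.le_of_lt_succ j.2.2) (Nat.le_of_lt_succ k.2), if_neg,
          mul_zero]
        rintro ⟨rfl, h⟩
        exact hne (by rw [Sigma.mk.injEq]; exact ⟨rfl, heq_of_eq (Fin.ext h.symm)⟩)
    rw [e, zernikeCoeff]
    have : (zernikeNorm κ R j.1 : ℂ) ≠ 0 := by exact_mod_cast (zernikeNorm_pos hR hκ _).ne'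
    push_cast
    field_simp
  have h := coeFn_smoothL2 hκ hu
  rwa [← hfu] at h

end Reconstruction

end GeodesicDisk

theorem lemma1 (κ R : ℝ) (hR : 0 < R) (hκ : R ^ 2 * |κ| < 1) :
    (∀ s : ℝ, 0 ≤ s →
      GeodesicDisk.hilbertScale κ R s = GeodesicDisk.zernikeScale κ R s) ∧
    (⋂ s ∈ Set.Ici (0 : ℝ), GeodesicDisk.hilbertScale κ R s)
      = GeodesicDisk.smoothFunctions κ R := by
  refine ⟨fun s _ => GeodesicDisk.hilbertScale_eq_zernikeScale hR hκ s, ?_⟩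
  refine Set.Subset.antisymm (fun f hf => ?_) (Set.subset_iInter₂ fun s _ =>
    GeodesicDisk.smoothFunctions_subset_hilbertScale hR hκ s)
  -- Integer orders already force smoothness.
  exact GeodesicDisk.mem_smoothFunctions hR hκ fun p =>
    Set.mem_iInter₂.mp hf p (Set.mem_Ici.mpr p.cast_nonneg)
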